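/- Let $m\in\mathbb C$ with $\operatorname{Re} m>-1$. On $C_c^\infty(0,\infty)$ consider the differential expression $$L_{m^2}=-\partial_x^2+\Big(-\frac14+m^2\Big)\frac1{x^2}.$$ In the Hilbert space $L^2[0,\infty)$ let $L_{m^2}^{\min}$ be the closure of $L_{m^2}$ restricted to $C_c^\infty(0,\infty)$, and let $L_{m^2}^{\max}$ be the operator $L_{m^2}$ (in the sense of distributions on $(0,\infty)$) with domain $\{f\in L^2[0,\infty) : L_{m^2}f\in L^2[0,\infty)\}$. Let $\xi$ be a smooth compactly supported cutoff equal to $1$ around $0$, and let $H_m$ be the restriction of $L_{m^2}^{\max}$ to the domain $$\operatorname{Dom}L_{m^2}^{\min}+\mathbb C\,x^{\frac12+m}\xi .$$ Let $k\in\mathbb C$ with $\operatorname{Re}k>0$. Then $k^2+H_m$ has a bounded inverse on $L^2[0,\infty)$, and $(k^2+H_m)^{-1}$ is the integral operator whose kernel is $$R_m(-k^2;x,y)=\begin{cases}\sqrt{xy}\,I_m(kx)K_m(ky) & \text{if } x<y,\\ \sqrt{xy}\,I_m(ky)K_m(kx) & \text{if } x>y;\end{cases}$$ that is, for every $f\in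 L^2[0,\infty)$ and almost every $x>0$, $\big((k^2+H_m)^{-1}f\big)(x)=\int_0^\infty R_m(-k^2;x,y)f(y)\,dy$, the integral being absolutely convergent. Here $$I_m(z)=\sum_{j=0}^\infty\frac{(z/2)^{m+2j}}{j!\,\Gamma(m+j+1)}$$ (principal branch) is the modified Bessel function and $$K_m(z)=\int_0^\infty e^{-z\cosh t}\cosh(mt)\,dt\qquad(\operatorname{Re}z>0)$$ is the MacDonald function. -/

import Mathlib

open MeasureTheory Set Filter Topology
open scoped ContDiff Distributions

noncomputable section

namespace BesselOp

/-! ### The Hilbert space and the differential expression -/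

/-- Lebesgue measure on the half-line `(0, ∞)`. -/
abbrev halfMeasure : Measure ℝ := volume.restrict (Ioi 0)

/-- The Hilbert space `L²[0, ∞)` of complex-valued functions. -/
abbrev L2 : Type := Lp ℂ 2 halfMeasure

/-- The open half-line `(0, ∞)`, as an open set; `𝓓(halfLine, ℂ)` is `C_c^∞(0, ∞)`. -/
def halfLine : TopologicalSpace.Opens ℝ := ⟨Ioi 0, isOpen_Ioi⟩

/-- The differential expression `L_α φ = -φ'' + (-1/4 + α) x⁻² φ`. -/
def diffExpr (α : ℂ) (φ : ℝ → ℂ) (x : ℝ) : ℂ :=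
  -deriv (deriv φ) x + (-1 / 4 + α) / (x : ℂ) ^ 2 * φ x

section Basic

variable (φ ψ : 𝓓(halfLine, ℂ))

theorem testFunction_contDiff : ContDiff ℝ ∞ φ := φ.contDiff'

theorem testFunction_differentiable : Differentiable ℝ φ :=
  (testFunction_contDiff φ).differentiable (by simp)

theorem testFunction_contDiff_deriv : ContDiff ℝ ∞ (deriv φ) :=
  (contDiff_infty_iff_deriv.1 (testFunction_contDiff φ)).2

theorem testFunction_differentiable_deriv : Differentiable ℝ (deriv φ) :=
  (testFunction_contDiff_deriv φ).differentiable (by simp)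

theorem testFunction_eq_zero {x : ℝ} (hx : x ∉ Ioi (0 : ℝ)) : φ x = 0 :=
  image_eq_zero_of_notMem_tsupport fun h => hx (φ.tsupport_subset' h)

theorem diffExpr_add (α : ℂ) : diffExpr α (φ + ψ : 𝓓(halfLine, ℂ)) =
    diffExpr α φ + diffExpr α ψ := by
  have h1 : deriv (⇑(φ + ψ)) = deriv φ + deriv ψ := by
    ext x
    exact deriv_add (testFunction_differentiable φ x) (testFunction_differentiable ψ x)
  ext x
  have h2 : deriv (deriv φ + deriv ψ) x = deriv (deriv φ) x + deriv (deriv ψ) x :=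
    deriv_add (testFunction_differentiable_deriv φ x) (testFunction_differentiable_deriv ψ x)
  have h3 : (φ + ψ) x = φ x + ψ x := rfl
  simp only [diffExpr, h1, h2, h3, Pi.add_apply]
  ring

theorem diffExpr_smul (α c : ℂ) : diffExpr α (c • φ : 𝓓(halfLine, ℂ)) =
    c • diffExpr α φ := by
  have h1 : deriv (⇑(c • φ)) = c • deriv φ := by
    ext x
    exact deriv_const_smul c (testFunction_differentiable φ x)
  ext x
  have h2 : deriv (c • deriv φ) x = c • deriv (deriv φ) x :=
    deriv_const_smul c (testFunction_differentiable_deriv φ x)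
  have h3 : (c • φ) x = c • φ x := rfl
  simp only [diffExpr, h1, h2, h3, Pi.smul_apply, smul_eq_mul]
  ring

theorem tsupport_diffExpr (α : ℂ) : tsupport (diffExpr α φ) ⊆ tsupport φ := by
  refine closure_minimal (fun x hx => ?_) (isClosed_tsupport _)
  by_contra h
  have h1 : deriv (deriv φ) x = 0 :=
    image_eq_zero_of_notMem_tsupport fun h' => h (tsupport_deriv_subset
      (tsupport_deriv_subset h'))
  exact hx (by simp [diffExpr, h1, image_eq_zero_of_notMem_tsupport h])

theorem continuous_diffExpr (α : ℂ) : Continuous (diffExpr α φ) := by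
  rw [continuous_iff_continuousAt]
  intro x
  by_cases hx : x ∈ tsupport φ
  · have hx0 : (0 : ℝ) < x := φ.tsupport_subset' hx
    have h2 : Continuous (deriv (deriv φ)) :=
      (contDiff_infty_iff_deriv.1 (testFunction_contDiff_deriv φ)).2.continuous
    have h3 : Continuous φ := (testFunction_contDiff φ).continuous
    have h4 : (x : ℂ) ^ 2 ≠ 0 := by simpa using hx0.ne'
    have h5 : ContinuousAt (fun x : ℝ => (-1 / 4 + α) / (x : ℂ) ^ 2) x :=
      ContinuousAt.div continuousAt_const (by fun_prop) h4
    exact h2.continuousAt.neg.add (h5.mul h3.continuousAt)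
  · have h1 : x ∉ tsupport (diffExpr α φ) := fun h => hx (tsupport_diffExpr φ α h)
    exact (notMem_tsupport_iff_eventuallyEq.1 h1).continuousAt

theorem hasCompactSupport_diffExpr (α : ℂ) : HasCompactSupport (diffExpr α φ) :=
  φ.hasCompactSupport'.of_isClosed_subset (isClosed_tsupport _) (tsupport_diffExpr φ α)

theorem memLp_diffExpr (α : ℂ) : MemLp (diffExpr α φ) 2 halfMeasure :=
  (continuous_diffExpr φ α).memLp_of_hasCompactSupport (hasCompactSupport_diffExpr φ α)

theorem memLp_testFunction : MemLp φ 2 halfMeasure :=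
  (testFunction_contDiff φ).continuous.memLp_of_hasCompactSupport φ.hasCompactSupport'

theorem integrable_mul_of_memLp (f : L2) {u : ℝ → ℂ} (hu : MemLp u 2 halfMeasure) :
    Integrable (fun x => f x * u x) halfMeasure :=
  (Lp.memLp f).integrable_mul hu

end Basic

/-! ### Minimal and maximal operators -/

/-- The graph of `L_α` on `C_c^∞(0, ∞)`. -/
def coreGraph (α : ℂ) : Submodule ℂ (L2 × L2) where
  carrier := {p | ∃ φ : 𝓓(halfLine, ℂ), p.1 =ᵐ[halfMeasure] φ ∧
    p.2 =ᵐ[halfMeasure] diffExpr α φ}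
  zero_mem' := by
    refine ⟨0, Lp.coeFn_zero _ _ _, ?_⟩
    have : diffExpr α (0 : 𝓓(halfLine, ℂ)) = 0 := by
      simpa using diffExpr_smul 0 α 0
    rw [this]
    exact Lp.coeFn_zero _ _ _
  add_mem' := by
    rintro ⟨a, b⟩ ⟨c, d⟩ ⟨φ, h1, h2⟩ ⟨ψ, h3, h4⟩
    refine ⟨φ + ψ, (Lp.coeFn_add a c).trans (h1.add h3), ?_⟩
    rw [diffExpr_add]
    exact (Lp.coeFn_add b d).trans (h2.add h4)
  smul_mem' := by
    rintro c ⟨a, b⟩ ⟨φ, h1, h2⟩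
    refine ⟨c • φ, (Lp.coeFn_smul c a).trans (h1.const_smul c), ?_⟩
    rw [diffExpr_smul]
    exact (Lp.coeFn_smul c b).trans (h2.const_smul c)

/-- The graph of the maximal operator: the pairs `(f, g)` in `L²` such that `L_α f = g` in the
sense of distributions on `(0, ∞)`. -/
def maxGraph (α : ℂ) : Submodule ℂ (L2 × L2) where
  carrier := {p | ∀ φ : 𝓓(halfLine, ℂ),
    ∫ x in Ioi (0 : ℝ), p.1 x * diffExpr α φ x = ∫ x in Ioi (0 : ℝ), p.2 x * φ x}
  zero_mem' := by
    intro φ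
    have h : ∀ u : ℝ → ℂ, ∫ x in Ioi (0 : ℝ), (0 : L2) x * u x = 0 := fun u => by
      rw [integral_congr_ae (g := fun _ => 0), integral_zero]
      filter_upwards [Lp.coeFn_zero ℂ 2 halfMeasure] with x hx
      rw [hx, Pi.zero_apply, zero_mul]
    exact (h _).trans (h _).symm
  add_mem' := by
    rintro ⟨a, b⟩ ⟨c, d⟩ h1 h2 φ
    have h : ∀ (a c : L2) {u : ℝ → ℂ}, MemLp u 2 halfMeasure →
        ∫ x in Ioi (0 : ℝ), (a + c : L2) x * u x =
          (∫ x in Ioi (0 : ℝ), a x * u x) + ∫ x in Ioi (0 : ℝ), c x * u x := fun a c u hu => by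
      rw [← integral_add (integrable_mul_of_memLp a hu) (integrable_mul_of_memLp c hu)]
      refine integral_congr_ae ?_
      filter_upwards [Lp.coeFn_add a c] with x hx
      rw [hx, Pi.add_apply, add_mul]
    have e1 := h1 φ
    have e2 := h2 φ
    simp only at e1 e2
    simp only [Prod.mk_add_mk]
    rw [h a c (memLp_diffExpr φ α), h b d (memLp_testFunction φ), e1, e2]
  smul_mem' := by
    rintro c ⟨a, b⟩ h1 φ
    have h : ∀ (a : L2) (u : ℝ → ℂ), ∫ x in Ioi (0 : ℝ), (c • a : L2) x * u x =
        c * ∫ x in Ioi (0 : ℝ), a x * u x := fun a u => by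
      rw [← integral_const_mul]
      refine integral_congr_ae ?_
      filter_upwards [Lp.coeFn_smul c a] with x hx
      rw [hx, Pi.smul_apply, smul_eq_mul, mul_assoc]
    have e1 := h1 φ
    simp only at e1
    simp only [Prod.smul_mk]
    rw [h, h, e1]

/-- The maximal operator `L_α^max`. -/
def LMax (α : ℂ) : L2 →ₗ.[ℂ] L2 := (maxGraph α).toLinearPMap

/-- The minimal operator `L_α^min`: the closure of `L_α` on `C_c^∞(0, ∞)`. -/
def LMin (α : ℂ) : L2 →ₗ.[ℂ] L2 := (coreGraph α).topologicalClosure.toLinearPMap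

/-! `maxGraph α` is closed, single-valued and contains `coreGraph α`, so that the two operators
above have exactly the graphs they are built from. -/

theorem maxGraph_single_valued (α : ℂ) (p : L2 × L2) (hp : p ∈ maxGraph α) (h0 : p.1 = 0) :
    p.2 = 0 := by
  obtain ⟨f, g⟩ := p
  simp only at h0
  subst h0
  have hp' : ∀ φ : 𝓓(halfLine, ℂ), ∫ x in Ioi (0 : ℝ), g x * φ x = 0 := fun φ => by
    rw [← hp φ, integral_congr_ae (g := fun _ => 0), integral_zero]
    filter_upwards [Lp.coeFn_zero ℂ 2 halfMeasure] with x hx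
    rw [hx, Pi.zero_apply, zero_mul]
  have hloc : LocallyIntegrableOn g (Ioi (0 : ℝ)) volume := by
    rw [locallyIntegrableOn_iff (isOpen_Ioi.isLocallyClosed)]
    intro k hk hkc
    have h1 : MemLp g 2 (volume.restrict k) :=
      (Lp.memLp g).mono_measure (Measure.restrict_mono hk le_rfl)
    have : IsFiniteMeasure (volume.restrict k) :=
      ⟨by simpa using hkc.measure_lt_top⟩
    exact h1.integrable (by norm_num)
  have key := isOpen_Ioi.ae_eq_zero_of_integral_contDiff_smul_eq_zero hloc (fun u hu hc hs => by
    let φ : 𝓓(halfLine, ℂ) :=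
      { toFun := fun x => (u x : ℂ)
        contDiff' := Complex.ofRealCLM.contDiff.comp hu
        hasCompactSupport' := hc.comp_left (g := fun t : ℝ => (t : ℂ)) (by simp)
        tsupport_subset' := (tsupport_comp_subset (g := fun t : ℝ => (t : ℂ)) (by simp) u).trans hs }
    have h1 := hp' φ
    rw [← h1, setIntegral_eq_integral_of_forall_compl_eq_zero]
    · refine integral_congr_ae (Eventually.of_forall fun x => ?_)
      change u x • g x = g x * (u x : ℂ)
      rw [Complex.real_smul, mul_comm]
    · intro x hx
      rw [testFunction_eq_zero φ hx, mul_zero])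
  refine Lp.ext ?_
  have h2 : ∀ᵐ x ∂halfMeasure, g x = 0 := (ae_restrict_iff' measurableSet_Ioi).2 key
  filter_upwards [h2, Lp.coeFn_zero ℂ 2 halfMeasure] with x hx h0
  rw [hx, h0, Pi.zero_apply]

theorem isClosed_maxGraph (α : ℂ) : IsClosed (maxGraph α : Set (L2 × L2)) := by
  have hc : ∀ {u : ℝ → ℂ}, MemLp u 2 halfMeasure →
      Continuous fun f : L2 => ∫ x in Ioi (0 : ℝ), f x * u x := fun {u} hu => by
    have hv : MemLp (fun x => star (u x)) 2 halfMeasure := hu.star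
    have : (fun f : L2 => ∫ x in Ioi (0 : ℝ), f x * u x) =
        fun f : L2 => inner ℂ (hv.toLp _) f := by
      ext f
      rw [L2.inner_def]
      refine integral_congr_ae ?_
      filter_upwards [hv.coeFn_toLp] with x hx
      rw [hx]
      simp
    rw [this]
    fun_prop
  have : (maxGraph α : Set (L2 × L2)) = ⋂ φ : 𝓓(halfLine, ℂ), {p : L2 × L2 |
      ∫ x in Ioi (0 : ℝ), p.1 x * diffExpr α φ x = ∫ x in Ioi (0 : ℝ), p.2 x * φ x} := by
    ext p
    simp only [mem_iInter]
    rfl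
  rw [this]
  exact isClosed_iInter fun φ => isClosed_eq ((hc (memLp_diffExpr φ α)).comp continuous_fst)
    ((hc (memLp_testFunction φ)).comp continuous_snd)

theorem coreGraph_le_maxGraph (α : ℂ) : coreGraph α ≤ maxGraph α := by
  rintro ⟨f, g⟩ ⟨φ, h1, h2⟩ ψ
  simp only at h1 h2 ⊢
  have e1 : ∫ x in Ioi (0 : ℝ), f x * diffExpr α ψ x = ∫ x : ℝ, φ x * diffExpr α ψ x := by
    rw [← setIntegral_eq_integral_of_forall_compl_eq_zero (s := Ioi (0 : ℝ))
      (f := fun x => φ x * diffExpr α ψ x)]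
    · refine integral_congr_ae ?_
      filter_upwards [h1] with x hx
      rw [hx]
    · intro x hx
      rw [testFunction_eq_zero φ hx, zero_mul]
  have e2 : ∫ x in Ioi (0 : ℝ), g x * ψ x = ∫ x : ℝ, diffExpr α φ x * ψ x := by
    rw [← setIntegral_eq_integral_of_forall_compl_eq_zero (s := Ioi (0 : ℝ))
      (f := fun x => diffExpr α φ x * ψ x)]
    · refine integral_congr_ae ?_
      filter_upwards [h2] with x hx
      rw [hx]
    · intro x hx
      rw [testFunction_eq_zero ψ hx, mul_zero]
  rw [e1, e2]
  have hφ := testFunction_differentiable φ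
  have hψ := testFunction_differentiable ψ
  have hφ' := testFunction_differentiable_deriv φ
  have hψ' := testFunction_differentiable_deriv ψ
  have cφ2 : Continuous (deriv (deriv φ)) :=
    (contDiff_infty_iff_deriv.1 (testFunction_contDiff_deriv φ)).2.continuous
  have cψ2 : Continuous (deriv (deriv ψ)) :=
    (contDiff_infty_iff_deriv.1 (testFunction_contDiff_deriv ψ)).2.continuous
  have sφ : HasCompactSupport φ := φ.hasCompactSupport'
  have sψ : HasCompactSupport ψ := ψ.hasCompactSupport'
  have i1 : Integrable (⇑φ * deriv (deriv ψ)) :=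
    (hφ.continuous.mul cψ2).integrable_of_hasCompactSupport sφ.mul_right
  have i2 : Integrable (deriv φ * deriv ψ) :=
    (hφ'.continuous.mul hψ'.continuous).integrable_of_hasCompactSupport sψ.deriv.mul_left
  have i3 : Integrable (⇑φ * deriv ψ) :=
    (hφ.continuous.mul hψ'.continuous).integrable_of_hasCompactSupport sφ.mul_right
  have i4 : Integrable (deriv (deriv φ) * ⇑ψ) :=
    (cφ2.mul hψ.continuous).integrable_of_hasCompactSupport sψ.mul_left
  have i5 : Integrable (deriv φ * ⇑ψ) :=
    (hφ'.continuous.mul hψ.continuous).integrable_of_hasCompactSupport sψ.mul_left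
  have p1 := integral_mul_deriv_eq_deriv_mul_of_integrable
    (fun x _ => (hφ x).hasDerivAt) (fun x _ => (hψ' x).hasDerivAt) i1 i2 i3
  have p2 := integral_mul_deriv_eq_deriv_mul_of_integrable
    (fun x _ => (hφ' x).hasDerivAt) (fun x _ => (hψ x).hasDerivAt) i2 i4 i5
  have q : ∫ x, φ x * deriv (deriv ψ) x = ∫ x, deriv (deriv φ) x * ψ x := by
    rw [p1, p2, neg_neg]
  have j1 : Integrable (fun x => φ x * diffExpr α ψ x) :=
    (hφ.continuous.mul (continuous_diffExpr ψ α)).integrable_of_hasCompactSupport sφ.mul_right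
  have j2 : Integrable (fun x => diffExpr α φ x * ψ x) :=
    ((continuous_diffExpr φ α).mul hψ.continuous).integrable_of_hasCompactSupport sψ.mul_left
  rw [← sub_eq_zero, ← integral_sub j1 j2]
  have : (fun x => φ x * diffExpr α ψ x - diffExpr α φ x * ψ x) =
      fun x => deriv (deriv φ) x * ψ x - φ x * deriv (deriv ψ) x := by
    ext x
    simp only [diffExpr]
    ring
  rw [this]
  exact (integral_sub i4 i1).trans (sub_eq_zero.2 q.symm)

theorem closure_coreGraph_le_maxGraph (α : ℂ) :
    (coreGraph α).topologicalClosure ≤ maxGraph α :=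
  Submodule.topologicalClosure_minimal _ (coreGraph_le_maxGraph α) (isClosed_maxGraph α)

theorem LMax_graph (α : ℂ) : (LMax α).graph = maxGraph α :=
  Submodule.toLinearPMap_graph_eq _ (maxGraph_single_valued α)

theorem LMin_graph (α : ℂ) : (LMin α).graph = (coreGraph α).topologicalClosure :=
  Submodule.toLinearPMap_graph_eq _ fun p hp =>
    maxGraph_single_valued α p (closure_coreGraph_le_maxGraph α hp)

/-! ### The homogeneous operators `H_m` -/

/-- A smooth compactly supported cutoff on `[0, ∞)` that equals `1` around `0`. -/
def IsCutoff (ξ : ℝ → ℝ) : Prop :=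
  ContDiff ℝ ∞ ξ ∧ HasCompactSupport ξ ∧ ∀ᶠ x in 𝓝 0, ξ x = 1

/-- The line `ℂ x^{1/2+m} ξ` in `L²`. -/
def boundaryLine (m : ℂ) (ξ : ℝ → ℝ) : Submodule ℂ L2 :=
  Submodule.span ℂ {u : L2 | u =ᵐ[halfMeasure] fun x => (x : ℂ) ^ (1 / 2 + m) * (ξ x : ℂ)}

/-- The operator `H_m`: the restriction of `L_{m²}^max` to `Dom L_{m²}^min + ℂ x^{1/2+m} ξ`. -/
def H (m : ℂ) (ξ : ℝ → ℝ) : L2 →ₗ.[ℂ] L2 :=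
  (LMax (m ^ 2)).domRestrict ((LMin (m ^ 2)).domain ⊔ boundaryLine m ξ)

/-! ### Modified Bessel functions -/

/-- The modified Bessel function `I_m(z) = ∑ⱼ (z/2)^{m+2j} / (j! Γ(m+j+1))` (principal branch of
the power; `1/Γ` vanishes at the poles of `Γ`, in agreement with Mathlib's conventions). -/
def besselI (m z : ℂ) : ℂ :=
  ∑' j : ℕ, (z / 2) ^ m * (z / 2) ^ (2 * j) / ((Nat.factorial j : ℂ) * Complex.Gamma (m + j + 1))

/-- The MacDonald function `K_m(z) = ∫₀^∞ e^{-z cosh t} cosh(m t) dt`, for `Re z > 0`. -/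
def besselK (m z : ℂ) : ℂ :=
  ∫ t in Ioi (0 : ℝ), Complex.exp (-z * (Real.cosh t : ℂ)) * Complex.cosh (m * t)

/-! ### Resolvents and integral kernels -/

/-- `R` is the bounded operator `(c + A)⁻¹`, i.e. a bounded two-sided inverse of
`c + A : Dom A → E`. -/
def IsBoundedInverse {E : Type*} [NormedAddCommGroup E] [NormedSpace ℂ E]
    (A : E →ₗ.[ℂ] E) (c : ℂ) (R : E →L[ℂ] E) : Prop :=
  (∀ u : A.domain, R (c • (u : E) + A u) = u) ∧
    ∀ f : E, ∃ u : A.domain, (u : E) = R f ∧ c • (u : E) + A u = f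

/-- The bounded operator `R` on `L²[0, ∞)` has the integral kernel `G`: for each `f` in `L²`,
`(R f)(x) = ∫₀^∞ G(x, y) f(y) dy` for almost every `x`, with absolutely convergent integrals. -/
def HasIntegralKernel (R : L2 →L[ℂ] L2) (G : ℝ → ℝ → ℂ) : Prop :=
  AEStronglyMeasurable (Function.uncurry G) (halfMeasure.prod halfMeasure) ∧
    ∀ f : L2, ∀ᵐ x ∂halfMeasure,
      Integrable (fun y => G x y * f y) halfMeasure ∧ R f x = ∫ y in Ioi (0 : ℝ), G x y * f y

/-- The kernel `√(xy) I_m(kx) K_m(ky)` for `x < y`, `√(xy) I_m(ky) K_m(kx)` for `x > y`. (Its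
values on the diagonal, a null set, play no role.) -/
def resolventKernel (m k : ℂ) (x y : ℝ) : ℂ :=
  if x < y then (Real.sqrt (x * y) : ℂ) * besselI m (k * x) * besselK m (k * y)
  else (Real.sqrt (x * y) : ℂ) * besselI m (k * y) * besselK m (k * x)

end BesselOp

end

noncomputable section

namespace BesselOp

/-! ### The entire function behind `I_m` -/

/-- The coefficients of the entire function `z ↦ (z/2)^{-m} I_m(z)` in powers of `z²/4`. -/
def besselCoeff (m : ℂ) (j : ℕ) : ℂ := ((j.factorial : ℂ) * Complex.Gamma (m + j + 1))⁻¹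

/-- The entire function `F_m(s) = ∑ⱼ sʲ / (j! Γ(m+j+1))`. -/
def besselF (m s : ℂ) : ℂ := ∑' j : ℕ, besselCoeff m j * s ^ j

theorem summable_norm_besselCoeff (m : ℂ) (r : ℝ) (hr : 0 ≤ r) :
    Summable fun j => ‖besselCoeff m j‖ * r ^ j := by
  have h := Complex.radius_regularizedHGFunSeries_eq_top (a := 0) (b := {m + 1}) (by simp)
  have h2 := (Complex.regularizedHGFunSeries 0 {m + 1}).summable_norm_mul_pow (r := ⟨r, hr⟩)
    (by rw [h]; exact ENNReal.coe_lt_top)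
  refine h2.congr fun j => ?_
  rw [FormalMultilinearSeries.norm_apply_eq_norm_coef, Complex.regularizedHGFunSeries_coeff]
  simp only [Complex.regularizedHGFunCoeff, besselCoeff, norm_inv, norm_mul]
  simp [show m + 1 + (j : ℂ) = m + j + 1 by ring]
  exact Or.inl rfl

theorem summable_besselCoeff (m s : ℂ) : Summable fun j => besselCoeff m j * s ^ j := by
  refine Summable.of_norm ?_
  simpa using summable_norm_besselCoeff m ‖s‖ (norm_nonneg _)

theorem succ_mul_besselCoeff (m : ℂ) (j : ℕ) :
    ((j + 1 : ℕ) : ℂ) * besselCoeff m (j + 1) = besselCoeff (m + 1) j := by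
  have h : ((j + 1 : ℕ) : ℂ) ≠ 0 := by exact_mod_cast j.succ_ne_zero
  rw [besselCoeff, besselCoeff, Nat.factorial_succ]
  push_cast at h ⊢
  rw [mul_assoc, mul_inv, ← mul_assoc, mul_inv_cancel₀ h, one_mul]
  congr 3
  ring

theorem besselCoeff_eq (m : ℂ) (j : ℕ) :
    besselCoeff m j = (m + 1) * besselCoeff (m + 1) j + j * besselCoeff (m + 1) j := by
  have h := Complex.one_div_Gamma_eq_self_mul_one_div_Gamma_add_one (m + j + 1)
  rw [besselCoeff, besselCoeff, mul_inv, mul_inv, h]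
  rw [show m + 1 + j + 1 = m + j + 1 + 1 by ring]
  ring

theorem hasDerivAt_besselF (m s : ℂ) : HasDerivAt (besselF m) (besselF (m + 1) s) s := by
  set r : ℝ := ‖s‖ + 1
  have hr : 0 ≤ r := by positivity
  have hs : s ∈ Metric.ball (0 : ℂ) r := by simp [r]
  have key := hasDerivAt_tsum_of_isPreconnected
    (g := fun (j : ℕ) (z : ℂ) => besselCoeff m j * z ^ j)
    (g' := fun (j : ℕ) (z : ℂ) => besselCoeff m j * (j * z ^ (j - 1)))
    (u := fun j : ℕ => ‖besselCoeff m j‖ * (j * r ^ (j - 1)))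
    (t := Metric.ball (0 : ℂ) r) (y₀ := s) (y := s) ?_ Metric.isOpen_ball
    (convex_ball (0 : ℂ) r).isPreconnected
    (fun j z _ => (hasDerivAt_pow j z).const_mul _) ?_ hs (summable_besselCoeff m s) hs
  · have e : ∑' j : ℕ, besselCoeff m j * (j * s ^ (j - 1)) = besselF (m + 1) s := by
      have hsum : Summable fun j : ℕ => besselCoeff m j * (j * s ^ (j - 1)) := by
        rw [← summable_nat_add_iff 1]
        refine (summable_besselCoeff (m + 1) s).congr fun j => ?_
        rw [← succ_mul_besselCoeff]
        simp; ring
      rw [hsum.tsum_eq_zero_add]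
      simp only [CharP.cast_eq_zero, zero_mul, mul_zero, zero_add, besselF]
      refine tsum_congr fun j => ?_
      rw [← succ_mul_besselCoeff]
      simp; ring
    rw [← e]
    exact key
  · rw [← summable_nat_add_iff 1]
    refine (summable_norm_besselCoeff (m + 1) r hr).congr fun j => ?_
    rw [← succ_mul_besselCoeff, norm_mul]
    simp only [Complex.norm_natCast, add_tsub_cancel_right]
    ring
  · intro j z hz
    have hz' : ‖z‖ ≤ r := (mem_ball_zero_iff.1 hz).le
    simp only [norm_mul, norm_pow, Complex.norm_natCast]
    gcongr

theorem besselF_eq (m s : ℂ) :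
    besselF m s = (m + 1) * besselF (m + 1) s + s * besselF (m + 2) s := by
  have h1 := summable_besselCoeff (m + 1) s
  have h2 : Summable fun j : ℕ => (j : ℂ) * besselCoeff (m + 1) j * s ^ j := by
    rw [← summable_nat_add_iff 1]
    refine ((summable_besselCoeff (m + 1 + 1) s).mul_left s).congr fun j => ?_
    rw [← succ_mul_besselCoeff]
    ring
  have e : ∑' j : ℕ, (j : ℂ) * besselCoeff (m + 1) j * s ^ j = s * besselF (m + 2) s := by
    rw [h2.tsum_eq_zero_add, besselF, ← tsum_mul_left]
    simp only [CharP.cast_eq_zero, zero_mul, zero_add]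
    refine tsum_congr fun j => ?_
    rw [show m + 2 = m + 1 + 1 by ring, ← succ_mul_besselCoeff (m + 1)]
    ring
  rw [← e, besselF, besselF, ← tsum_mul_left, ← (h1.mul_left (m + 1)).tsum_add h2]
  refine tsum_congr fun j => ?_
  rw [besselCoeff_eq]
  ring

theorem continuous_besselF (m : ℂ) : Continuous (besselF m) :=
  continuous_iff_continuousAt.2 fun s => (hasDerivAt_besselF m s).continuousAt

theorem besselF_zero (m : ℂ) : besselF m 0 = (Complex.Gamma (m + 1))⁻¹ := by
  rw [besselF, tsum_eq_single 0 fun j hj => by simp [hj]]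
  simp [besselCoeff]

theorem besselI_eq (m z : ℂ) : besselI m z = (z / 2) ^ m * besselF m (z ^ 2 / 4) := by
  rw [besselI, besselF, ← tsum_mul_left]
  refine tsum_congr fun j => ?_
  rw [besselCoeff, pow_mul, div_eq_mul_inv, mul_assoc ((z / 2) ^ m), mul_comm _⁻¹]
  congr 3
  ring

theorem hasDerivAt_besselI {m z : ℂ} (hz : 0 < z.re) :
    HasDerivAt (besselI m) (besselI (m + 1) z + m / z * besselI m z) z := by
  have hz0 : z ≠ 0 := by rintro rfl; simp at hz
  have hz2 : z / 2 ≠ 0 := by simpa using hz0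
  have hs : z / 2 ∈ Complex.slitPlane := Or.inl (by simpa using hz)
  have h1 : HasDerivAt (fun z : ℂ => (z / 2) ^ m) (m * (z / 2) ^ (m - 1) * (1 / 2)) z :=
    ((hasDerivAt_id z).div_const 2).cpow_const hs
  have h2 : HasDerivAt (fun z : ℂ => besselF m (z ^ 2 / 4))
      (besselF (m + 1) (z ^ 2 / 4) * (2 * z / 4)) z := by
    have h := (hasDerivAt_pow 2 z).div_const 4
    simp only [Nat.cast_ofNat, Nat.add_one_sub_one, pow_one] at h
    exact (hasDerivAt_besselF m (z ^ 2 / 4)).comp z h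
  have h3 := h1.mul h2
  refine (h3.congr_deriv ?_).congr_of_eventuallyEq (Eventually.of_forall fun w => besselI_eq m w)
  rw [besselI_eq, besselI_eq, Complex.cpow_add _ _ hz2, Complex.cpow_sub _ _ hz2,
    Complex.cpow_one]
  field_simp
  ring

theorem hasDerivAt_besselI_add_one {m z : ℂ} (hz : 0 < z.re) :
    HasDerivAt (besselI (m + 1)) (besselI m z - (m + 1) / z * besselI (m + 1) z) z := by
  have hz0 : z ≠ 0 := by rintro rfl; simp at hz
  have hz2 : z / 2 ≠ 0 := by simpa using hz0
  refine (hasDerivAt_besselI hz).congr_deriv ?_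
  have h := besselF_eq m (z ^ 2 / 4)
  rw [besselI_eq, besselI_eq, besselI_eq, h, Complex.cpow_add _ _ hz2, Complex.cpow_add _ _ hz2,
    Complex.cpow_one, show m + 1 + 1 = m + 2 by ring]
  field_simp
  ring

/-! ### Integrals of the form `∫₀^∞ e^{-z cosh t} g(t) dt` -/

/-- Continuous functions of at most exponential growth on `[0, ∞)`. -/
def IsExpBounded (g : ℝ → ℂ) : Prop :=
  Continuous g ∧ ∃ C b : ℝ, ∀ t, 0 ≤ t → ‖g t‖ ≤ C * Real.exp (b * t)

theorem IsExpBounded.mul {g h : ℝ → ℂ} (hg : IsExpBounded g) (hh : IsExpBounded h) :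
    IsExpBounded fun t => g t * h t := by
  obtain ⟨gc, C, b, hC⟩ := hg
  obtain ⟨hc, D, d, hD⟩ := hh
  refine ⟨gc.mul hc, C * D, b + d, fun t ht => ?_⟩
  rw [norm_mul, add_mul, Real.exp_add]
  calc ‖g t‖ * ‖h t‖ ≤ (C * Real.exp (b * t)) * (D * Real.exp (d * t)) :=
        mul_le_mul (hC t ht) (hD t ht) (norm_nonneg _) ((norm_nonneg _).trans (hC t ht))
    _ = _ := by ring

theorem norm_cexp_mul_le (ν : ℂ) {t : ℝ} (ht : 0 ≤ t) :
    ‖Complex.exp (ν * t)‖ ≤ Real.exp (‖ν‖ * t) := by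
  rw [Complex.norm_exp]
  have := (Complex.abs_re_le_norm ν)
  have := (abs_le.1 this).2
  simp only [Complex.mul_re, Complex.ofReal_re, Complex.ofReal_im, mul_zero, sub_zero]
  gcongr

theorem norm_cosh_mul_le (ν : ℂ) {t : ℝ} (ht : 0 ≤ t) :
    ‖Complex.cosh (ν * t)‖ ≤ Real.exp (|ν.re| * t) := by
  have h1 : ‖Complex.exp (ν * t)‖ ≤ Real.exp (|ν.re| * t) := by
    rw [Complex.norm_exp]
    have := le_abs_self ν.re
    simp only [Complex.mul_re, Complex.ofReal_re, Complex.ofReal_im, mul_zero, sub_zero]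
    gcongr
  have h2 : ‖Complex.exp (-(ν * t))‖ ≤ Real.exp (|ν.re| * t) := by
    rw [Complex.norm_exp]
    have := neg_le_abs ν.re
    simp only [Complex.neg_re, Complex.mul_re, Complex.ofReal_re, Complex.ofReal_im, mul_zero,
      sub_zero, ← neg_mul]
    gcongr
  rw [Complex.cosh, norm_div]
  have := norm_add_le (Complex.exp (ν * t)) (Complex.exp (-(ν * t)))
  simp only [Complex.norm_ofNat]
  linarith

theorem isExpBounded_cosh (ν : ℂ) : IsExpBounded fun t => Complex.cosh (ν * t) :=
  ⟨by fun_prop, 1, |ν.re|, fun t ht => by rw [one_mul]; exact norm_cosh_mul_le ν ht⟩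

theorem isExpBounded_sinh (ν : ℂ) : IsExpBounded fun t => Complex.sinh (ν * t) := by
  refine ⟨by fun_prop, 1, ‖ν‖, fun t ht => ?_⟩
  have h1 := norm_cexp_mul_le ν ht
  have h2 := norm_cexp_mul_le (-ν) ht
  rw [norm_neg, neg_mul] at h2
  change ‖Complex.sinh (ν * t)‖ ≤ _
  rw [Complex.sinh, norm_div]
  have := norm_sub_le (Complex.exp (ν * t)) (Complex.exp (-(ν * t)))
  simp only [Complex.norm_ofNat]
  linarith

theorem isExpBounded_ofReal_cosh : IsExpBounded fun t => (Real.cosh t : ℂ) := by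
  simpa using isExpBounded_cosh 1

theorem isExpBounded_ofReal_sinh : IsExpBounded fun t => (Real.sinh t : ℂ) := by
  simpa using isExpBounded_sinh 1

theorem one_add_sq_le_cosh {t : ℝ} (ht : 0 ≤ t) : 1 + t ^ 2 / 2 ≤ Real.cosh t := by
  have h1 : t / 2 ≤ Real.sinh (t / 2) := Real.self_le_sinh_iff.2 (by positivity)
  have h2 := Real.cosh_two_mul (t / 2)
  have h3 := Real.cosh_sq (t / 2)
  rw [show 2 * (t / 2) = t by ring] at h2
  nlinarith

theorem neg_mul_cosh_add_le {x b t : ℝ} (hx : 0 < x) (ht : 0 ≤ t) :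
    -x * Real.cosh t + b * t ≤ (b + 1) ^ 2 / (2 * x) - t := by
  have h1 := one_add_sq_le_cosh ht
  have h2 : (b + 1) * t ≤ x * (t ^ 2 / 2) + (b + 1) ^ 2 / (2 * x) := by
    have : x * (t ^ 2 / 2) + (b + 1) ^ 2 / (2 * x) - (b + 1) * t
        = (x * t - (b + 1)) ^ 2 / (2 * x) := by
      field_simp
      ring
    have h3 : 0 ≤ (x * t - (b + 1)) ^ 2 / (2 * x) := by positivity
    linarith
  nlinarith

theorem norm_exp_neg_mul_cosh (z : ℂ) (t : ℝ) :
    ‖Complex.exp (-z * (Real.cosh t : ℂ))‖ = Real.exp (-z.re * Real.cosh t) := by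
  rw [Complex.norm_exp]
  simp

theorem exists_norm_expCosh_mul_le {g : ℝ → ℂ} (hg : IsExpBounded g) {x : ℝ} (hx : 0 < x) :
    ∃ C : ℝ, ∀ z : ℂ, x ≤ z.re → ∀ t : ℝ, 0 ≤ t →
      ‖Complex.exp (-z * (Real.cosh t : ℂ)) * g t‖ ≤ C * Real.exp (-t) := by
  obtain ⟨-, C, b, hC⟩ := hg
  refine ⟨C * Real.exp ((b + 1) ^ 2 / (2 * x)), fun z hz t ht => ?_⟩
  have hC0 : 0 ≤ C := by
    have := (norm_nonneg _).trans (hC 0 le_rfl)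
    simpa using this
  rw [norm_mul, norm_exp_neg_mul_cosh]
  calc Real.exp (-z.re * Real.cosh t) * ‖g t‖
      ≤ Real.exp (-x * Real.cosh t) * (C * Real.exp (b * t)) := by
        gcongr
        exact hC t ht
    _ = C * Real.exp (-x * Real.cosh t + b * t) := by rw [Real.exp_add]; ring
    _ ≤ C * Real.exp ((b + 1) ^ 2 / (2 * x) - t) := by
        gcongr
        exact neg_mul_cosh_add_le hx ht
    _ = _ := by rw [sub_eq_add_neg, Real.exp_add]; ring

theorem continuous_expCosh_mul {g : ℝ → ℂ} (hg : IsExpBounded g) (z : ℂ) :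
    Continuous fun t : ℝ => Complex.exp (-z * (Real.cosh t : ℂ)) * g t := by
  have := hg.1
  have h : Continuous Real.cosh := Real.continuous_cosh
  fun_prop

theorem integrableOn_expCosh_mul {g : ℝ → ℂ} (hg : IsExpBounded g) {z : ℂ} (hz : 0 < z.re) :
    IntegrableOn (fun t : ℝ => Complex.exp (-z * (Real.cosh t : ℂ)) * g t) (Ioi 0) := by
  obtain ⟨C, hC⟩ := exists_norm_expCosh_mul_le hg hz
  refine Integrable.mono' ((integrableOn_exp_neg_Ioi 0).const_mul C)
    (continuous_expCosh_mul hg z).aestronglyMeasurable ?_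
  filter_upwards [ae_restrict_mem measurableSet_Ioi] with t ht
  exact hC z le_rfl t (le_of_lt ht)

theorem hasDerivAt_integral_expCosh_mul {g : ℝ → ℂ} (hg : IsExpBounded g) {z : ℂ}
    (hz : 0 < z.re) :
    HasDerivAt (fun z : ℂ => ∫ t in Ioi (0 : ℝ), Complex.exp (-z * (Real.cosh t : ℂ)) * g t)
      (-∫ t in Ioi (0 : ℝ), Complex.exp (-z * (Real.cosh t : ℂ)) * ((Real.cosh t : ℂ) * g t)) z := by
  have hz2 : 0 < z.re / 2 := by positivity
  obtain ⟨C, hC⟩ := exists_norm_expCosh_mul_le (isExpBounded_ofReal_cosh.mul hg) hz2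
  have hs : {w : ℂ | z.re / 2 < w.re} ∈ 𝓝 z :=
    (isOpen_lt continuous_const Complex.continuous_re).mem_nhds (by simp; linarith)
  rw [← integral_neg]
  refine (hasDerivAt_integral_of_dominated_loc_of_deriv_le (μ := volume.restrict (Ioi (0 : ℝ)))
    (F := fun z t => Complex.exp (-z * (Real.cosh t : ℂ)) * g t)
    (F' := fun z t => -(Complex.exp (-z * (Real.cosh t : ℂ)) * ((Real.cosh t : ℂ) * g t)))
    (bound := fun t => C * Real.exp (-t)) hs
    (Eventually.of_forall fun w => (continuous_expCosh_mul hg w).aestronglyMeasurable)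
    (integrableOn_expCosh_mul hg hz)
    (continuous_expCosh_mul (isExpBounded_ofReal_cosh.mul hg) z).neg.aestronglyMeasurable ?_
    ((integrableOn_exp_neg_Ioi 0).const_mul C) ?_).2
  · filter_upwards [ae_restrict_mem measurableSet_Ioi] with t ht w hw
    rw [norm_neg]
    exact hC w (le_of_lt hw) t (le_of_lt ht)
  · refine Eventually.of_forall fun t w _ => ?_
    have h1 : HasDerivAt (fun w : ℂ => -w * (Real.cosh t : ℂ)) (-1 * (Real.cosh t : ℂ)) w :=
      (hasDerivAt_id w).neg.mul_const _
    exact (h1.cexp.mul_const (g t)).congr_deriv (by ring)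

theorem mul_integral_expCosh_sinh (ν : ℂ) {z : ℂ} (hz : 0 < z.re) :
    z * ∫ t in Ioi (0 : ℝ), Complex.exp (-z * (Real.cosh t : ℂ)) *
      ((Real.sinh t : ℂ) * Complex.sinh (ν * t)) = ν * besselK ν z := by
  have hs := isExpBounded_ofReal_sinh.mul (isExpBounded_sinh ν)
  have hc := isExpBounded_cosh ν
  have i1 := (integrableOn_expCosh_mul hc hz).const_mul ν
  have i2 := (integrableOn_expCosh_mul hs hz).const_mul z
  obtain ⟨C, hC⟩ := exists_norm_expCosh_mul_le (isExpBounded_sinh ν) hz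
  have key := integral_Ioi_of_hasDerivAt_of_tendsto (a := 0) (m := 0)
    (f := fun t : ℝ => Complex.exp (-z * (Real.cosh t : ℂ)) * Complex.sinh (ν * t))
    (f' := fun t : ℝ => ν * (Complex.exp (-z * (Real.cosh t : ℂ)) * Complex.cosh (ν * t)) -
      z * (Complex.exp (-z * (Real.cosh t : ℂ)) * ((Real.sinh t : ℂ) * Complex.sinh (ν * t))))
    (continuous_expCosh_mul (isExpBounded_sinh ν) z).continuousWithinAt ?_ (i1.sub i2) ?_
  · rw [integral_sub i1 i2, integral_const_mul, integral_const_mul] at key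
    simp only [Complex.ofReal_zero, mul_zero, Complex.sinh_zero, sub_zero] at key
    exact (sub_eq_zero.1 key).symm
  · intro t _
    have h1 : HasDerivAt (fun t : ℝ => -z * (Real.cosh t : ℂ)) (-z * (Real.sinh t : ℂ)) t :=
      ((Real.hasDerivAt_cosh t).ofReal_comp).const_mul _
    have h2 : HasDerivAt (fun t : ℝ => ν * (t : ℂ)) (ν * 1) t :=
      ((hasDerivAt_id t).ofReal_comp).const_mul ν
    have h3 := (Complex.hasDerivAt_sinh (ν * t)).comp t h2
    exact (h1.cexp.mul h3).congr_deriv (by simp only [Function.comp]; ring)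
  · refine squeeze_zero_norm' (a := fun t => C * Real.exp (-t)) ?_ ?_
    · filter_upwards [eventually_ge_atTop 0] with t ht
      exact hC z le_rfl t ht
    · simpa using (Real.tendsto_exp_neg_atTop_nhds_zero).const_mul C

/-! ### The MacDonald function -/

theorem hasDerivAt_besselK {m z : ℂ} (hz : 0 < z.re) :
    HasDerivAt (besselK m) (-besselK (m + 1) z + m / z * besselK m z) z := by
  have hz0 : z ≠ 0 := by rintro rfl; simp at hz
  refine (hasDerivAt_integral_expCosh_mul (isExpBounded_cosh m) hz).congr_deriv ?_
  have h := mul_integral_expCosh_sinh m hz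
  have i1 := integrableOn_expCosh_mul (isExpBounded_ofReal_cosh.mul (isExpBounded_cosh m)) hz
  have i2 := integrableOn_expCosh_mul (isExpBounded_ofReal_sinh.mul (isExpBounded_sinh m)) hz
  rw [div_mul_eq_mul_div, ← h, mul_div_cancel_left₀ _ hz0]
  have e : besselK (m + 1) z = (∫ t in Ioi (0 : ℝ), Complex.exp (-z * (Real.cosh t : ℂ)) *
        ((Real.cosh t : ℂ) * Complex.cosh (m * t))) +
      ∫ t in Ioi (0 : ℝ), Complex.exp (-z * (Real.cosh t : ℂ)) *
        ((Real.sinh t : ℂ) * Complex.sinh (m * t)) := by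
    rw [← integral_add i1 i2]
    refine integral_congr_ae (Eventually.of_forall fun t => ?_)
    simp only [add_mul, one_mul, Complex.cosh_add, Complex.ofReal_cosh, Complex.ofReal_sinh]
    ring
  rw [e]
  ring

theorem hasDerivAt_besselK_add_one {m z : ℂ} (hz : 0 < z.re) :
    HasDerivAt (besselK (m + 1)) (-besselK m z - (m + 1) / z * besselK (m + 1) z) z := by
  have hz0 : z ≠ 0 := by rintro rfl; simp at hz
  refine (hasDerivAt_integral_expCosh_mul (isExpBounded_cosh (m + 1)) hz).congr_deriv ?_
  have h := mul_integral_expCosh_sinh (m + 1) hz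
  have i1 := integrableOn_expCosh_mul
    (isExpBounded_ofReal_cosh.mul (isExpBounded_cosh (m + 1))) hz
  have i2 := integrableOn_expCosh_mul
    (isExpBounded_ofReal_sinh.mul (isExpBounded_sinh (m + 1))) hz
  rw [div_mul_eq_mul_div, ← h, mul_div_cancel_left₀ _ hz0]
  have e : besselK m z = (∫ t in Ioi (0 : ℝ), Complex.exp (-z * (Real.cosh t : ℂ)) *
        ((Real.cosh t : ℂ) * Complex.cosh ((m + 1) * t))) -
      ∫ t in Ioi (0 : ℝ), Complex.exp (-z * (Real.cosh t : ℂ)) *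
        ((Real.sinh t : ℂ) * Complex.sinh ((m + 1) * t)) := by
    rw [← integral_sub i1 i2]
    refine integral_congr_ae (Eventually.of_forall fun t => ?_)
    have h1 := Complex.cosh_sub ((m + 1) * t) t
    rw [show (m + 1) * (t : ℂ) - t = m * t by ring] at h1
    simp only [h1, Complex.ofReal_cosh, Complex.ofReal_sinh]
    ring
  rw [e]
  ring

/-- A pointwise bound of `K_m` near the origin. -/
theorem exists_norm_besselK_le_rpow {m : ℂ} {σ : ℝ} (hσ : |m.re| < σ) :
    ∃ C : ℝ, 0 ≤ C ∧ ∀ z : ℂ, 0 < z.re → ‖besselK m z‖ ≤ C * z.re ^ (-σ) := by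
  have hσ0 : 0 < σ := (abs_nonneg _).trans_lt hσ
  obtain ⟨B, hB0, hB⟩ : ∃ B : ℝ, 0 ≤ B ∧ ∀ s : ℝ, 0 < s → s ^ σ * Real.exp (-s) ≤ B := by
    obtain ⟨n, hn⟩ := exists_nat_gt σ
    refine ⟨1 + n.factorial, by positivity, fun s hs => ?_⟩
    rcases le_total s 1 with h1 | h1
    · have : s ^ σ * Real.exp (-s) ≤ 1 * 1 := by
        gcongr
        · exact Real.rpow_le_one hs.le h1 hσ0.le
        · exact Real.exp_le_one_iff.2 (by linarith)
      have : (0 : ℝ) ≤ n.factorial := by positivity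
      linarith
    · have h2 : s ^ σ ≤ s ^ n := by
        rw [← Real.rpow_natCast]
        exact Real.rpow_le_rpow_of_exponent_le h1 hn.le
      have h3 := Real.pow_div_factorial_le_exp s hs.le n
      rw [div_le_iff₀ (by positivity)] at h3
      have h4 : s ^ σ * Real.exp (-s) ≤ (Real.exp s * n.factorial) * Real.exp (-s) := by
        gcongr
        exact h2.trans h3
      have h5 : Real.exp s * n.factorial * Real.exp (-s) = n.factorial := by
        rw [mul_right_comm, ← Real.exp_add]
        simp
      linarith
  set δ := σ - |m.re|
  have hδ : 0 < δ := by simp only [δ]; linarith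
  have hint : IntegrableOn (fun t : ℝ => Real.exp (-δ * t)) (Ioi 0) :=
    exp_neg_integrableOn_Ioi 0 hδ
  refine ⟨B * 2 ^ σ * ∫ t in Ioi (0 : ℝ), Real.exp (-δ * t),
    mul_nonneg (by positivity) (integral_nonneg fun t => (Real.exp_pos _).le), fun z hz => ?_⟩
  rw [mul_right_comm, ← integral_const_mul]
  refine norm_integral_le_of_norm_le (hint.const_mul _) ?_
  filter_upwards [ae_restrict_mem measurableSet_Ioi] with t ht
  have ht0 : 0 ≤ t := le_of_lt ht
  rw [norm_mul, norm_exp_neg_mul_cosh]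
  set x := z.re
  have hc : Real.exp t / 2 ≤ Real.cosh t := by
    rw [Real.cosh_eq]
    have := Real.exp_pos (-t)
    linarith
  have h1 : Real.exp (-x * Real.cosh t) ≤ B * (x * Real.exp t / 2) ^ (-σ) := by
    have hs : 0 < x * Real.exp t / 2 := by positivity
    have h2 := hB _ hs
    have h3 : Real.exp (-x * Real.cosh t) ≤ Real.exp (-(x * Real.exp t / 2)) := by
      gcongr
      nlinarith
    refine h3.trans ?_
    rw [Real.rpow_neg hs.le, ← div_eq_mul_inv, le_div_iff₀ (Real.rpow_pos_of_pos hs _), mul_comm]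
    exact h2
  have h4 : (x * Real.exp t / 2) ^ (-σ) = 2 ^ σ * x ^ (-σ) * Real.exp (-σ * t) := by
    rw [Real.div_rpow (by positivity) (by norm_num), Real.mul_rpow hz.le (Real.exp_pos _).le,
      ← Real.exp_mul, Real.rpow_neg (by norm_num : (0 : ℝ) ≤ 2), div_inv_eq_mul, mul_comm t]
    ring
  calc Real.exp (-x * Real.cosh t) * ‖Complex.cosh (m * t)‖
      ≤ (B * (2 ^ σ * x ^ (-σ) * Real.exp (-σ * t))) * Real.exp (|m.re| * t) := by
        rw [← h4]
        gcongr
        exact norm_cosh_mul_le m ht0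
    _ = B * 2 ^ σ * x ^ (-σ) * (Real.exp (-σ * t) * Real.exp (|m.re| * t)) := by ring
    _ = _ := by rw [← Real.exp_add]; simp only [δ]; ring_nf

/-- Exponential decay of `K_m`. -/
theorem exists_norm_besselK_le_exp (m : ℂ) {κ : ℝ} (hκ : 0 < κ) :
    ∃ C : ℝ, 0 ≤ C ∧ ∀ z : ℂ, κ ≤ z.re →
      √z.re * ‖besselK m z‖ ≤ C * Real.exp (-z.re) := by
  set b := |m.re|
  refine ⟨Real.exp (b ^ 2 / κ) * √(2 * Real.pi), by positivity, fun z hz => ?_⟩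
  set x := z.re
  have hx : 0 < x := hκ.trans_le hz
  have hg : Integrable fun t : ℝ => Real.exp (-(x / 4) * t ^ 2) :=
    integrable_exp_neg_mul_sq (by positivity)
  have h1 : ‖besselK m z‖ ≤ ∫ t in Ioi (0 : ℝ),
      (Real.exp (-x) * Real.exp (b ^ 2 / κ)) * Real.exp (-(x / 4) * t ^ 2) := by
    refine norm_integral_le_of_norm_le (hg.integrableOn.const_mul _) ?_
    filter_upwards [ae_restrict_mem measurableSet_Ioi] with t ht
    have ht0 : 0 ≤ t := le_of_lt ht
    rw [norm_mul, norm_exp_neg_mul_cosh]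
    refine (mul_le_mul_of_nonneg_left (norm_cosh_mul_le m ht0) (Real.exp_pos _).le).trans ?_
    rw [← Real.exp_add, ← Real.exp_add, ← Real.exp_add]
    refine Real.exp_le_exp.2 ?_
    change -x * Real.cosh t + b * t ≤ _
    have h2 := one_add_sq_le_cosh ht0
    have h3 : b * t ≤ x / 4 * t ^ 2 + b ^ 2 / x := by
      have : x / 4 * t ^ 2 + b ^ 2 / x - b * t = (x * t / 2 - b) ^ 2 / x := by
        field_simp
        ring
      have h4 : 0 ≤ (x * t / 2 - b) ^ 2 / x := by positivity
      linarith
    have h5 : b ^ 2 / x ≤ b ^ 2 / κ := by gcongr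
    nlinarith
  rw [integral_const_mul, integral_gaussian_Ioi] at h1
  have h2 : √x * (√(Real.pi / (x / 4)) / 2) ≤ √(2 * Real.pi) := by
    rw [mul_div_assoc', ← Real.sqrt_mul hx.le]
    have : x * (Real.pi / (x / 4)) = 4 * Real.pi := by field_simp
    rw [this]
    rw [show 4 * Real.pi = 2 ^ 2 * Real.pi by ring, Real.sqrt_mul (by positivity),
      Real.sqrt_sq (by norm_num), mul_div_cancel_left₀ _ (by norm_num)]
    exact Real.sqrt_le_sqrt (by linarith [Real.pi_pos])
  calc √x * ‖besselK m z‖ ≤ √x * (Real.exp (-x) * Real.exp (b ^ 2 / κ) *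
        (√(Real.pi / (x / 4)) / 2)) := by gcongr
    _ = Real.exp (-x) * Real.exp (b ^ 2 / κ) * (√x * (√(Real.pi / (x / 4)) / 2)) := by ring
    _ ≤ Real.exp (-x) * Real.exp (b ^ 2 / κ) * √(2 * Real.pi) := by gcongr
    _ = _ := by ring

/-! ### The Wronskian of `I_m` and `K_m` -/

theorem cpow_mul_integral_expCosh_exp (ν : ℂ) {x : ℝ} (hx : 0 < x) :
    (x : ℂ) ^ ν * ∫ t in Ioi (0 : ℝ), Complex.exp (-x * (Real.cosh t : ℂ)) * Complex.exp (ν * t) =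
      ∫ y in Ioi x, (y : ℂ) ^ (ν - 1) * Complex.exp (-(1 / 2 : ℝ) * (y + x ^ 2 / y : ℝ)) := by
  set h : ℝ → ℂ := fun y => (y : ℂ) ^ (ν - 1) * Complex.exp (-(1 / 2 : ℝ) * (y + x ^ 2 / y : ℝ))
  have e1 : ∫ y in Ioi x, h y = ∫ y in Ioi (1 : ℝ), x • h (x * y) := by
    rw [integral_smul, integral_comp_mul_left_Ioi h 1 hx, smul_smul, mul_inv_cancel₀ hx.ne',
      one_smul, mul_one]
  have e2 := integral_comp_exp_Ioi (fun y => x • h (x * y)) 0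
  rw [Real.exp_zero] at e2
  rw [e1, ← e2, ← integral_const_mul]
  refine setIntegral_congr_fun measurableSet_Ioi fun t _ => ?_
  have hx0 : (x : ℂ) ≠ 0 := by exact_mod_cast hx.ne'
  have he : (0 : ℝ) < x * Real.exp t := by positivity
  have he0 : ((x * Real.exp t : ℝ) : ℂ) ≠ 0 := by exact_mod_cast he.ne'
  have c1 : ((x * Real.exp t : ℝ) : ℂ) ^ ν = (x : ℂ) ^ ν * Complex.exp (ν * t) := by
    rw [Complex.ofReal_mul, Complex.mul_cpow_ofReal_nonneg hx.le (Real.exp_pos t).le,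
      Complex.cpow_def_of_ne_zero (x := (Real.exp t : ℂ))
        (by exact_mod_cast (Real.exp_pos t).ne'),
      ← Complex.ofReal_log (Real.exp_pos t).le, Real.log_exp, mul_comm (t : ℂ)]
  have c2 : -(1 / 2 : ℝ) * (x * Real.exp t + x ^ 2 / (x * Real.exp t)) = -x * Real.cosh t := by
    rw [Real.cosh_eq, Real.exp_neg]
    have := (Real.exp_pos t).ne'
    field_simp
  have c3 : -((1 / 2 : ℝ) : ℂ) * ((x * Real.exp t + x ^ 2 / (x * Real.exp t) : ℝ) : ℂ) =
      -x * (Real.cosh t : ℂ) := by exact_mod_cast congrArg (fun r : ℝ => (r : ℂ)) c2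
  simp only [h, Complex.real_smul]
  rw [c3, Complex.cpow_sub _ _ he0, c1, Complex.cpow_one]
  push_cast at he0 ⊢
  field_simp

theorem tendsto_cpow_mul_integral_expCosh_exp {ν : ℂ} (hν : 0 < ν.re) :
    Tendsto (fun x : ℝ => (x : ℂ) ^ ν *
      ∫ t in Ioi (0 : ℝ), Complex.exp (-x * (Real.cosh t : ℂ)) * Complex.exp (ν * t))
      (𝓝[>] 0) (𝓝 (2 ^ ν * Complex.Gamma ν)) := by
  have hG := Complex.integral_cpow_mul_exp_neg_mul_Ioi hν (r := 1 / 2) (by norm_num)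
  have hint : IntegrableOn (fun y : ℝ => y ^ (ν.re - 1) * Real.exp (-(1 / 2) * y)) (Ioi 0) := by
    have := integrableOn_rpow_mul_exp_neg_mul_rpow (p := 1) (s := ν.re - 1) (b := 1 / 2)
      (by linarith) one_pos (by norm_num)
    simpa using this
  have key : Tendsto (fun x : ℝ => ∫ y in Ioi (0 : ℝ), (Ioi x).indicator (fun y : ℝ =>
      (y : ℂ) ^ (ν - 1) * Complex.exp (-(1 / 2 : ℝ) * (y + x ^ 2 / y : ℝ))) y)
      (𝓝[>] 0) (𝓝 (∫ y in Ioi (0 : ℝ), (y : ℂ) ^ (ν - 1) *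
        Complex.exp (-(((1 / 2 : ℝ) : ℂ) * y)))) := by
    refine tendsto_integral_filter_of_dominated_convergence
      (fun y : ℝ => y ^ (ν.re - 1) * Real.exp (-(1 / 2) * y)) ?_ ?_ hint ?_
    · refine Eventually.of_forall fun x =>
        (Measurable.indicator ?_ measurableSet_Ioi).aestronglyMeasurable
      fun_prop
    · filter_upwards [self_mem_nhdsWithin] with x hx
      filter_upwards [ae_restrict_mem measurableSet_Ioi] with y hy
      have hy0 : (0 : ℝ) < y := hy
      refine (norm_indicator_le_norm_self _ _).trans ?_
      rw [norm_mul, Complex.norm_cpow_eq_rpow_re_of_pos hy0, Complex.norm_exp]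
      simp only [Complex.sub_re, Complex.one_re]
      gcongr
      rw [← Complex.ofReal_neg, ← Complex.ofReal_mul, Complex.ofReal_re]
      have : 0 ≤ x ^ 2 / y := by positivity
      nlinarith
    · filter_upwards [ae_restrict_mem measurableSet_Ioi] with y hy
      have hy0 : (0 : ℝ) < y := hy
      have hc : ContinuousAt (fun x : ℝ => (y : ℂ) ^ (ν - 1) *
          Complex.exp (-(1 / 2 : ℝ) * (y + x ^ 2 / y : ℝ))) 0 := by fun_prop
      have hc' := hc.tendsto.mono_left (nhdsWithin_le_nhds (s := Ioi 0))
      have e : -(((1 / 2 : ℝ) : ℂ) * y) =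
          -((1 / 2 : ℝ) : ℂ) * ((y + (0 : ℝ) ^ 2 / y : ℝ) : ℂ) := by simp
      rw [e]
      refine hc'.congr' ?_
      have : ∀ᶠ x in 𝓝[>] (0 : ℝ), x < y :=
        nhdsWithin_le_nhds (Iio_mem_nhds hy0)
      filter_upwards [this] with x hx
      rw [indicator_of_mem (by exact hx)]
  have hG2 : (1 / ((1 / 2 : ℝ) : ℂ)) ^ ν * Complex.Gamma ν = 2 ^ ν * Complex.Gamma ν := by
    norm_num
  rw [← hG2, ← hG]
  refine key.congr' ?_
  filter_upwards [self_mem_nhdsWithin] with x hx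
  have hx0 : (0 : ℝ) < x := hx
  rw [cpow_mul_integral_expCosh_exp ν hx0, setIntegral_indicator measurableSet_Ioi,
    inter_eq_self_of_subset_right (Ioi_subset_Ioi hx0.le)]

theorem tendsto_cpow_mul_besselK {ν : ℂ} (hν : 0 < ν.re) :
    Tendsto (fun x : ℝ => (x : ℂ) ^ ν * besselK ν x) (𝓝[>] 0)
      (𝓝 (2 ^ ν * Complex.Gamma ν / 2)) := by
  have hb : ∀ μ : ℂ, IsExpBounded fun t => Complex.exp (μ * t) := fun μ =>
    ⟨by fun_prop, 1, ‖μ‖, fun t ht => by rw [one_mul]; exact norm_cexp_mul_le μ ht⟩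
  have h2 : Tendsto (fun x : ℝ => (x : ℂ) ^ ν *
      ∫ t in Ioi (0 : ℝ), Complex.exp (-x * (Real.cosh t : ℂ)) * Complex.exp (-ν * t))
      (𝓝[>] 0) (𝓝 0) := by
    have hlim : Tendsto (fun x : ℝ => x ^ ν.re * ∫ t in Ioi (0 : ℝ), Real.exp (-ν.re * t))
        (𝓝[>] 0) (𝓝 0) := by
      have : ContinuousAt (fun x : ℝ => x ^ ν.re) 0 :=
        Real.continuousAt_rpow_const _ _ (Or.inr hν.le)
      have := (this.tendsto.mono_left (nhdsWithin_le_nhds (s := Ioi 0))).mul_const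
        (∫ t in Ioi (0 : ℝ), Real.exp (-ν.re * t))
      simpa [Real.zero_rpow hν.ne'] using this
    refine squeeze_zero_norm' ?_ hlim
    filter_upwards [self_mem_nhdsWithin] with x hx
    have hx0 : (0 : ℝ) < x := hx
    rw [norm_mul, Complex.norm_cpow_eq_rpow_re_of_pos hx0]
    gcongr
    refine norm_integral_le_of_norm_le (exp_neg_integrableOn_Ioi 0 hν) ?_
    filter_upwards [ae_restrict_mem measurableSet_Ioi] with t ht
    rw [norm_mul, norm_exp_neg_mul_cosh, Complex.norm_exp]
    have h1 : Real.exp (-(x : ℂ).re * Real.cosh t) ≤ 1 := by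
      refine Real.exp_le_one_iff.2 ?_
      have := Real.cosh_pos t
      rw [Complex.ofReal_re]
      nlinarith
    refine (mul_le_mul_of_nonneg_right h1 (Real.exp_pos _).le).trans ?_
    simp
  have h3 := ((tendsto_cpow_mul_integral_expCosh_exp hν).add h2).div_const 2
  rw [add_zero] at h3
  refine h3.congr' ?_
  filter_upwards [self_mem_nhdsWithin] with x hx
  have hx0 : 0 < (x : ℂ).re := by simpa using hx
  have e : besselK ν x =
      ((∫ t in Ioi (0 : ℝ), Complex.exp (-x * (Real.cosh t : ℂ)) * Complex.exp (ν * t)) +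
      ∫ t in Ioi (0 : ℝ), Complex.exp (-x * (Real.cosh t : ℂ)) * Complex.exp (-ν * t)) / 2 := by
    rw [← integral_add (integrableOn_expCosh_mul (hb ν) hx0)
      (integrableOn_expCosh_mul (hb (-ν)) hx0), ← integral_div]
    refine integral_congr_ae (Eventually.of_forall fun t => ?_)
    simp only [Complex.cosh, neg_mul]
    ring
  rw [e]
  ring

theorem exists_norm_besselI_le (m : ℂ) :
    ∃ C : ℝ, 0 ≤ C ∧ ∀ x : ℝ, 0 < x → x ≤ 1 → ‖besselI m x‖ ≤ C * x ^ m.re := by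
  obtain ⟨C, hC⟩ := (isCompact_closedBall (0 : ℂ) 1).exists_bound_of_continuousOn
    (continuous_besselF m).continuousOn
  refine ⟨‖(1 / 2 : ℂ) ^ m‖ * C, mul_nonneg (norm_nonneg _)
    ((norm_nonneg _).trans (hC 0 (by simp))), fun x hx hx1 => ?_⟩
  have e : ((x : ℂ) / 2) ^ m = (x : ℂ) ^ m * (1 / 2 : ℂ) ^ m := by
    have := Complex.mul_cpow_ofReal_nonneg hx.le (by norm_num : (0 : ℝ) ≤ 1 / 2) m
    push_cast at this
    rw [← this]
    ring_nf
  rw [besselI_eq, norm_mul, e, norm_mul, Complex.norm_cpow_eq_rpow_re_of_pos hx]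
  have h1 : ‖besselF m ((x : ℂ) ^ 2 / 4)‖ ≤ C := by
    refine hC _ ?_
    rw [mem_closedBall_zero_iff, norm_div, norm_pow, Complex.norm_real, Real.norm_of_nonneg hx.le]
    simp only [Complex.norm_ofNat]
    nlinarith
  calc x ^ m.re * ‖(1 / 2 : ℂ) ^ m‖ * ‖besselF m ((x : ℂ) ^ 2 / 4)‖
      ≤ x ^ m.re * ‖(1 / 2 : ℂ) ^ m‖ * C := by gcongr
    _ = _ := by ring

theorem tendsto_wronskian {m : ℂ} (hm : -1 < m.re) :
    Tendsto (fun x : ℝ => (x : ℂ) * (besselI (m + 1) x * besselK m x +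
      besselI m x * besselK (m + 1) x)) (𝓝[>] 0) (𝓝 1) := by
  have h1 : Tendsto (fun x : ℝ => (x : ℂ) * (besselI (m + 1) x * besselK m x))
      (𝓝[>] 0) (𝓝 0) := by
    obtain ⟨σ, hσ1, hσ2⟩ : ∃ σ, |m.re| < σ ∧ σ < 2 + m.re := by
      refine exists_between ?_
      rw [abs_lt]
      constructor <;> linarith
    obtain ⟨C, hC0, hC⟩ := exists_norm_besselI_le (m + 1)
    obtain ⟨D, hD0, hD⟩ := exists_norm_besselK_le_rpow hσ1
    have hp : 0 < 2 + m.re - σ := by linarith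
    have hlim : Tendsto (fun x : ℝ => C * D * x ^ (2 + m.re - σ)) (𝓝[>] 0) (𝓝 0) := by
      have : ContinuousAt (fun x : ℝ => x ^ (2 + m.re - σ)) 0 :=
        Real.continuousAt_rpow_const _ _ (Or.inr hp.le)
      have := (this.tendsto.mono_left (nhdsWithin_le_nhds (s := Ioi 0))).const_mul (C * D)
      simpa [Real.zero_rpow hp.ne'] using this
    refine squeeze_zero_norm' ?_ hlim
    have h1 : ∀ᶠ x in 𝓝[>] (0 : ℝ), x < 1 := nhdsWithin_le_nhds (Iio_mem_nhds one_pos)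
    filter_upwards [self_mem_nhdsWithin, h1] with x hx hx1
    have hx0 : (0 : ℝ) < x := hx
    rw [norm_mul, norm_mul, Complex.norm_real, Real.norm_of_nonneg hx0.le]
    calc x * (‖besselI (m + 1) x‖ * ‖besselK m x‖)
        ≤ x * ((C * x ^ (m.re + 1)) * (D * x ^ (-σ))) := by
          gcongr
          · simpa using hC x hx0 hx1.le
          · simpa using hD x (by simpa using hx0)
      _ = C * D * (x ^ (1 : ℝ) * x ^ (m.re + 1) * x ^ (-σ)) := by rw [Real.rpow_one]; ring
      _ = _ := by
          rw [← Real.rpow_add hx0, ← Real.rpow_add hx0]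
          ring_nf
  have hG : Complex.Gamma (m + 1) ≠ 0 :=
    Complex.Gamma_ne_zero_of_re_pos (by simp; linarith)
  have h2 : Tendsto (fun x : ℝ => (x : ℂ) * (besselI m x * besselK (m + 1) x))
      (𝓝[>] 0) (𝓝 1) := by
    have hK := tendsto_cpow_mul_besselK (ν := m + 1) (by simp; linarith)
    have hF : Tendsto (fun x : ℝ => besselF m ((x : ℂ) ^ 2 / 4)) (𝓝[>] 0)
        (𝓝 (besselF m (((0 : ℝ) : ℂ) ^ 2 / 4))) := by
      have : Continuous fun x : ℝ => besselF m ((x : ℂ) ^ 2 / 4) :=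
        (continuous_besselF m).comp (by fun_prop)
      exact (this.tendsto 0).mono_left nhdsWithin_le_nhds
    have h3 := ((hF.mul hK).const_mul ((1 / 2 : ℂ) ^ m))
    have e0 : (1 / 2 : ℂ) ^ m * (besselF m (((0 : ℝ) : ℂ) ^ 2 / 4) *
        (2 ^ (m + 1) * Complex.Gamma (m + 1) / 2)) = 1 := by
      have : (1 / 2 : ℂ) ^ m * 2 ^ m = 1 := by
        have := Complex.mul_cpow_ofReal_nonneg (by norm_num : (0 : ℝ) ≤ 1 / 2)
          (by norm_num : (0 : ℝ) ≤ 2) m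
        push_cast at this
        rw [← this]
        norm_num
      rw [Complex.ofReal_zero, zero_pow two_ne_zero, zero_div, besselF_zero,
        Complex.cpow_add _ _ two_ne_zero, Complex.cpow_one]
      field_simp
      linear_combination this
    rw [e0] at h3
    refine h3.congr' ?_
    filter_upwards [self_mem_nhdsWithin] with x hx
    have hx0 : (0 : ℝ) < x := hx
    have e : ((x : ℂ) / 2) ^ m = (x : ℂ) ^ m * (1 / 2 : ℂ) ^ m := by
      have := Complex.mul_cpow_ofReal_nonneg hx0.le (by norm_num : (0 : ℝ) ≤ 1 / 2) m
      push_cast at this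
      rw [← this]
      ring_nf
    rw [besselI_eq, e, Complex.cpow_add _ _ (by exact_mod_cast hx0.ne'), Complex.cpow_one]
    ring
  simpa [mul_add] using h1.add h2

theorem besselI_besselK_wronskian {m z : ℂ} (hm : -1 < m.re) (hz : 0 < z.re) :
    z * (besselI (m + 1) z * besselK m z + besselI m z * besselK (m + 1) z) = 1 := by
  set U : Set ℂ := {z : ℂ | 0 < z.re}
  set w : ℂ → ℂ := fun z =>
    z * (besselI (m + 1) z * besselK m z + besselI m z * besselK (m + 1) z)
  have hU : IsOpen U := isOpen_lt continuous_const Complex.continuous_re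
  have hd : ∀ z ∈ U, HasDerivAt w 0 z := fun z hz => by
    have hz0 : z ≠ 0 := by rintro rfl; simp [U] at hz
    refine ((hasDerivAt_id z).mul (((hasDerivAt_besselI_add_one hz).mul
      (hasDerivAt_besselK hz)).add ((hasDerivAt_besselI hz).mul
      (hasDerivAt_besselK_add_one hz)))).congr_deriv ?_
    simp only [Pi.add_apply, Pi.mul_apply, id]
    field_simp
    ring
  have hc : ∀ x ∈ U, w x = w z := fun x hx =>
    hU.is_const_of_deriv_eq_zero (convex_halfSpace_re_gt 0).isPreconnected
      (fun z hz => (hd z hz).differentiableAt.differentiableWithinAt)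
      (fun z hz => (hd z hz).deriv) hx hz
  refine tendsto_nhds_unique (Tendsto.congr' ?_ (tendsto_const_nhds (x := w z)))
    (tendsto_wronskian hm)
  filter_upwards [self_mem_nhdsWithin] with x hx
  exact (hc x (by simpa [U] using hx)).symm

/-! ### Second order equations `u'' = q u` on the half-line -/

/-- `u' = u₁` and `u₁' = q u` on `(0, ∞)`. -/
def IsSolution (q u u₁ : ℝ → ℂ) : Prop :=
  ∀ x, 0 < x → HasDerivAt u (u₁ x) x ∧ HasDerivAt u₁ (q x * u x) x

theorem IsSolution.contDiffOn {q u u₁ : ℝ → ℂ} (h : IsSolution q u u₁)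
    (hq : ContDiffOn ℝ ∞ q (Ioi 0)) : ContDiffOn ℝ ∞ u (Ioi 0) := by
  have key : ∀ n : ℕ, ContDiffOn ℝ n u (Ioi 0) ∧ ContDiffOn ℝ n u₁ (Ioi 0) := by
    intro n
    induction n with
    | zero =>
      simp only [CharP.cast_eq_zero, contDiffOn_zero]
      exact ⟨fun x hx => (h x hx).1.continuousAt.continuousWithinAt,
        fun x hx => (h x hx).2.continuousAt.continuousWithinAt⟩
    | succ n ih =>
      push_cast
      rw [contDiffOn_succ_iff_deriv_of_isOpen isOpen_Ioi,
        contDiffOn_succ_iff_deriv_of_isOpen isOpen_Ioi]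
      refine ⟨⟨fun x hx => (h x hx).1.differentiableAt.differentiableWithinAt, by simp,
        ih.2.congr fun x hx => (h x hx).1.deriv⟩,
        ⟨fun x hx => (h x hx).2.differentiableAt.differentiableWithinAt, by simp,
        ((hq.of_le (by exact_mod_cast le_top)).mul ih.1).congr fun x hx => (h x hx).2.deriv⟩⟩
  exact contDiffOn_infty.2 fun n => (key n).1

theorem IsSolution.continuousOn {q u u₁ : ℝ → ℂ} (h : IsSolution q u u₁) :
    ContinuousOn u (Ioi 0) := fun x hx => (h x hx).1.continuousAt.continuousWithinAt

theorem IsSolution.continuousOn_deriv {q u u₁ : ℝ → ℂ} (h : IsSolution q u u₁) :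
    ContinuousOn u₁ (Ioi 0) := fun x hx => (h x hx).2.continuousAt.continuousWithinAt

/-- The coefficient of the equation `u'' = (k² + (m² - 1/4) / x²) u`. -/
def besselPotential (m k : ℂ) (x : ℝ) : ℂ := k ^ 2 + (-1 / 4 + m ^ 2) / (x : ℂ) ^ 2

theorem contDiffOn_besselPotential (m k : ℂ) : ContDiffOn ℝ ∞ (besselPotential m k) (Ioi 0) := by
  have h : ContDiffOn ℝ ∞ (fun x : ℝ => (x : ℂ) ^ 2) (Ioi 0) :=
    (Complex.ofRealCLM.contDiff.pow 2).contDiffOn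
  have e : besselPotential m k = fun x : ℝ => k ^ 2 + (-1 / 4 + m ^ 2) * ((x : ℂ) ^ 2)⁻¹ := by
    ext x
    rw [besselPotential, div_eq_mul_inv]
  rw [e]
  refine contDiffOn_const.add (contDiffOn_const.mul (h.inv fun x hx => ?_))
  have : (x : ℂ) ≠ 0 := by exact_mod_cast (ne_of_gt hx)
  exact pow_ne_zero 2 this

/-- Solutions of `u'' = (k² + c / x²) u` grow at most like `e^{Re k x}`. -/
theorem IsSolution.exists_norm_le_exp {m k : ℂ} (hk : 0 < k.re) {u u₁ : ℝ → ℂ}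
    (h : IsSolution (besselPotential m k) u u₁) :
    ∃ C : ℝ, 0 ≤ C ∧ ∀ x : ℝ, 1 ≤ x → ‖u x‖ ≤ C * Real.exp (k.re * x) := by
  have hk0 : k ≠ 0 := by rintro rfl; simp at hk
  set c : ℂ := -1 / 4 + m ^ 2
  set e : ℝ → ℂ := fun x => Complex.exp (-k * x)
  have he : ∀ x, HasDerivAt e (e x * (-k * 1)) x := fun x =>
    ((hasDerivAt_id x).ofReal_comp.const_mul (-k)).cexp
  set p : ℝ → ℂ := fun x => (u₁ x + k * u x) * e x
  set q : ℝ → ℂ := fun x => (u₁ x - k * u x) * e x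
  have hue : ∀ x, u x * e x = (p x - q x) / (2 * k) := fun x => by
    simp only [p, q]
    field_simp
    ring
  have hp : ∀ x : ℝ, 0 < x → HasDerivAt p (c / (x : ℂ) ^ 2 * ((p x - q x) / (2 * k))) x :=
    fun x hx => by
      refine (((h x hx).2.add ((h x hx).1.const_mul k)).mul (he x)).congr_deriv ?_
      rw [← hue]
      simp only [besselPotential, Pi.add_apply]
      ring
  have hq : ∀ x : ℝ, 0 < x →
      HasDerivAt q (c / (x : ℂ) ^ 2 * ((p x - q x) / (2 * k)) - 2 * k * q x) x :=
    fun x hx => by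
      refine (((h x hx).2.sub ((h x hx).1.const_mul k)).mul (he x)).congr_deriv ?_
      rw [← hue]
      simp only [besselPotential, q, Pi.sub_apply]
      ring
  set A : ℝ := 2 * ‖c‖ / ‖k‖
  have hkn : 0 < ‖k‖ := norm_pos_iff.2 hk0
  set E : ℝ → ℝ := fun x => ‖p x‖ ^ 2 + ‖q x‖ ^ 2
  have hanti : AntitoneOn (fun x => E x * Real.exp (A / x)) (Ici 1) := by
    have hd : ∀ x : ℝ, 0 < x → HasDerivAt (fun x => E x * Real.exp (A / x))
        ((2 * inner ℝ (p x) (c / (x : ℂ) ^ 2 * ((p x - q x) / (2 * k))) +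
          2 * inner ℝ (q x) (c / (x : ℂ) ^ 2 * ((p x - q x) / (2 * k)) - 2 * k * q x)) *
          Real.exp (A / x) + E x * (Real.exp (A / x) * (A * (-(x ^ 2)⁻¹)))) x := fun x hx => by
      have h2 : HasDerivAt (fun x : ℝ => A / x) (A * (-(x ^ 2)⁻¹)) x := by
        simpa [div_eq_mul_inv] using (hasDerivAt_inv hx.ne').const_mul A
      exact ((hp x hx).norm_sq.add (hq x hx).norm_sq).mul h2.exp
    refine antitoneOn_of_deriv_nonpos (convex_Ici 1) (fun x hx => ?_) (fun x hx => ?_)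
      (fun x hx => ?_)
    · exact (hd x (one_pos.trans_le hx)).continuousAt.continuousWithinAt
    · rw [interior_Ici] at hx
      exact (hd x (one_pos.trans hx)).differentiableAt.differentiableWithinAt
    · rw [interior_Ici] at hx
      have hx0 : 0 < x := one_pos.trans hx
      rw [(hd x hx0).deriv]
      set d : ℂ := c / (x : ℂ) ^ 2 * ((p x - q x) / (2 * k))
      have hdn : ‖d‖ ≤ ‖c‖ / x ^ 2 * ((‖p x‖ + ‖q x‖) / (2 * ‖k‖)) := by
        simp only [d, norm_mul, norm_div, norm_pow, Complex.norm_real, Complex.norm_ofNat,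
          Real.norm_of_nonneg hx0.le]
        gcongr
        exact norm_sub_le _ _
      have i1 : inner ℝ (p x) d ≤ ‖p x‖ * ‖d‖ := real_inner_le_norm _ _
      have i2 : inner ℝ (q x) d ≤ ‖q x‖ * ‖d‖ := real_inner_le_norm _ _
      have i3 : 0 ≤ inner ℝ (q x) (2 * k * q x) := by
        have : inner ℝ (q x) (2 * k * q x) = 2 * k.re * (‖q x‖ ^ 2) := by
          rw [Complex.inner, ← Complex.normSq_eq_norm_sq, Complex.normSq_apply]
          simp
          ring
        rw [this]
        positivity
      have i4 : 2 * inner ℝ (p x) d + 2 * inner ℝ (q x) (d - 2 * k * q x) ≤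
          E x * (A * (x ^ 2)⁻¹) := by
        rw [inner_sub_right]
        have s1 : 2 * ((‖p x‖ + ‖q x‖) * ‖d‖) ≤
            2 * ((‖p x‖ + ‖q x‖) * (‖c‖ / x ^ 2 * ((‖p x‖ + ‖q x‖) / (2 * ‖k‖)))) := by
          gcongr
        have s2 : 2 * ((‖p x‖ + ‖q x‖) * (‖c‖ / x ^ 2 * ((‖p x‖ + ‖q x‖) / (2 * ‖k‖)))) =
            (‖p x‖ + ‖q x‖) ^ 2 * (‖c‖ / ‖k‖ * (x ^ 2)⁻¹) := by
          field_simp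
        have s3 : (‖p x‖ + ‖q x‖) ^ 2 * (‖c‖ / ‖k‖ * (x ^ 2)⁻¹) ≤
            (2 * E x) * (‖c‖ / ‖k‖ * (x ^ 2)⁻¹) := by
          gcongr
          simp only [E]
          nlinarith [sq_nonneg (‖p x‖ - ‖q x‖)]
        have s4 : (2 * E x) * (‖c‖ / ‖k‖ * (x ^ 2)⁻¹) = E x * (A * (x ^ 2)⁻¹) := by
          simp only [A]
          ring
        nlinarith
      have hexp := Real.exp_pos (A / x)
      nlinarith
  set B : ℝ := E 1 * Real.exp (A / 1)
  have hE : ∀ x, 1 ≤ x → E x ≤ B := fun x hx => by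
    have h1 := hanti (self_mem_Ici) hx hx
    have h2 : 1 ≤ Real.exp (A / x) := Real.one_le_exp (by positivity)
    have h3 : 0 ≤ E x := by positivity
    simp only at h1
    nlinarith
  refine ⟨√(2 * B) / (2 * ‖k‖), by positivity, fun x hx => ?_⟩
  have h1 : ‖p x - q x‖ ≤ √(2 * B) := by
    refine Real.le_sqrt_of_sq_le ?_
    have h2 := norm_sub_le (p x) (q x)
    have h3 := hE x hx
    simp only [E] at h3
    nlinarith [sq_nonneg (‖p x‖ - ‖q x‖), norm_nonneg (p x - q x)]
  have h2 : ‖u x‖ * Real.exp (-k.re * x) ≤ √(2 * B) / (2 * ‖k‖) := by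
    have h3 := congrArg norm (hue x)
    rw [norm_mul, norm_div, norm_mul, Complex.norm_ofNat, Complex.norm_exp] at h3
    simp only [Complex.mul_re, Complex.neg_re, Complex.ofReal_re, Complex.ofReal_im, mul_zero,
      sub_zero] at h3
    rw [h3]
    gcongr
  calc ‖u x‖ = (‖u x‖ * Real.exp (-k.re * x)) * Real.exp (k.re * x) := by
        rw [mul_assoc, ← Real.exp_add]
        simp
    _ ≤ _ := by gcongr

/-! ### The two solutions built from Bessel functions -/

theorem hasDerivAt_sqrt_mul_ofReal {J : ℝ → ℂ} {J' : ℂ} {x : ℝ} (hx : 0 < x)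
    (h : HasDerivAt J J' x) :
    HasDerivAt (fun x : ℝ => (√x : ℂ) * J x) ((√x : ℂ) * (1 / (2 * x) * J x + J')) x := by
  have h1 := (Real.hasDerivAt_sqrt hx.ne').ofReal_comp
  refine (h1.mul h).congr_deriv ?_
  have hs : (√x : ℂ) ≠ 0 := by exact_mod_cast (Real.sqrt_pos.2 hx).ne'
  have hx0 : (x : ℂ) ≠ 0 := by exact_mod_cast hx.ne'
  have e : (√x : ℂ) ^ 2 = x := by exact_mod_cast Real.sq_sqrt hx.le
  push_cast
  field_simp
  rw [e]
  ring

theorem isSolution_sqrt_mul {m s : ℂ} {J J₁ : ℝ → ℂ}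
    (h : ∀ x, 0 < x → HasDerivAt J (s * J₁ x + m / x * J x) x)
    (h₁ : ∀ x, 0 < x → HasDerivAt J₁ (s * J x - (m + 1) / x * J₁ x) x) :
    IsSolution (besselPotential m s) (fun x => (√x : ℂ) * J x)
      (fun x => (√x : ℂ) * ((1 / 2 + m) / x * J x + s * J₁ x)) := by
  intro x hx
  have hx0 : (x : ℂ) ≠ 0 := by exact_mod_cast hx.ne'
  constructor
  · refine (hasDerivAt_sqrt_mul_ofReal hx (h x hx)).congr_deriv ?_
    field_simp
    ring
  · have hinv : HasDerivAt (fun x : ℝ => (1 / 2 + m) / (x : ℂ))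
        (((0 : ℂ) * x - (1 / 2 + m) * 1) / (x : ℂ) ^ 2) x :=
      (hasDerivAt_const x (1 / 2 + m)).div (hasDerivAt_id x).ofReal_comp hx0
    refine (hasDerivAt_sqrt_mul_ofReal hx ((hinv.mul (h x hx)).add
      ((h₁ x hx).const_mul s))).congr_deriv ?_
    simp only [besselPotential, Pi.add_apply, Pi.mul_apply]
    field_simp
    ring

/-- `√x I_m(k x)`. -/
def solI (m k : ℂ) (x : ℝ) : ℂ := (√x : ℂ) * besselI m (k * x)

/-- `√x K_m(k x)`. -/
def solK (m k : ℂ) (x : ℝ) : ℂ := (√x : ℂ) * besselK m (k * x)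

/-- The derivative of `solI`. -/
def solI' (m k : ℂ) (x : ℝ) : ℂ :=
  (√x : ℂ) * ((1 / 2 + m) / x * besselI m (k * x) + k * besselI (m + 1) (k * x))

/-- The derivative of `solK`. -/
def solK' (m k : ℂ) (x : ℝ) : ℂ :=
  (√x : ℂ) * ((1 / 2 + m) / x * besselK m (k * x) + -k * besselK (m + 1) (k * x))

section Solutions

variable {m k : ℂ}

theorem re_mul_ofReal_pos (hk : 0 < k.re) {x : ℝ} (hx : 0 < x) : 0 < (k * x).re := by
  simpa using mul_pos hk hx

theorem hasDerivAt_comp_mul_ofReal {f : ℂ → ℂ} {f' k : ℂ} {x : ℝ} (h : HasDerivAt f f' (k * x)) :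
    HasDerivAt (fun x : ℝ => f (k * x)) (f' * k) x := by
  have h1 : HasDerivAt (fun x : ℝ => k * (x : ℂ)) (k * 1) x :=
    ((hasDerivAt_id x).ofReal_comp).const_mul k
  rw [mul_one] at h1
  exact h.comp x h1

theorem isSolution_solI (m : ℂ) (hk : 0 < k.re) :
    IsSolution (besselPotential m k) (solI m k) (solI' m k) := by
  have hk0 : k ≠ 0 := by rintro rfl; simp at hk
  refine isSolution_sqrt_mul (fun x hx => ?_) (fun x hx => ?_)
  · have hx0 : (x : ℂ) ≠ 0 := by exact_mod_cast hx.ne'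
    refine (hasDerivAt_comp_mul_ofReal
      (hasDerivAt_besselI (re_mul_ofReal_pos hk hx))).congr_deriv ?_
    field_simp
  · have hx0 : (x : ℂ) ≠ 0 := by exact_mod_cast hx.ne'
    refine (hasDerivAt_comp_mul_ofReal
      (hasDerivAt_besselI_add_one (re_mul_ofReal_pos hk hx))).congr_deriv ?_
    field_simp

theorem isSolution_solK (m : ℂ) (hk : 0 < k.re) :
    IsSolution (besselPotential m k) (solK m k) (solK' m k) := by
  have hk0 : k ≠ 0 := by rintro rfl; simp at hk
  have e : besselPotential m k = besselPotential m (-k) := by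
    ext x
    simp [besselPotential]
  rw [e]
  refine isSolution_sqrt_mul (fun x hx => ?_) (fun x hx => ?_)
  · have hx0 : (x : ℂ) ≠ 0 := by exact_mod_cast hx.ne'
    refine (hasDerivAt_comp_mul_ofReal
      (hasDerivAt_besselK (re_mul_ofReal_pos hk hx))).congr_deriv ?_
    field_simp
  · have hx0 : (x : ℂ) ≠ 0 := by exact_mod_cast hx.ne'
    refine (hasDerivAt_comp_mul_ofReal
      (hasDerivAt_besselK_add_one (re_mul_ofReal_pos hk hx))).congr_deriv ?_
    field_simp

theorem solI_solK_wronskian (hm : -1 < m.re) (hk : 0 < k.re) {x : ℝ} (hx : 0 < x) :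
    solI' m k x * solK m k x - solI m k x * solK' m k x = 1 := by
  have h := besselI_besselK_wronskian hm (re_mul_ofReal_pos hk hx)
  have e : (√x : ℂ) ^ 2 = x := by exact_mod_cast Real.sq_sqrt hx.le
  rw [← h, solI, solI', solK, solK', ← e]
  ring

theorem mul_ofReal_cpow (hk : 0 < k.re) (a : ℂ) {x : ℝ} (hx : 0 < x) :
    (k * x / 2) ^ a = (k / 2) ^ a * (x : ℂ) ^ a := by
  have hk0 : k / 2 ≠ 0 := by
    intro h
    have : k = 0 := by simpa using h
    simp [this] at hk
  have hx0 : (x : ℂ) ≠ 0 := by exact_mod_cast hx.ne'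
  rw [show k * x / 2 = (x : ℂ) * (k / 2) by ring, Complex.cpow_def_of_ne_zero (mul_ne_zero hx0 hk0),
    Complex.cpow_def_of_ne_zero hx0, Complex.cpow_def_of_ne_zero hk0,
    Complex.log_ofReal_mul hx hk0, ← Complex.exp_add, Complex.ofReal_log hx.le]
  ring_nf

theorem solI_eq (m : ℂ) (hk : 0 < k.re) {x : ℝ} (hx : 0 < x) :
    solI m k x = (k / 2) ^ m * ((x : ℂ) ^ (1 / 2 + m) * besselF m (k ^ 2 * x ^ 2 / 4)) := by
  have hx0 : (x : ℂ) ≠ 0 := by exact_mod_cast hx.ne'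
  have h1 : (√x : ℂ) = (x : ℂ) ^ (1 / 2 : ℂ) := by
    rw [Real.sqrt_eq_rpow, Complex.ofReal_cpow hx.le]
    norm_num
  rw [solI, besselI_eq, mul_ofReal_cpow hk m hx, Complex.cpow_add _ _ hx0, h1, mul_pow]
  ring

theorem exists_norm_solI_le_rpow (m : ℂ) (hk : 0 < k.re) :
    ∃ C : ℝ, 0 ≤ C ∧ ∀ x : ℝ, 0 < x → x ≤ 1 → ‖solI m k x‖ ≤ C * x ^ (1 / 2 + m.re) := by
  obtain ⟨C, hC⟩ := (isCompact_Icc (a := (0 : ℝ)) (b := 1)).exists_bound_of_continuousOn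
    (f := fun x : ℝ => besselF m (k ^ 2 * x ^ 2 / 4))
    ((continuous_besselF m).comp (by fun_prop)).continuousOn
  refine ⟨‖(k / 2) ^ m‖ * C, mul_nonneg (norm_nonneg _)
    ((norm_nonneg _).trans (hC 0 (by simp))), fun x hx hx1 => ?_⟩
  rw [solI_eq m hk hx, norm_mul, norm_mul, Complex.norm_cpow_eq_rpow_re_of_pos hx]
  have := hC x ⟨hx.le, hx1⟩
  simp only [Complex.add_re, Complex.div_ofNat_re, Complex.one_re]
  calc ‖(k / 2) ^ m‖ * (x ^ (1 / 2 + m.re) * ‖besselF m (k ^ 2 * x ^ 2 / 4)‖)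
      ≤ ‖(k / 2) ^ m‖ * (x ^ (1 / 2 + m.re) * C) := by gcongr
    _ = _ := by ring

theorem exists_norm_solK_le_rpow (hk : 0 < k.re) {σ : ℝ} (hσ : |m.re| < σ) :
    ∃ C : ℝ, 0 ≤ C ∧ ∀ x : ℝ, 0 < x → ‖solK m k x‖ ≤ C * x ^ (1 / 2 - σ) := by
  obtain ⟨C, hC0, hC⟩ := exists_norm_besselK_le_rpow hσ
  refine ⟨C * k.re ^ (-σ), by positivity, fun x hx => ?_⟩
  have h1 := hC (k * x) (re_mul_ofReal_pos hk hx)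
  have e : (k * (x : ℂ)).re = k.re * x := by simp
  rw [e, Real.mul_rpow hk.le hx.le] at h1
  rw [solK, norm_mul, Complex.norm_real, Real.norm_of_nonneg (Real.sqrt_nonneg x),
    sub_eq_add_neg, Real.rpow_add hx, Real.sqrt_eq_rpow]
  calc x ^ (1 / 2 : ℝ) * ‖besselK m (k * x)‖
      ≤ x ^ (1 / 2 : ℝ) * (C * (k.re ^ (-σ) * x ^ (-σ))) := by gcongr
    _ = _ := by ring

theorem exists_norm_sqrt_mul_besselK_le_exp (m : ℂ) (hk : 0 < k.re) :
    ∃ C : ℝ, 0 ≤ C ∧ ∀ x : ℝ, 1 ≤ x →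
      √x * ‖besselK m (k * x)‖ ≤ C * Real.exp (-(k.re * x)) := by
  obtain ⟨C, hC0, hC⟩ := exists_norm_besselK_le_exp m hk
  refine ⟨C / √k.re, by positivity, fun x hx => ?_⟩
  have e : (k * (x : ℂ)).re = k.re * x := by simp
  have h1 := hC (k * x) (by rw [e]; nlinarith)
  rw [e, Real.sqrt_mul hk.le] at h1
  have hs : 0 < √k.re := Real.sqrt_pos.2 hk
  rw [div_mul_eq_mul_div, le_div_iff₀ hs]
  linarith

theorem exists_norm_solK_le_exp (m : ℂ) (hk : 0 < k.re) :
    ∃ C : ℝ, 0 ≤ C ∧ ∀ x : ℝ, 1 ≤ x → ‖solK m k x‖ ≤ C * Real.exp (-(k.re * x)) := by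
  obtain ⟨C, hC0, hC⟩ := exists_norm_sqrt_mul_besselK_le_exp m hk
  refine ⟨C, hC0, fun x hx => ?_⟩
  rw [solK, norm_mul, Complex.norm_real, Real.norm_of_nonneg (Real.sqrt_nonneg x)]
  exact hC x hx

theorem exists_norm_solK'_le_exp (m : ℂ) (hk : 0 < k.re) :
    ∃ C : ℝ, 0 ≤ C ∧ ∀ x : ℝ, 1 ≤ x → ‖solK' m k x‖ ≤ C * Real.exp (-(k.re * x)) := by
  obtain ⟨C, hC0, hC⟩ := exists_norm_sqrt_mul_besselK_le_exp m hk
  obtain ⟨D, hD0, hD⟩ := exists_norm_sqrt_mul_besselK_le_exp (m + 1) hk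
  refine ⟨‖1 / 2 + m‖ * C + ‖k‖ * D, by positivity, fun x hx => ?_⟩
  have hx0 : 0 < x := one_pos.trans_le hx
  have h1 : ‖(1 / 2 + m) / (x : ℂ)‖ ≤ ‖1 / 2 + m‖ := by
    rw [norm_div, Complex.norm_real, Real.norm_of_nonneg hx0.le]
    exact div_le_self (norm_nonneg _) hx
  rw [solK', norm_mul, Complex.norm_real, Real.norm_of_nonneg (Real.sqrt_nonneg x)]
  calc √x * ‖(1 / 2 + m) / (x : ℂ) * besselK m (k * x) + -k * besselK (m + 1) (k * x)‖
      ≤ √x * (‖1 / 2 + m‖ * ‖besselK m (k * x)‖ + ‖k‖ * ‖besselK (m + 1) (k * x)‖) := by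
        gcongr
        refine (norm_add_le _ _).trans ?_
        rw [norm_mul, norm_mul, norm_neg]
        gcongr
    _ = ‖1 / 2 + m‖ * (√x * ‖besselK m (k * x)‖) +
        ‖k‖ * (√x * ‖besselK (m + 1) (k * x)‖) := by ring
    _ ≤ ‖1 / 2 + m‖ * (C * Real.exp (-(k.re * x))) +
        ‖k‖ * (D * Real.exp (-(k.re * x))) := by
        exact add_le_add (mul_le_mul_of_nonneg_left (hC x hx) (norm_nonneg _))
          (mul_le_mul_of_nonneg_left (hD x hx) (norm_nonneg _))
    _ = _ := by ring

end Solutions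

/-! ### A weighted Schur test -/

section Schur

open scoped ENNReal

variable {μ : Measure ℝ}

theorem lintegral_mul_sq_le {f g : ℝ → ℝ≥0∞} (hf : AEMeasurable f μ) (hg : AEMeasurable g μ) :
    (∫⁻ x, f x * g x ∂μ) ^ 2 ≤ (∫⁻ x, f x ^ 2 ∂μ) * ∫⁻ x, g x ^ 2 ∂μ := by
  have h := ENNReal.lintegral_mul_le_Lp_mul_Lq μ Real.HolderConjugate.two_two hf hg
  simp only [Pi.mul_apply, ENNReal.rpow_two] at h
  have e : ∀ t : ℝ≥0∞, (t ^ (1 / (2 : ℝ))) ^ 2 = t := fun t => by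
    rw [← ENNReal.rpow_two, ← ENNReal.rpow_mul]
    norm_num
  calc _ ≤ ((∫⁻ x, f x ^ 2 ∂μ) ^ (1 / (2 : ℝ)) * (∫⁻ x, g x ^ 2 ∂μ) ^ (1 / (2 : ℝ))) ^ 2 := by
        gcongr
    _ = _ := by rw [mul_pow, e, e]

theorem eLpNorm_two_sq (f : ℝ → ℂ) : eLpNorm f 2 μ ^ 2 = ∫⁻ x, ‖f x‖ₑ ^ 2 ∂μ := by
  have := eLpNorm_nnreal_pow_eq_lintegral (μ := μ) (f := f) (p := 2) two_ne_zero
  simpa using this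

theorem schur_lintegral_le [SFinite μ] {a : ℝ → ℝ≥0∞} (ha : Measurable a) {e : ℝ → ℝ → ℝ≥0∞}
    (he : Measurable (Function.uncurry e)) (hsymm : ∀ x y, e x y = e y x) {M : ℝ≥0∞}
    (hM : ∀ x, ∫⁻ y, a y ^ 2 * e x y ^ 2 ∂μ ≤ M) {F : ℝ → ℝ≥0∞} (hF : AEMeasurable F μ) :
    ∫⁻ x, (∫⁻ y, a x * a y * e x y ^ 2 * F y ∂μ) ^ 2 ∂μ ≤ M ^ 2 * ∫⁻ y, F y ^ 2 ∂μ := by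
  have he' : ∀ x, Measurable (e x) := fun x => he.comp measurable_prodMk_left
  have h1 : ∀ x, (∫⁻ y, a x * a y * e x y ^ 2 * F y ∂μ) ^ 2 ≤
      ∫⁻ y, M * (a x ^ 2 * e x y ^ 2 * F y ^ 2) ∂μ := fun x => by
    have h2 : ∫⁻ y, a x * a y * e x y ^ 2 * F y ∂μ =
        ∫⁻ y, (a y * e x y) * (a x * (e x y * F y)) ∂μ := by
      refine lintegral_congr fun y => ?_
      ring
    have h3 : AEMeasurable (fun y => e x y * F y) μ := (he' x).aemeasurable.mul hF
    rw [h2]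
    refine (lintegral_mul_sq_le (ha.mul (he' x)).aemeasurable (h3.const_mul _)).trans ?_
    rw [lintegral_const_mul'' M (by fun_prop)]
    refine mul_le_mul' ?_ (le_of_eq (lintegral_congr fun y => by ring))
    simpa only [Pi.mul_apply, mul_pow] using hM x
  have hm : AEMeasurable (Function.uncurry fun x y => M * (a x ^ 2 * e x y ^ 2 * F y ^ 2))
      (μ.prod μ) := by
    have h3 : AEMeasurable (fun p : ℝ × ℝ => F p.2) (μ.prod μ) := hF.comp_snd
    have h4 : Measurable fun p : ℝ × ℝ => e p.1 p.2 := he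
    simp only [Function.uncurry_def]
    fun_prop
  calc _ ≤ ∫⁻ x, ∫⁻ y, M * (a x ^ 2 * e x y ^ 2 * F y ^ 2) ∂μ ∂μ := lintegral_mono h1
    _ = ∫⁻ y, ∫⁻ x, M * (a x ^ 2 * e x y ^ 2 * F y ^ 2) ∂μ ∂μ := lintegral_lintegral_swap hm
    _ ≤ ∫⁻ y, M ^ 2 * F y ^ 2 ∂μ := by
        refine lintegral_mono fun y => ?_
        have h5 : Measurable fun x => a x ^ 2 * e x y ^ 2 := by
          have : Measurable fun x => e x y := he.comp measurable_prodMk_right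
          fun_prop
        rw [lintegral_const_mul M (by fun_prop), lintegral_mul_const _ h5, pow_two M, mul_assoc]
        gcongr
        simp_rw [fun x => hsymm x y]
        exact hM y
    _ = _ := lintegral_const_mul'' _ (by fun_prop)

theorem exists_kernel_operator [SFinite μ] {G : ℝ → ℝ → ℂ}
    (hG : AEStronglyMeasurable (Function.uncurry G) (μ.prod μ))
    {a : ℝ → ℝ≥0∞} (ha : Measurable a) {e : ℝ → ℝ → ℝ≥0∞}
    (he : Measurable (Function.uncurry e)) (hsymm : ∀ x y, e x y = e y x) {M : ℝ≥0∞}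
    (hM0 : M ≠ ⊤) (hM : ∀ x, ∫⁻ y, a y ^ 2 * e x y ^ 2 ∂μ ≤ M)
    (hb : ∀ᵐ x ∂μ, ∀ᵐ y ∂μ, ‖G x y‖ₑ ≤ a x * a y * e x y ^ 2) :
    ∃ R : Lp ℂ 2 μ →L[ℂ] Lp ℂ 2 μ, ∀ f : Lp ℂ 2 μ, ∀ᵐ x ∂μ,
      Integrable (fun y => G x y * f y) μ ∧ R f x = ∫ y, G x y * f y ∂μ := by
  have hfm : ∀ f : Lp ℂ 2 μ, AEStronglyMeasurable (fun p : ℝ × ℝ => G p.1 p.2 * f p.2)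
      (μ.prod μ) := fun f => hG.mul (Lp.aestronglyMeasurable f).comp_snd
  have hbound : ∀ f : Lp ℂ 2 μ,
      ∫⁻ x, (∫⁻ y, ‖G x y * f y‖ₑ ∂μ) ^ 2 ∂μ ≤ M ^ 2 * ∫⁻ y, ‖f y‖ₑ ^ 2 ∂μ := fun f => by
    refine le_trans (lintegral_mono_ae ?_)
      (schur_lintegral_le ha he hsymm hM (Lp.aestronglyMeasurable f).enorm)
    filter_upwards [hb] with x hx
    gcongr ?_ ^ 2
    refine lintegral_mono_ae ?_
    filter_upwards [hx] with y hy
    rw [enorm_mul]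
    gcongr
  have hfin : ∀ f : Lp ℂ 2 μ, M ^ 2 * ∫⁻ y, ‖f y‖ₑ ^ 2 ∂μ ≠ ⊤ := fun f => by
    rw [← eLpNorm_two_sq]
    exact ENNReal.mul_ne_top (ENNReal.pow_ne_top hM0) (ENNReal.pow_ne_top (Lp.eLpNorm_ne_top f))
  have hint : ∀ f : Lp ℂ 2 μ, ∀ᵐ x ∂μ, Integrable (fun y => G x y * f y) μ := fun f => by
    have hmeas : AEMeasurable (fun x => (∫⁻ y, ‖G x y * f y‖ₑ ∂μ) ^ 2) μ :=
      ((hfm f).enorm.lintegral_prod_right').pow_const 2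
    filter_upwards [(hfm f).prodMk_left,
      ae_lt_top' hmeas ((hbound f).trans_lt (hfin f).lt_top).ne] with x hx1 hx2
    refine ⟨hx1, ?_⟩
    by_contra hcon
    rw [hasFiniteIntegral_iff_enorm, not_lt, top_le_iff] at hcon
    rw [hcon] at hx2
    simp at hx2
  have hle : ∀ f : Lp ℂ 2 μ, eLpNorm (fun x => ∫ y, G x y * f y ∂μ) 2 μ ≤ M * eLpNorm f 2 μ :=
    fun f => by
    refine (ENNReal.pow_le_pow_left_iff two_ne_zero).1 ?_
    rw [mul_pow, eLpNorm_two_sq, eLpNorm_two_sq]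
    refine (lintegral_mono fun x => ?_).trans (hbound f)
    gcongr
    exact enorm_integral_le_lintegral_enorm _
  have hmem : ∀ f : Lp ℂ 2 μ, MemLp (fun x => ∫ y, G x y * f y ∂μ) 2 μ := fun f =>
    ⟨(hfm f).integral_prod_right', (hle f).trans_lt
      (ENNReal.mul_ne_top hM0 (Lp.eLpNorm_ne_top f)).lt_top⟩
  let T : Lp ℂ 2 μ →ₗ[ℂ] Lp ℂ 2 μ :=
    { toFun := fun f => (hmem f).toLp _
      map_add' := fun f g => by
        refine Lp.ext ?_
        filter_upwards [(hmem (f + g)).coeFn_toLp, (hmem f).coeFn_toLp, (hmem g).coeFn_toLp,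
          Lp.coeFn_add ((hmem f).toLp _) ((hmem g).toLp _), hint f, hint g] with x h1 h2 h3 h4 h5 h6
        rw [h1, h4, Pi.add_apply, h2, h3, ← integral_add h5 h6]
        refine integral_congr_ae ?_
        filter_upwards [Lp.coeFn_add f g] with y hy
        rw [hy, Pi.add_apply, mul_add]
      map_smul' := fun c f => by
        refine Lp.ext ?_
        filter_upwards [(hmem (c • f)).coeFn_toLp, (hmem f).coeFn_toLp,
          Lp.coeFn_smul c ((hmem f).toLp _)] with x h1 h2 h4
        rw [h1, RingHom.id_apply, h4, Pi.smul_apply, h2, smul_eq_mul, ← integral_const_mul]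
        refine integral_congr_ae ?_
        filter_upwards [Lp.coeFn_smul c f] with y hy
        rw [hy, Pi.smul_apply, smul_eq_mul]
        ring }
  refine ⟨T.mkContinuous M.toReal fun f => ?_, fun f => ?_⟩
  · change ‖(hmem f).toLp _‖ ≤ _
    rw [Lp.norm_toLp, Lp.norm_def, ← ENNReal.toReal_mul]
    exact ENNReal.toReal_mono (ENNReal.mul_ne_top hM0 (Lp.eLpNorm_ne_top f)) (hle f)
  · filter_upwards [hint f, (hmem f).coeFn_toLp] with x h1 h2
    exact ⟨h1, h2⟩

end Schur

/-! ### The weight -/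

/-- The weight controlling the resolvent kernel near the origin. -/
def weight (s x : ℝ) : ℝ := 1 + x ^ (-s)

theorem measurable_weight (s : ℝ) : Measurable (weight s) := by
  unfold weight
  fun_prop

theorem one_le_weight (s : ℝ) {x : ℝ} (hx : 0 < x) : 1 ≤ weight s x := by
  have := Real.rpow_pos_of_pos hx (-s)
  simp only [weight]
  linarith

theorem rpow_le_weight (s : ℝ) (x : ℝ) : x ^ (-s) ≤ weight s x := by
  simp only [weight]
  linarith

theorem integrable_exp_neg_mul_abs {κ : ℝ} (hκ : 0 < κ) :
    Integrable fun t : ℝ => Real.exp (-(κ * |t|)) := by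
  have h1 : IntegrableOn (fun t : ℝ => Real.exp (-(κ * |t|))) (Ioi 0) := by
    refine (exp_neg_integrableOn_Ioi 0 hκ).congr_fun (fun t ht => ?_) measurableSet_Ioi
    simp only
    rw [abs_of_pos ht, neg_mul]
  have h2 : IntegrableOn (fun t : ℝ => Real.exp (-(κ * |t|))) (Iic 0) := by
    rw [integrableOn_Iic_iff_integrableOn_Iio]
    have := h1.comp_neg
    rw [Set.neg_Ioi, neg_zero] at this
    simpa using this
  rw [← integrableOn_univ, ← Iic_union_Ioi (a := (0 : ℝ))]
  exact h2.union h1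

theorem exists_lintegral_weight_le {s κ : ℝ} (hs0 : 0 ≤ s) (hs : s < 1 / 2) (hκ : 0 < κ) :
    ∃ M : ENNReal, M ≠ ⊤ ∧ ∀ x : ℝ, ∫⁻ y in Ioi (0 : ℝ),
      ENNReal.ofReal (weight s y ^ 2 * Real.exp (-(κ * |x - y|))) ≤ M := by
  have i1 : IntegrableOn (fun y : ℝ => 4 * y ^ (-(2 * s))) (Ioo 0 1) :=
    ((intervalIntegral.integrableOn_Ioo_rpow_iff one_pos).2 (by linarith)).const_mul 4
  have i2 := (integrable_exp_neg_mul_abs hκ).const_mul 4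
  set g : ℝ → ENNReal := (Ioo (0 : ℝ) 1).indicator fun y => ENNReal.ofReal (4 * y ^ (-(2 * s)))
  set M₂ := ∫⁻ t : ℝ, ENNReal.ofReal (4 * Real.exp (-(κ * |t|)))
  have hg : Measurable g := Measurable.indicator (by fun_prop) measurableSet_Ioo
  refine ⟨(∫⁻ y, g y) + M₂, ENNReal.add_ne_top.2 ⟨?_, i2.lintegral_lt_top.ne⟩, fun x => ?_⟩
  · simp only [g]
    rw [lintegral_indicator measurableSet_Ioo]
    exact i1.lintegral_lt_top.ne
  · have e : M₂ = ∫⁻ y : ℝ, ENNReal.ofReal (4 * Real.exp (-(κ * |x - y|))) :=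
      (lintegral_sub_left_eq_self (fun t : ℝ => ENNReal.ofReal (4 * Real.exp (-(κ * |t|)))) x).symm
    rw [e, ← lintegral_add_left hg]
    refine (setLIntegral_mono (by fun_prop) fun y hy => ?_).trans (setLIntegral_le_lintegral _ _)
    have hy0 : (0 : ℝ) < y := hy
    have he : Real.exp (-(κ * |x - y|)) ≤ 1 := Real.exp_le_one_iff.2 (by
      have := mul_nonneg hκ.le (abs_nonneg (x - y))
      linarith)
    rcases lt_or_ge y 1 with h1 | h1
    · refine le_trans ?_ le_self_add
      simp only [g]
      rw [indicator_of_mem (show y ∈ Ioo (0 : ℝ) 1 from ⟨hy0, h1⟩)]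
      refine ENNReal.ofReal_le_ofReal ?_
      have h2 : 1 ≤ y ^ (-s) := Real.one_le_rpow_of_pos_of_le_one_of_nonpos hy0 h1.le (by linarith)
      have h3 : y ^ (-(2 * s)) = (y ^ (-s)) ^ 2 := by
        rw [← Real.rpow_natCast, ← Real.rpow_mul hy0.le]
        congr 1
        push_cast
        ring
      rw [h3]
      calc weight s y ^ 2 * Real.exp (-(κ * |x - y|)) ≤ weight s y ^ 2 * 1 := by gcongr
        _ ≤ _ := by
          simp only [weight]
          nlinarith
    · refine le_trans (ENNReal.ofReal_le_ofReal ?_) le_add_self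
      gcongr
      have h2 : y ^ (-s) ≤ 1 := Real.rpow_le_one_of_one_le_of_nonpos h1 (by linarith)
      have h3 := Real.rpow_pos_of_pos hy0 (-s)
      simp only [weight]
      nlinarith

theorem memLp_weight_mul_exp {s κ : ℝ} (hs0 : 0 ≤ s) (hs : s < 1 / 2) (hκ : 0 < κ) (x : ℝ) :
    MemLp (fun y => weight s y * Real.exp (-(κ * |x - y|))) 2 halfMeasure := by
  have hm := measurable_weight s
  rw [memLp_two_iff_integrable_sq (by fun_prop)]
  obtain ⟨M, hM0, hM⟩ := exists_lintegral_weight_le hs0 hs (κ := 2 * κ) (by linarith)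
  refine ⟨by fun_prop, ?_⟩
  rw [hasFiniteIntegral_iff_ofReal (Eventually.of_forall fun y => sq_nonneg _)]
  refine lt_of_le_of_lt (le_of_eq (lintegral_congr fun y => ?_)) ((hM x).trans_lt hM0.lt_top)
  rw [mul_pow, ← Real.exp_nat_mul]
  congr 3
  push_cast
  ring

/-! ### The resolvent kernel -/

section Kernel

variable {m k : ℂ}

theorem resolventKernel_of_lt (m k : ℂ) {x y : ℝ} (hx : 0 < x) (h : x < y) :
    resolventKernel m k x y = solI m k x * solK m k y := by
  rw [resolventKernel, if_pos h, Real.sqrt_mul hx.le, solI, solK]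
  push_cast
  ring

theorem resolventKernel_of_le (m k : ℂ) {x y : ℝ} (hx : 0 < x) (h : y ≤ x) :
    resolventKernel m k x y = solI m k y * solK m k x := by
  rw [resolventKernel, if_neg (not_lt.2 h), Real.sqrt_mul hx.le, solI, solK]
  push_cast
  ring

/-- Exponents for the behaviour of the two solutions at the origin. -/
theorem exists_exponents (hm : -1 < m.re) : ∃ σ s : ℝ, |m.re| < σ ∧ σ < 2 + m.re ∧ 0 ≤ s ∧
    s < 1 / 2 ∧ -s ≤ 1 / 2 + m.re ∧ ∀ x y : ℝ, 0 < x → x ≤ y → y ≤ 1 →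
      x ^ (1 / 2 + m.re) * y ^ (1 / 2 - σ) ≤ weight s x * weight s y := by
  rcases le_or_gt 0 m.re with h | h
  · refine ⟨m.re + 1 / 4, 0, by rw [abs_of_nonneg h]; linarith, by linarith, le_rfl, by norm_num,
      by linarith, fun x y hx hxy hy => ?_⟩
    have hy0 : 0 < y := hx.trans_le hxy
    have h1 : x ^ (1 / 2 + m.re) ≤ y ^ (1 / 2 + m.re) := by gcongr
    calc x ^ (1 / 2 + m.re) * y ^ (1 / 2 - (m.re + 1 / 4))
        ≤ y ^ (1 / 2 + m.re) * y ^ (1 / 2 - (m.re + 1 / 4)) := by gcongr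
      _ = y ^ (3 / 4 : ℝ) := by rw [← Real.rpow_add hy0]; ring_nf
      _ ≤ 1 := Real.rpow_le_one hy0.le hy (by norm_num)
      _ ≤ weight 0 x * weight 0 y :=
        one_le_mul_of_one_le_of_one_le (one_le_weight _ hx) (one_le_weight _ hy0)
  · obtain ⟨σ, h1, h2⟩ := exists_between (show |m.re| < 1 by rw [abs_of_neg h]; linarith)
    have h3 := h1
    rw [abs_of_neg h] at h3
    obtain ⟨τ, h4, h5⟩ := exists_between (show |m.re| < min σ (2 + m.re) by
      rw [lt_min_iff, abs_of_neg h]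
      exact ⟨h3, by linarith⟩)
    rw [lt_min_iff] at h5
    have h6 := h4
    rw [abs_of_neg h] at h6
    refine ⟨τ, max 0 (τ - 1 / 2), h4, h5.2, le_max_left _ _,
      max_lt (by norm_num) (by linarith [h5.1]), ?_, fun x y hx hxy hy => ?_⟩
    · have := le_max_right 0 (τ - 1 / 2)
      linarith
    · have hy0 : 0 < y := hx.trans_le hxy
      have h7 := le_max_right 0 (τ - 1 / 2)
      refine mul_le_mul ?_ ?_ (Real.rpow_pos_of_pos hy0 _).le
        (zero_le_one.trans (one_le_weight _ hx))
      · exact (Real.rpow_le_rpow_of_exponent_ge hx (hxy.trans hy) (by linarith)).trans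
          (rpow_le_weight _ _)
      · exact (Real.rpow_le_rpow_of_exponent_ge hy0 hy (by linarith)).trans (rpow_le_weight _ _)

/-- Bounds of the two solutions, and of the product that makes up the resolvent kernel. -/
theorem exists_bounds (hm : -1 < m.re) (hk : 0 < k.re) : ∃ s C : ℝ, 0 ≤ s ∧ s < 1 / 2 ∧ 0 ≤ C ∧
    (∀ x, 0 < x → ‖solI m k x‖ ≤ C * weight s x * Real.exp (k.re * x)) ∧
    ∀ x y, 0 < x → x ≤ y → ‖solI m k x * solK m k y‖ ≤
      C * weight s x * weight s y * Real.exp (-(k.re * |x - y|)) := by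
  obtain ⟨σ, s, hσ1, -, hs0, hs, hsm, hw⟩ := exists_exponents hm
  obtain ⟨A, hA0, hA⟩ := exists_norm_solI_le_rpow m hk
  obtain ⟨B, hB0, hB⟩ := (isSolution_solI m hk).exists_norm_le_exp hk
  obtain ⟨D, hD0, hD⟩ := exists_norm_solK_le_rpow hk hσ1
  obtain ⟨E, hE0, hE⟩ := exists_norm_solK_le_exp m hk
  have hxw : ∀ x : ℝ, 0 < x → x ≤ 1 → x ^ (1 / 2 + m.re) ≤ weight s x := fun x hx hx1 =>
    (Real.rpow_le_rpow_of_exponent_ge hx hx1 hsm).trans (rpow_le_weight _ _)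
  set P := max A B
  set Q := max D E
  have hP0 : 0 ≤ P := hA0.trans (le_max_left _ _)
  have hQ0 : 0 ≤ Q := hD0.trans (le_max_left _ _)
  have hI : ∀ x, 0 < x → ‖solI m k x‖ ≤ P * weight s x * Real.exp (k.re * x) := fun x hx => by
    have hwx := one_le_weight s hx
    rcases le_total x 1 with h | h
    · calc _ ≤ A * x ^ (1 / 2 + m.re) := hA x hx h
        _ ≤ P * weight s x * 1 := by
          rw [mul_one]
          gcongr
          · exact le_max_left _ _
          · exact hxw x hx h
        _ ≤ _ := by
          gcongr
          exact Real.one_le_exp (by positivity)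
    · calc _ ≤ B * Real.exp (k.re * x) := hB x h
        _ ≤ P * 1 * Real.exp (k.re * x) := by
          rw [mul_one]
          gcongr
          exact le_max_right _ _
        _ ≤ _ := by gcongr
  refine ⟨s, P * (1 + Q) * Real.exp k.re, hs0, hs, by positivity, fun x hx => ?_,
    fun x y hx hxy => ?_⟩
  · refine (hI x hx).trans ?_
    have h1 : 1 ≤ Real.exp k.re := Real.one_le_exp hk.le
    have hwx := one_le_weight s hx
    gcongr
    calc P = P * 1 * 1 := by ring
      _ ≤ P * (1 + Q) * Real.exp k.re := by gcongr; linarith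
  · have hy : 0 < y := hx.trans_le hxy
    have hwx := one_le_weight s hx
    have hwy := one_le_weight s hy
    have h1 : 1 ≤ Real.exp k.re := Real.one_le_exp hk.le
    rw [norm_mul, abs_of_nonpos (by linarith : x - y ≤ 0)]
    rcases le_total y 1 with h | h
    · have h2 : 1 ≤ Real.exp k.re * Real.exp (-(k.re * -(x - y))) := by
        rw [← Real.exp_add]
        refine Real.one_le_exp ?_
        nlinarith
      calc _ ≤ (A * x ^ (1 / 2 + m.re)) * (D * y ^ (1 / 2 - σ)) :=
            mul_le_mul (hA x hx (hxy.trans h)) (hD y hy) (norm_nonneg _) (by positivity)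
        _ = (A * D) * (x ^ (1 / 2 + m.re) * y ^ (1 / 2 - σ)) := by ring
        _ ≤ (P * (1 + Q)) * (weight s x * weight s y) := by
          refine mul_le_mul ?_ (hw x y hx hxy h) (by positivity) (by positivity)
          gcongr
          · exact le_max_left _ _
          · exact (le_max_left D E).trans (by linarith)
        _ = (P * (1 + Q)) * (weight s x * weight s y) * 1 := by ring
        _ ≤ (P * (1 + Q)) * (weight s x * weight s y) *
            (Real.exp k.re * Real.exp (-(k.re * -(x - y)))) := by gcongr
        _ = _ := by ring
    · calc _ ≤ (P * weight s x * Real.exp (k.re * x)) * (E * Real.exp (-(k.re * y))) :=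
            mul_le_mul (hI x hx) (hE y h) (norm_nonneg _) (by positivity)
        _ = P * E * weight s x * (Real.exp (k.re * x) * Real.exp (-(k.re * y))) := by ring
        _ = P * E * 1 * weight s x * 1 * Real.exp (-(k.re * -(x - y))) := by
          rw [← Real.exp_add]
          ring_nf
        _ ≤ P * (1 + Q) * Real.exp k.re * weight s x * weight s y *
            Real.exp (-(k.re * -(x - y))) := by
          gcongr
          exact (le_max_right D E).trans (by linarith)

theorem continuousOn_besselI_mul (m : ℂ) (hk : 0 < k.re) :
    ContinuousOn (fun x : ℝ => besselI m (k * x)) (Ioi 0) := fun _ hx =>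
  (hasDerivAt_comp_mul_ofReal
    (hasDerivAt_besselI (re_mul_ofReal_pos hk hx))).continuousAt.continuousWithinAt

theorem continuousOn_besselK_mul (m : ℂ) (hk : 0 < k.re) :
    ContinuousOn (fun x : ℝ => besselK m (k * x)) (Ioi 0) := fun _ hx =>
  (hasDerivAt_comp_mul_ofReal
    (hasDerivAt_besselK (re_mul_ofReal_pos hk hx))).continuousAt.continuousWithinAt

theorem aestronglyMeasurable_resolventKernel (m : ℂ) (hk : 0 < k.re) :
    AEStronglyMeasurable (Function.uncurry (resolventKernel m k))
      (halfMeasure.prod halfMeasure) := by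
  have hI : AEStronglyMeasurable (fun x : ℝ => besselI m (k * x)) halfMeasure :=
    (continuousOn_besselI_mul m hk).aestronglyMeasurable measurableSet_Ioi
  have hK : AEStronglyMeasurable (fun x : ℝ => besselK m (k * x)) halfMeasure :=
    (continuousOn_besselK_mul m hk).aestronglyMeasurable measurableSet_Ioi
  have hs : AEStronglyMeasurable (fun p : ℝ × ℝ => (√(p.1 * p.2) : ℂ))
      (halfMeasure.prod halfMeasure) := by
    have : Continuous fun p : ℝ × ℝ => (√(p.1 * p.2) : ℂ) := by fun_prop
    exact this.aestronglyMeasurable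
  have hS : MeasurableSet {p : ℝ × ℝ | p.1 < p.2} := measurableSet_lt measurable_fst measurable_snd
  classical
  have h := AEStronglyMeasurable.piecewise (μ := halfMeasure.prod halfMeasure) hS
    ((hs.mul hI.comp_fst).mul hK.comp_snd).restrict
    ((hs.mul hI.comp_snd).mul hK.comp_fst).restrict
  refine h.congr (Eventually.of_forall fun p => ?_)
  by_cases hp : p.1 < p.2
  · rw [piecewise_eq_of_mem _ _ _ (by exact hp)]
    simp [Function.uncurry_def, resolventKernel, hp]
  · rw [piecewise_eq_of_notMem _ _ _ (by exact hp)]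
    simp [Function.uncurry_def, resolventKernel, hp]

theorem exists_hasIntegralKernel_resolventKernel (hm : -1 < m.re) (hk : 0 < k.re) :
    ∃ R : L2 →L[ℂ] L2, HasIntegralKernel R (resolventKernel m k) := by
  obtain ⟨s, C, hs0, hs, hC0, -, hb⟩ := exists_bounds hm hk
  obtain ⟨M, hM0, hM⟩ := exists_lintegral_weight_le hs0 hs hk
  have hw := measurable_weight s
  have hG := aestronglyMeasurable_resolventKernel m hk
  have hb' : ∀ x y, 0 < x → 0 < y → ‖resolventKernel m k x y‖ ≤
      C * weight s x * weight s y * Real.exp (-(k.re * |x - y|)) := fun x y hx hy => by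
    rcases lt_or_ge x y with h | h
    · rw [resolventKernel_of_lt m k hx h]
      exact hb x y hx h.le
    · rw [resolventKernel_of_le m k hx h, abs_sub_comm]
      refine (hb y x hy h).trans (le_of_eq ?_)
      ring
  suffices h : ∃ R : L2 →L[ℂ] L2, ∀ f : L2, ∀ᵐ x ∂halfMeasure,
      Integrable (fun y => resolventKernel m k x y * f y) halfMeasure ∧
        R f x = ∫ y in Ioi (0 : ℝ), resolventKernel m k x y * f y by
    obtain ⟨R, hR⟩ := h
    exact ⟨R, hG, hR⟩
  refine exists_kernel_operator (μ := halfMeasure) hG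
    (a := fun x => ENNReal.ofReal (√C * weight s x))
    (e := fun x y => ENNReal.ofReal (Real.exp (-(k.re / 2 * |x - y|))))
    (M := ENNReal.ofReal C * M) (by fun_prop) (by fun_prop)
    (fun x y => by rw [abs_sub_comm]) (ENNReal.mul_ne_top ENNReal.ofReal_ne_top hM0)
    (fun x => ?_) ?_
  · refine le_trans (le_of_eq ?_) (mul_le_mul_right (hM x) (ENNReal.ofReal C))
    rw [← lintegral_const_mul _ (by fun_prop)]
    refine setLIntegral_congr_fun measurableSet_Ioi fun y hy => ?_
    have hwy := one_le_weight s hy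
    rw [← ENNReal.ofReal_pow (by positivity), ← ENNReal.ofReal_pow (by positivity),
      ← ENNReal.ofReal_mul (by positivity), ← ENNReal.ofReal_mul hC0, mul_pow, Real.sq_sqrt hC0,
      ← Real.exp_nat_mul, mul_assoc]
    congr 4
    push_cast
    ring
  · filter_upwards [ae_restrict_mem measurableSet_Ioi] with x hx
    filter_upwards [ae_restrict_mem measurableSet_Ioi] with y hy
    have hwx := one_le_weight s hx
    have hwy := one_le_weight s hy
    rw [← ENNReal.ofReal_pow (by positivity), ← ENNReal.ofReal_mul (by positivity),
      ← ENNReal.ofReal_mul (by positivity), ← ofReal_norm]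
    refine ENNReal.ofReal_le_ofReal ((hb' x y hx hy).trans (le_of_eq ?_))
    have e1 : Real.exp (-(k.re / 2 * |x - y|)) ^ 2 = Real.exp (-(k.re * |x - y|)) := by
      rw [← Real.exp_nat_mul]
      congr 1
      push_cast
      ring
    rw [e1]
    nth_rewrite 1 [← Real.mul_self_sqrt hC0]
    ring

end Kernel

/-! ### The resolvent kernel is a left inverse -/

section LeftInverse

variable {m k : ℂ}

theorem memLp_indicator_solI (hm : -1 < m.re) (hk : 0 < k.re) (x : ℝ) :
    MemLp ((Ioc 0 x).indicator (solI m k)) 2 halfMeasure := by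
  obtain ⟨s, C, hs0, hs, hC0, hI, -⟩ := exists_bounds hm hk
  refine ((memLp_weight_mul_exp hs0 hs hk x).const_mul (C * Real.exp (k.re * x))).mono' ?_ ?_
  · exact ((isSolution_solI m hk).continuousOn.aestronglyMeasurable measurableSet_Ioi).indicator
      measurableSet_Ioc
  · filter_upwards [ae_restrict_mem measurableSet_Ioi] with y hy
    have hwy := one_le_weight s hy
    by_cases h : y ∈ Ioc 0 x
    · rw [indicator_of_mem h, abs_of_nonneg (by linarith [h.2])]
      refine (hI y hy).trans (le_of_eq ?_)
      have : Real.exp (k.re * y) = Real.exp (k.re * x) * Real.exp (-(k.re * (x - y))) := by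
        rw [← Real.exp_add]
        ring_nf
      rw [this]
      ring
    · rw [indicator_of_notMem h, norm_zero]
      positivity

theorem exists_norm_solK_le_of_le (m : ℂ) (hk : 0 < k.re) {x : ℝ} (hx : 0 < x) :
    ∃ C : ℝ, 0 ≤ C ∧ ∀ y, x ≤ y → ‖solK m k y‖ ≤ C * Real.exp (-(k.re * y)) := by
  obtain ⟨C, hC0, hC⟩ := exists_norm_solK_le_exp m hk
  have hcont : ContinuousOn (fun y : ℝ => solK m k y * Real.exp (k.re * y)) (Icc x 1) := by
    refine ContinuousOn.mul ((isSolution_solK m hk).continuousOn.mono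
      fun y hy => hx.trans_le hy.1) ?_
    fun_prop
  obtain ⟨D, hD⟩ := isCompact_Icc.exists_bound_of_continuousOn hcont
  refine ⟨max C D, hC0.trans (le_max_left _ _), fun y hy => ?_⟩
  rcases le_total y 1 with h | h
  · have h1 := hD y ⟨hy, h⟩
    rw [norm_mul, Complex.norm_real, Real.norm_of_nonneg (Real.exp_pos _).le] at h1
    have h2 := h1.trans (le_max_right C D)
    rw [Real.exp_neg, ← div_eq_mul_inv, le_div_iff₀ (Real.exp_pos _)]
    exact h2
  · refine (hC y h).trans ?_
    gcongr
    exact le_max_left _ _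

theorem memLp_indicator_solK (m : ℂ) (hk : 0 < k.re) {x : ℝ} (hx : 0 < x) :
    MemLp ((Ioi x).indicator (solK m k)) 2 halfMeasure := by
  obtain ⟨C, hC0, hC⟩ := exists_norm_solK_le_of_le m hk hx
  refine ((memLp_weight_mul_exp le_rfl (by norm_num) hk x).const_mul
    (C * Real.exp (-(k.re * x)))).mono' ?_ ?_
  · exact ((isSolution_solK m hk).continuousOn.aestronglyMeasurable measurableSet_Ioi).indicator
      measurableSet_Ioi
  · filter_upwards [ae_restrict_mem measurableSet_Ioi] with y hy
    have hwy := one_le_weight 0 hy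
    by_cases h : y ∈ Ioi x
    · have hxy : x < y := h
      rw [indicator_of_mem h, abs_of_nonpos (by linarith)]
      refine (hC y hxy.le).trans ?_
      have : Real.exp (-(k.re * y)) =
          Real.exp (-(k.re * x)) * (1 * Real.exp (-(k.re * -(x - y)))) := by
        rw [one_mul, ← Real.exp_add]
        ring_nf
      rw [this, mul_assoc]
      gcongr
    · rw [indicator_of_notMem h, norm_zero]
      positivity

theorem integrableOn_mul_of_memLp_indicator {w g : ℝ → ℂ} {S : Set ℝ} (hS : MeasurableSet S)
    (hS0 : S ⊆ Ioi 0) (hw : MemLp (S.indicator w) 2 halfMeasure) (hg : MemLp g 2 halfMeasure) :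
    IntegrableOn (fun y => w y * g y) S := by
  have h : Integrable (S.indicator w * g) halfMeasure := hw.integrable_mul hg
  have h2 : IntegrableOn (S.indicator w * g) S :=
    IntegrableOn.mono_set (s := S) (t := Ioi 0) h hS0
  refine h2.congr_fun (fun y hy => ?_) hS
  simp [indicator_of_mem hy]

theorem integrableOn_solI_mul (hm : -1 < m.re) (hk : 0 < k.re) {g : ℝ → ℂ}
    (hg : MemLp g 2 halfMeasure) (x : ℝ) : IntegrableOn (fun y => solI m k y * g y) (Ioc 0 x) :=
  integrableOn_mul_of_memLp_indicator measurableSet_Ioc (fun _ hy => hy.1)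
    (memLp_indicator_solI hm hk x) hg

theorem integrableOn_solK_mul (m : ℂ) (hk : 0 < k.re) {g : ℝ → ℂ}
    (hg : MemLp g 2 halfMeasure) {x : ℝ} (hx : 0 < x) :
    IntegrableOn (fun y => solK m k y * g y) (Ioi x) :=
  integrableOn_mul_of_memLp_indicator measurableSet_Ioi (fun _ hy => hx.trans hy)
    (memLp_indicator_solK m hk hx) hg

theorem IsSolution.hasDerivAt_wronskian {q u u₁ η η₁ η₂ : ℝ → ℂ} (h : IsSolution q u u₁)
    {x : ℝ} (hx : 0 < x) (h1 : HasDerivAt η (η₁ x) x) (h2 : HasDerivAt η₁ (η₂ x) x) :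
    HasDerivAt (fun x => u₁ x * η x - u x * η₁ x) (u x * (q x * η x - η₂ x)) x := by
  refine (((h x hx).2.mul h1).sub ((h x hx).1.mul h2)).congr_deriv ?_
  ring

variable {η η₁ η₂ : ℝ → ℂ}

theorem integral_Ioi_solK_mul (m : ℂ) (hk : 0 < k.re)
    (h1 : ∀ x, 0 < x → HasDerivAt η (η₁ x) x) (h2 : ∀ x, 0 < x → HasDerivAt η₁ (η₂ x) x)
    (hg : MemLp (fun x => besselPotential m k x * η x - η₂ x) 2 halfMeasure)
    (hη : ∀ᶠ x in atTop, η x = 0 ∧ η₁ x = 0) {x : ℝ} (hx : 0 < x) :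
    ∫ y in Ioi x, solK m k y * (besselPotential m k y * η y - η₂ y) =
      solK m k x * η₁ x - solK' m k x * η x := by
  have h := integral_Ioi_of_hasDerivAt_of_tendsto' (a := x) (m := 0)
    (fun y hy => (isSolution_solK m hk).hasDerivAt_wronskian (hx.trans_le hy)
      (h1 y (hx.trans_le hy)) (h2 y (hx.trans_le hy)))
    (integrableOn_solK_mul m hk hg hx) ?_
  · rw [h]
    ring
  · refine tendsto_const_nhds.congr' ?_
    filter_upwards [hη] with y hy
    simp [hy.1, hy.2]

theorem integral_Ioc_solI_mul (hm : -1 < m.re) (hk : 0 < k.re)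
    (h1 : ∀ x, 0 < x → HasDerivAt η (η₁ x) x) (h2 : ∀ x, 0 < x → HasDerivAt η₁ (η₂ x) x)
    (hg : MemLp (fun x => besselPotential m k x * η x - η₂ x) 2 halfMeasure)
    (h0 : Tendsto (fun x => solI' m k x * η x - solI m k x * η₁ x) (𝓝[>] 0) (𝓝 0))
    {x : ℝ} (hx : 0 < x) :
    ∫ y in Ioc 0 x, solI m k y * (besselPotential m k y * η y - η₂ y) =
      solI' m k x * η x - solI m k x * η₁ x := by
  have hd : ∀ y, 0 < y → HasDerivAt (fun x => solI' m k x * η x - solI m k x * η₁ x)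
      (solI m k y * (besselPotential m k y * η y - η₂ y)) y := fun y hy =>
    (isSolution_solI m hk).hasDerivAt_wronskian hy (h1 y hy) (h2 y hy)
  have h := intervalIntegral.integral_eq_sub_of_hasDerivAt_of_tendsto hx
    (fun y hy => hd y hy.1)
    ((intervalIntegrable_iff_integrableOn_Ioc_of_le hx.le).2 (integrableOn_solI_mul hm hk hg x))
    h0 ((hd x hx).continuousAt.tendsto.mono_left nhdsWithin_le_nhds)
  rw [intervalIntegral.integral_of_le hx.le] at h
  rw [h, sub_zero]

theorem integral_resolventKernel_mul {f g : ℝ → ℂ} (hm : -1 < m.re) (hk : 0 < k.re)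
    (hfg : f =ᵐ[halfMeasure] g) (hg : MemLp g 2 halfMeasure) {x : ℝ} (hx : 0 < x) :
    ∫ y in Ioi (0 : ℝ), resolventKernel m k x y * f y =
      solK m k x * (∫ y in Ioc 0 x, solI m k y * g y) +
        solI m k x * ∫ y in Ioi x, solK m k y * g y := by
  have e : ∫ y in Ioi (0 : ℝ), resolventKernel m k x y * f y =
      ∫ y in Ioi (0 : ℝ), resolventKernel m k x y * g y := by
    refine integral_congr_ae ?_
    filter_upwards [hfg] with y hy
    rw [hy]
  have e1 : ∀ y ∈ Ioc 0 x,
      solK m k x * (solI m k y * g y) = resolventKernel m k x y * g y := fun y hy => by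
    rw [resolventKernel_of_le m k hx hy.2]
    ring
  have e2 : ∀ y ∈ Ioi x,
      solI m k x * (solK m k y * g y) = resolventKernel m k x y * g y := fun y hy => by
    rw [resolventKernel_of_lt m k hx hy]
    ring
  have i1 := (integrableOn_solI_mul hm hk hg x).const_mul (solK m k x)
  have i2 := (integrableOn_solK_mul m hk hg hx).const_mul (solI m k x)
  rw [e, ← Ioc_union_Ioi_eq_Ioi hx.le, setIntegral_union (Ioc_disjoint_Ioi le_rfl)
    measurableSet_Ioi (IntegrableOn.congr_fun i1 e1 measurableSet_Ioc)
    (IntegrableOn.congr_fun i2 e2 measurableSet_Ioi),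
    ← setIntegral_congr_fun measurableSet_Ioc e1, ← setIntegral_congr_fun measurableSet_Ioi e2,
    integral_const_mul, integral_const_mul]

theorem kernel_operator_apply {R : L2 →L[ℂ] L2} (hR : HasIntegralKernel R (resolventKernel m k))
    (hm : -1 < m.re) (hk : 0 < k.re)
    (h1 : ∀ x, 0 < x → HasDerivAt η (η₁ x) x) (h2 : ∀ x, 0 < x → HasDerivAt η₁ (η₂ x) x)
    (hg : MemLp (fun x => besselPotential m k x * η x - η₂ x) 2 halfMeasure)
    (hη : ∀ᶠ x in atTop, η x = 0 ∧ η₁ x = 0)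
    (h0 : Tendsto (fun x => solI' m k x * η x - solI m k x * η₁ x) (𝓝[>] 0) (𝓝 0))
    {f : L2} (hf : f =ᵐ[halfMeasure] fun x => besselPotential m k x * η x - η₂ x) :
    R f =ᵐ[halfMeasure] η := by
  filter_upwards [hR.2 f, ae_restrict_mem measurableSet_Ioi] with x hx hx0
  rw [hx.2, integral_resolventKernel_mul hm hk hf hg hx0, integral_Ioc_solI_mul hm hk h1 h2 hg h0
    hx0, integral_Ioi_solK_mul m hk h1 h2 hg hη hx0]
  linear_combination η x * solI_solK_wronskian hm hk hx0

end LeftInverse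

/-! ### Test functions -/

section TestFunction

variable {m k : ℂ} (φ : 𝓓(halfLine, ℂ))

theorem testFunction_eventuallyEq_atTop : ∀ᶠ x in atTop, φ x = 0 ∧ deriv φ x = 0 := by
  have h1 : (φ : ℝ → ℂ) =ᶠ[cocompact ℝ] 0 :=
    coclosedCompact_eq_cocompact (X := ℝ) ▸
      hasCompactSupport_iff_eventuallyEq.1 φ.hasCompactSupport'
  have h2 : deriv (φ : ℝ → ℂ) =ᶠ[cocompact ℝ] 0 :=
    coclosedCompact_eq_cocompact (X := ℝ) ▸
      hasCompactSupport_iff_eventuallyEq.1 (HasCompactSupport.deriv φ.hasCompactSupport')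
  filter_upwards [atTop_le_cocompact h1, atTop_le_cocompact h2] with x hx1 hx2
  exact ⟨hx1, hx2⟩

theorem testFunction_eventuallyEq_nhds_zero : ∀ᶠ x in 𝓝 0, φ x = 0 ∧ deriv φ x = 0 := by
  have h0 : (0 : ℝ) ∉ tsupport φ := fun h => lt_irrefl (0 : ℝ) (φ.tsupport_subset' h)
  have h1 := notMem_tsupport_iff_eventuallyEq.1 h0
  filter_upwards [h1, h1.deriv] with x hx1 hx2
  exact ⟨hx1, by simpa using hx2⟩

theorem mul_add_diffExpr_eq (η : ℝ → ℂ) (x : ℝ) :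
    k ^ 2 * η x + diffExpr (m ^ 2) η x = besselPotential m k x * η x - deriv (deriv η) x := by
  rw [diffExpr, besselPotential]
  ring

theorem kernel_operator_coreGraph {R : L2 →L[ℂ] L2}
    (hR : HasIntegralKernel R (resolventKernel m k)) (hm : -1 < m.re) (hk : 0 < k.re)
    {p : L2 × L2} (hp : p ∈ coreGraph (m ^ 2)) : R (k ^ 2 • p.1 + p.2) = p.1 := by
  obtain ⟨φ, h1, h2⟩ := hp
  refine Lp.ext ((kernel_operator_apply hR hm hk (η := φ) (η₁ := deriv φ) (η₂ := deriv (deriv φ))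
    (fun x _ => (testFunction_differentiable φ x).hasDerivAt)
    (fun x _ => (testFunction_differentiable_deriv φ x).hasDerivAt) ?_
    (testFunction_eventuallyEq_atTop φ) ?_ ?_).trans h1.symm)
  · simp_rw [← mul_add_diffExpr_eq]
    exact ((memLp_testFunction φ).const_mul _).add (memLp_diffExpr φ _)
  · refine tendsto_const_nhds.congr' ?_
    filter_upwards [nhdsWithin_le_nhds (testFunction_eventuallyEq_nhds_zero φ)] with x hx
    simp [hx.1, hx.2]
  · filter_upwards [Lp.coeFn_add (k ^ 2 • p.1) p.2, Lp.coeFn_smul (k ^ 2) p.1, h1, h2]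
      with x e1 e2 e3 e4
    rw [e1, Pi.add_apply, e2, Pi.smul_apply, e3, e4, smul_eq_mul, mul_add_diffExpr_eq]

/-- Green's formula against test functions. -/
theorem mem_maxGraph_of_hasDerivAt {η η₁ η₂ g : ℝ → ℂ}
    (h1 : ∀ x, 0 < x → HasDerivAt η (η₁ x) x) (h2 : ∀ x, 0 < x → HasDerivAt η₁ (η₂ x) x)
    (hg : ∀ x, 0 < x → g x = -η₂ x + (-1 / 4 + m ^ 2) / (x : ℂ) ^ 2 * η x)
    (mη : MemLp η 2 halfMeasure) (mg : MemLp g 2 halfMeasure) :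
    (mη.toLp η, mg.toLp g) ∈ maxGraph (m ^ 2) := by
  intro φ
  have e1 : ∫ x in Ioi (0 : ℝ), mη.toLp η x * diffExpr (m ^ 2) φ x =
      ∫ x in Ioi (0 : ℝ), η x * diffExpr (m ^ 2) φ x := by
    refine integral_congr_ae ?_
    filter_upwards [mη.coeFn_toLp] with x hx
    rw [hx]
  have e2 : ∫ x in Ioi (0 : ℝ), mg.toLp g x * φ x = ∫ x in Ioi (0 : ℝ), g x * φ x := by
    refine integral_congr_ae ?_
    filter_upwards [mg.coeFn_toLp] with x hx
    rw [hx]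
  have i1 : Integrable (fun x => η x * diffExpr (m ^ 2) φ x) halfMeasure :=
    mη.integrable_mul (memLp_diffExpr φ _)
  have i2 : Integrable (fun x => g x * φ x) halfMeasure := mg.integrable_mul (memLp_testFunction φ)
  simp only
  rw [e1, e2, ← sub_eq_zero, ← integral_sub i1 i2]
  set W : ℝ → ℂ := fun x => η₁ x * φ x - η x * deriv φ x
  have hW : ∀ x ∈ Ioi (0 : ℝ),
      HasDerivAt W (η x * diffExpr (m ^ 2) φ x - g x * φ x) x := fun x hx => by
    refine (((h2 x hx).mul (testFunction_differentiable φ x).hasDerivAt).sub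
      ((h1 x hx).mul (testFunction_differentiable_deriv φ x).hasDerivAt)).congr_deriv ?_
    rw [hg x hx, diffExpr]
    ring
  have hW0 : W =ᶠ[𝓝 0] fun _ => 0 := by
    filter_upwards [testFunction_eventuallyEq_nhds_zero φ] with x hx
    simp [W, hx.1, hx.2]
  have key := integral_Ioi_of_hasDerivAt_of_tendsto (a := 0) (m := 0)
    (continuousAt_const.congr hW0.symm).continuousWithinAt hW (i1.sub i2) ?_
  · rw [key, hW0.eq_of_nhds, sub_zero]
  · refine tendsto_const_nhds.congr' ?_
    filter_upwards [testFunction_eventuallyEq_atTop φ] with x hx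
    simp [W, hx.1, hx.2]

end TestFunction

/-! ### The boundary function `x^{1/2+m} ξ` -/

section Boundary

variable {m k : ℂ} {ξ : ℝ → ℝ}

/-- The function `x^{1/2+m} ξ`. -/
def bdry (m : ℂ) (ξ : ℝ → ℝ) (x : ℝ) : ℂ := (x : ℂ) ^ (1 / 2 + m) * (ξ x : ℂ)

/-- The derivative of `bdry`. -/
def bdry' (m : ℂ) (ξ : ℝ → ℝ) (x : ℝ) : ℂ :=
  (x : ℂ) ^ (1 / 2 + m) * ((1 / 2 + m) / x * (ξ x : ℂ) + ((deriv ξ x : ℝ) : ℂ))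

/-- The image of `bdry` under the differential expression. -/
def bdryImage (m : ℂ) (ξ : ℝ → ℝ) (x : ℝ) : ℂ :=
  -((x : ℂ) ^ (1 / 2 + m) *
    (2 * (1 / 2 + m) / x * ((deriv ξ x : ℝ) : ℂ) + ((deriv (deriv ξ) x : ℝ) : ℂ)))

theorem IsCutoff.contDiff_deriv (hξ : IsCutoff ξ) : ContDiff ℝ ∞ (deriv ξ) :=
  (contDiff_infty_iff_deriv.1 hξ.1).2

theorem IsCutoff.continuous_deriv_deriv (hξ : IsCutoff ξ) : Continuous (deriv (deriv ξ)) :=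
  (contDiff_infty_iff_deriv.1 hξ.contDiff_deriv).2.continuous

theorem hasDerivAt_ofReal_cpow (a : ℂ) {x : ℝ} (hx : 0 < x) :
    HasDerivAt (fun x : ℝ => (x : ℂ) ^ a) (a / x * (x : ℂ) ^ a) x := by
  have hx0 : (x : ℂ) ≠ 0 := by exact_mod_cast hx.ne'
  have h1 := ((hasDerivAt_id (x : ℂ)).cpow_const (c := a) (Or.inl (by simpa using hx))).comp_ofReal
  refine h1.congr_deriv ?_
  simp only [id]
  rw [Complex.cpow_sub _ _ hx0, Complex.cpow_one]
  ring

theorem hasDerivAt_bdry (m : ℂ) (hξ : IsCutoff ξ) {x : ℝ} (hx : 0 < x) :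
    HasDerivAt (bdry m ξ) (bdry' m ξ x) x := by
  have h := (hξ.1.differentiable (by simp) x).hasDerivAt.ofReal_comp
  refine ((hasDerivAt_ofReal_cpow (1 / 2 + m) hx).mul h).congr_deriv ?_
  rw [bdry']
  ring

theorem hasDerivAt_bdry' (m : ℂ) (hξ : IsCutoff ξ) {x : ℝ} (hx : 0 < x) :
    HasDerivAt (bdry' m ξ) (-bdryImage m ξ x + (-1 / 4 + m ^ 2) / (x : ℂ) ^ 2 * bdry m ξ x) x := by
  have hx0 : (x : ℂ) ≠ 0 := by exact_mod_cast hx.ne'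
  have h := (hξ.1.differentiable (by simp) x).hasDerivAt.ofReal_comp
  have h' := (hξ.contDiff_deriv.differentiable (by simp) x).hasDerivAt.ofReal_comp
  have hinv : HasDerivAt (fun x : ℝ => (1 / 2 + m) / (x : ℂ))
      (((0 : ℂ) * x - (1 / 2 + m) * 1) / (x : ℂ) ^ 2) x :=
    (hasDerivAt_const x (1 / 2 + m)).div (hasDerivAt_id x).ofReal_comp hx0
  refine ((hasDerivAt_ofReal_cpow (1 / 2 + m) hx).mul ((hinv.mul h).add h')).congr_deriv ?_
  simp only [bdryImage, bdry, Pi.add_apply, Pi.mul_apply]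
  field_simp
  ring

theorem IsCutoff.exists_pos (hξ : IsCutoff ξ) :
    ∃ δ > 0, ∀ x < δ, 0 < x → ξ x = 1 ∧ deriv ξ x = 0 ∧ deriv (deriv ξ) x = 0 := by
  have h0 : ξ =ᶠ[𝓝 0] fun _ => 1 := hξ.2.2
  have h1 : deriv ξ =ᶠ[𝓝 0] fun _ => 0 := h0.deriv.trans (by simp)
  have h2 : deriv (deriv ξ) =ᶠ[𝓝 0] fun _ => 0 := h1.deriv.trans (by simp)
  obtain ⟨δ, hδ, h⟩ := Metric.eventually_nhds_iff.1 (h0.and (h1.and h2))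
  exact ⟨δ, hδ, fun x hx hx0 => h (by rw [Real.dist_0_eq_abs, abs_of_pos hx0]; exact hx)⟩

theorem IsCutoff.exists_bound (hξ : IsCutoff ξ) :
    ∃ T > 0, ∀ x > T, ξ x = 0 ∧ deriv ξ x = 0 ∧ deriv (deriv ξ) x = 0 := by
  have h : ∀ g : ℝ → ℝ, HasCompactSupport g → ∀ᶠ x in atTop, g x = 0 := fun g hg =>
    atTop_le_cocompact (coclosedCompact_eq_cocompact (X := ℝ) ▸
      hasCompactSupport_iff_eventuallyEq.1 hg)
  obtain ⟨T, hT⟩ := eventually_atTop.1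
    ((h ξ hξ.2.1).and ((h _ hξ.2.1.deriv).and (h _ hξ.2.1.deriv.deriv)))
  exact ⟨max T 1, by positivity, fun x hx => hT x ((le_max_left _ _).trans hx.le)⟩

theorem eventually_bdry_eq_zero (m : ℂ) (hξ : IsCutoff ξ) :
    ∀ᶠ x in atTop, bdry m ξ x = 0 ∧ bdry' m ξ x = 0 := by
  obtain ⟨T, -, hT⟩ := hξ.exists_bound
  filter_upwards [eventually_gt_atTop T] with x hx
  obtain ⟨h1, h2, -⟩ := hT x hx
  simp [bdry, bdry', h1, h2]

theorem continuousOn_ofReal_cpow (a : ℂ) : ContinuousOn (fun x : ℝ => (x : ℂ) ^ a) (Ioi 0) :=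
  fun _ hx => (hasDerivAt_ofReal_cpow a hx).continuousAt.continuousWithinAt

theorem memLp_bdryImage (m : ℂ) (hξ : IsCutoff ξ) : MemLp (bdryImage m ξ) 2 halfMeasure := by
  obtain ⟨δ, hδ0, hδ⟩ := hξ.exists_pos
  obtain ⟨T, hT0, hT⟩ := hξ.exists_bound
  have hc : ContinuousOn (bdryImage m ξ) (Ioi 0) := by
    have h1 := hξ.contDiff_deriv.continuous
    have h2 := hξ.continuous_deriv_deriv
    have h3 : ContinuousOn (fun x : ℝ => 2 * (1 / 2 + m) / (x : ℂ)) (Ioi 0) :=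
      ContinuousOn.div (by fun_prop) (by fun_prop) fun x hx => by
        exact_mod_cast (ne_of_gt hx)
    exact ((continuousOn_ofReal_cpow _).mul ((h3.mul (by fun_prop)).add (by fun_prop))).neg
  obtain ⟨C, hC⟩ := (isCompact_Icc (a := δ) (b := T)).exists_bound_of_continuousOn
    (hc.mono fun x hx => hδ0.trans_le hx.1)
  have hi : MemLp ((Icc δ T).indicator fun _ => C) 2 halfMeasure :=
    memLp_indicator_const 2 measurableSet_Icc C (Or.inr (by
      refine ((Measure.restrict_apply_le _ _).trans_lt ?_).ne
      simp))
  refine hi.mono' (hc.aestronglyMeasurable measurableSet_Ioi) ?_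
  filter_upwards [ae_restrict_mem measurableSet_Ioi] with x hx
  by_cases h : x ∈ Icc δ T
  · rw [indicator_of_mem h]
    exact hC x h
  · rw [indicator_of_notMem h]
    have : deriv ξ x = 0 ∧ deriv (deriv ξ) x = 0 := by
      by_cases h1 : x < δ
      · exact (hδ x h1 hx).2
      · exact (hT x (by
          by_contra h2
          exact h ⟨not_lt.1 h1, not_lt.1 h2⟩)).2
    simp [bdryImage, this.1, this.2]

theorem memLp_bdry (hm : -1 < m.re) (hξ : IsCutoff ξ) : MemLp (bdry m ξ) 2 halfMeasure := by
  obtain ⟨T, hT0, hT⟩ := hξ.exists_bound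
  obtain ⟨C, hC⟩ := hξ.2.1.exists_bound_of_continuous hξ.1.continuous
  have hc : ContinuousOn (bdry m ξ) (Ioi 0) := fun x hx =>
    (hasDerivAt_bdry m hξ hx).continuousAt.continuousWithinAt
  have hi : MemLp ((Ioo 0 (T + 1)).indicator fun x : ℝ => x ^ (1 / 2 + m.re)) 2 halfMeasure := by
    rw [memLp_two_iff_integrable_sq
      (Measurable.indicator (by fun_prop) measurableSet_Ioo).aestronglyMeasurable]
    have h1 : IntegrableOn (fun x : ℝ => x ^ (1 + 2 * m.re)) (Ioo 0 (T + 1)) :=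
      (intervalIntegral.integrableOn_Ioo_rpow_iff (by linarith)).2 (by linarith)
    have h2 := ((integrable_indicator_iff measurableSet_Ioo).2 h1).restrict (s := Ioi 0)
    refine h2.congr (Eventually.of_forall fun x => ?_)
    by_cases h : x ∈ Ioo 0 (T + 1)
    · simp only [indicator_of_mem h]
      rw [← Real.rpow_natCast, ← Real.rpow_mul h.1.le]
      congr 1
      push_cast
      ring
    · simp [indicator_of_notMem h]
  refine (hi.const_mul C).mono' (hc.aestronglyMeasurable measurableSet_Ioi) ?_
  filter_upwards [ae_restrict_mem measurableSet_Ioi] with x hx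
  by_cases h : x ∈ Ioo 0 (T + 1)
  · rw [indicator_of_mem h, bdry, norm_mul, Complex.norm_cpow_eq_rpow_re_of_pos hx, mul_comm,
      Complex.norm_real]
    simp only [Complex.add_re, Complex.div_ofNat_re, Complex.one_re]
    exact mul_le_mul_of_nonneg_right (hC x) (Real.rpow_nonneg h.1.le _)
  · have hx0 : (0 : ℝ) < x := hx
    have : ξ x = 0 := (hT x (by
      by_contra h2
      exact h ⟨hx0, by linarith⟩)).1
    simp [indicator_of_notMem h, bdry, this]

theorem solI'_eq (m : ℂ) (hk : 0 < k.re) {x : ℝ} (hx : 0 < x) :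
    solI' m k x = (k / 2) ^ m * ((x : ℂ) ^ (1 / 2 + m) *
      ((1 / 2 + m) / x * besselF m (k ^ 2 * x ^ 2 / 4) +
        besselF (m + 1) (k ^ 2 * x ^ 2 / 4) * (k ^ 2 * x / 2))) := by
  have h1 : HasDerivAt (fun x : ℝ => k ^ 2 * (x : ℂ) ^ 2 / 4) (k ^ 2 * x / 2) x := by
    refine (((((hasDerivAt_id x).ofReal_comp).pow 2).const_mul (k ^ 2)).div_const 4).congr_deriv ?_
    simp
    ring
  have h2 : HasDerivAt (fun x : ℝ => besselF m (k ^ 2 * x ^ 2 / 4))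
      (besselF (m + 1) (k ^ 2 * x ^ 2 / 4) * (k ^ 2 * x / 2)) x := by
    have hF := hasDerivAt_besselF m (k ^ 2 * (x : ℂ) ^ 2 / 4)
    exact hF.comp x h1
  have h3 := ((hasDerivAt_ofReal_cpow (1 / 2 + m) hx).mul h2).const_mul ((k / 2) ^ m)
  have h4 := h3.congr_of_eventuallyEq (f₁ := solI m k) (by
    filter_upwards [Ioi_mem_nhds hx] with y hy
    exact solI_eq m hk hy)
  rw [((isSolution_solI m hk) x hx).1.unique h4]
  ring

theorem eventually_wronskian_bdry (m : ℂ) (hk : 0 < k.re) (hξ : IsCutoff ξ) :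
    ∀ᶠ x in 𝓝[>] (0 : ℝ), bdry m ξ x = (x : ℂ) ^ (1 / 2 + m) ∧
      solI' m k x * bdry m ξ x - solI m k x * bdry' m ξ x =
        (x : ℂ) ^ (1 / 2 + m) * ((k / 2) ^ m * (k ^ 2 / 2) *
          (x * (x : ℂ) ^ (1 / 2 + m) * besselF (m + 1) (k ^ 2 * x ^ 2 / 4))) := by
  obtain ⟨δ, hδ0, hδ⟩ := hξ.exists_pos
  have h1 : ∀ᶠ x in 𝓝[>] (0 : ℝ), x < δ := nhdsWithin_le_nhds (Iio_mem_nhds hδ0)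
  filter_upwards [self_mem_nhdsWithin, h1] with x hx hxδ
  obtain ⟨e1, e2, -⟩ := hδ x hxδ hx
  refine ⟨by simp [bdry, e1], ?_⟩
  rw [solI_eq m hk hx, solI'_eq m hk hx, bdry, bdry', e1, e2]
  push_cast
  ring

theorem tendsto_rpow_nhdsGT_zero {p : ℝ} (hp : 0 < p) :
    Tendsto (fun x : ℝ => x ^ p) (𝓝[>] 0) (𝓝 0) := by
  have : ContinuousAt (fun x : ℝ => x ^ p) 0 := Real.continuousAt_rpow_const _ _ (Or.inr hp.le)
  simpa [Real.zero_rpow hp.ne'] using this.tendsto.mono_left (nhdsWithin_le_nhds (s := Ioi 0))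

theorem tendsto_besselF_mul_sq (m k : ℂ) :
    Tendsto (fun x : ℝ => besselF m (k ^ 2 * x ^ 2 / 4)) (𝓝[>] 0)
      (𝓝 (Complex.Gamma (m + 1))⁻¹) := by
  have : Continuous fun x : ℝ => besselF m (k ^ 2 * x ^ 2 / 4) :=
    (continuous_besselF m).comp (by fun_prop)
  simpa [besselF_zero] using (this.tendsto 0).mono_left (nhdsWithin_le_nhds (s := Ioi 0))

theorem tendsto_wronskian_bdry (hm : -1 < m.re) (hk : 0 < k.re) (hξ : IsCutoff ξ) :
    Tendsto (fun x => solI' m k x * bdry m ξ x - solI m k x * bdry' m ξ x) (𝓝[>] 0) (𝓝 0) := by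
  have h1 : Tendsto (fun x : ℝ => (x : ℂ) ^ (1 / 2 + m) * (x * (x : ℂ) ^ (1 / 2 + m)))
      (𝓝[>] 0) (𝓝 0) := by
    refine squeeze_zero_norm' (a := fun x => x ^ (2 + 2 * m.re)) ?_
      (tendsto_rpow_nhdsGT_zero (by linarith))
    filter_upwards [self_mem_nhdsWithin] with x hx
    have hx0 : (0 : ℝ) < x := hx
    rw [norm_mul, norm_mul, Complex.norm_cpow_eq_rpow_re_of_pos hx0, Complex.norm_real,
      Real.norm_of_nonneg hx0.le]
    nth_rewrite 2 [← Real.rpow_one x]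
    rw [← Real.rpow_add hx0, ← Real.rpow_add hx0]
    simp only [Complex.add_re, Complex.div_ofNat_re, Complex.one_re]
    refine le_of_eq ?_
    congr 1
    ring
  have h2 := (h1.mul (tendsto_besselF_mul_sq (m + 1) k)).const_mul ((k / 2) ^ m * (k ^ 2 / 2))
  rw [zero_mul, mul_zero] at h2
  refine h2.congr' ?_
  filter_upwards [eventually_wronskian_bdry m hk hξ] with x hx
  rw [hx.2]
  ring

/-- The pair `(x^{1/2+m} ξ, L x^{1/2+m} ξ)` in `L² × L²`. -/
def bdryPair (hm : -1 < m.re) (hξ : IsCutoff ξ) : L2 × L2 :=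
  ((memLp_bdry hm hξ).toLp _, (memLp_bdryImage m hξ).toLp _)

theorem bdryPair_mem_maxGraph (hm : -1 < m.re) (hξ : IsCutoff ξ) :
    bdryPair hm hξ ∈ maxGraph (m ^ 2) :=
  mem_maxGraph_of_hasDerivAt (fun _ hx => hasDerivAt_bdry m hξ hx)
    (fun _ hx => hasDerivAt_bdry' m hξ hx) (fun _ _ => by ring)
    (memLp_bdry hm hξ) (memLp_bdryImage m hξ)

theorem besselPotential_mul_bdry_sub (x : ℝ) :
    besselPotential m k x * bdry m ξ x -
      (-bdryImage m ξ x + (-1 / 4 + m ^ 2) / (x : ℂ) ^ 2 * bdry m ξ x) =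
      k ^ 2 * bdry m ξ x + bdryImage m ξ x := by
  rw [besselPotential]
  ring

theorem memLp_besselPotential_mul_bdry_sub (k : ℂ) (hm : -1 < m.re) (hξ : IsCutoff ξ) :
    MemLp (fun x => besselPotential m k x * bdry m ξ x -
      (-bdryImage m ξ x + (-1 / 4 + m ^ 2) / (x : ℂ) ^ 2 * bdry m ξ x)) 2 halfMeasure := by
  simp_rw [besselPotential_mul_bdry_sub]
  exact ((memLp_bdry hm hξ).const_mul _).add (memLp_bdryImage m hξ)

theorem smul_bdryPair_add_coeFn (k : ℂ) (hm : -1 < m.re) (hξ : IsCutoff ξ) :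
    (k ^ 2 • (bdryPair hm hξ).1 + (bdryPair hm hξ).2 : L2) =ᵐ[halfMeasure] fun x =>
      besselPotential m k x * bdry m ξ x -
      (-bdryImage m ξ x + (-1 / 4 + m ^ 2) / (x : ℂ) ^ 2 * bdry m ξ x) := by
  filter_upwards [Lp.coeFn_add (k ^ 2 • (bdryPair hm hξ).1) (bdryPair hm hξ).2,
    Lp.coeFn_smul (k ^ 2) (bdryPair hm hξ).1, (memLp_bdry hm hξ).coeFn_toLp,
    (memLp_bdryImage m hξ).coeFn_toLp] with x e1 e2 e3 e4
  rw [e1, Pi.add_apply, e2, Pi.smul_apply, besselPotential_mul_bdry_sub]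
  simp only [bdryPair]
  rw [e3, e4, smul_eq_mul]

theorem kernel_operator_bdryPair {R : L2 →L[ℂ] L2}
    (hR : HasIntegralKernel R (resolventKernel m k)) (hm : -1 < m.re) (hk : 0 < k.re)
    (hξ : IsCutoff ξ) :
    R (k ^ 2 • (bdryPair hm hξ).1 + (bdryPair hm hξ).2) = (bdryPair hm hξ).1 :=
  Lp.ext ((kernel_operator_apply hR hm hk (fun _ hx => hasDerivAt_bdry m hξ hx)
    (fun _ hx => hasDerivAt_bdry' m hξ hx) (memLp_besselPotential_mul_bdry_sub k hm hξ)
    (eventually_bdry_eq_zero m hξ) (tendsto_wronskian_bdry hm hk hξ)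
    (smul_bdryPair_add_coeFn k hm hξ)).trans (memLp_bdry hm hξ).coeFn_toLp.symm)

end Boundary

/-! ### The graph of `H_m` -/

section Graph

variable {m k : ℂ} {ξ : ℝ → ℝ}

/-- The graph of `H_m`. -/
def graphH (hm : -1 < m.re) (hξ : IsCutoff ξ) : Submodule ℂ (L2 × L2) :=
  (coreGraph (m ^ 2)).topologicalClosure ⊔ Submodule.span ℂ {bdryPair hm hξ}

theorem isClosed_graphH (hm : -1 < m.re) (hξ : IsCutoff ξ) :
    IsClosed (graphH hm hξ : Set (L2 × L2)) :=
  Submodule.isClosed_sup_finiteDimensional _ _ (Submodule.isClosed_topologicalClosure _)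

theorem graphH_le_maxGraph (hm : -1 < m.re) (hξ : IsCutoff ξ) :
    graphH hm hξ ≤ maxGraph (m ^ 2) :=
  sup_le (closure_coreGraph_le_maxGraph _)
    ((Submodule.span_singleton_le_iff_mem _ _).2 (bdryPair_mem_maxGraph hm hξ))

theorem boundaryLine_eq (hm : -1 < m.re) (hξ : IsCutoff ξ) :
    boundaryLine m ξ = Submodule.span ℂ {(bdryPair hm hξ).1} := by
  rw [boundaryLine]
  congr 1
  ext u
  exact ⟨fun h => Lp.ext (EventuallyEq.trans h (memLp_bdry hm hξ).coeFn_toLp.symm), fun h => by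
    rw [mem_singleton_iff.1 h]
    exact (memLp_bdry hm hξ).coeFn_toLp⟩

theorem mem_graphH_of_mem_domain (hm : -1 < m.re) (hξ : IsCutoff ξ) (u : (H m ξ).domain) :
    ((u : L2), H m ξ u) ∈ graphH hm hξ := by
  have hu : (u : L2) ∈ (LMin (m ^ 2)).domain ⊔ boundaryLine m ξ := u.2.1
  rw [boundaryLine_eq hm hξ, Submodule.mem_sup] at hu
  obtain ⟨w, hw, z, hz, hwz⟩ := hu
  obtain ⟨c, rfl⟩ := Submodule.mem_span_singleton.1 hz
  have h1 : (w, LMin (m ^ 2) ⟨w, hw⟩) ∈ (coreGraph (m ^ 2)).topologicalClosure := by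
    rw [← LMin_graph]
    exact LinearPMap.mem_graph _ ⟨w, hw⟩
  have h2 : (w, LMin (m ^ 2) ⟨w, hw⟩) + c • bdryPair hm hξ ∈ graphH hm hξ :=
    Submodule.add_mem_sup h1 (Submodule.smul_mem _ _ (Submodule.mem_span_singleton_self _))
  have h3 : ((u : L2), H m ξ u) ∈ maxGraph (m ^ 2) := by
    rw [← LMax_graph]
    have h4 : H m ξ u = LMax (m ^ 2) ⟨u, u.2.2⟩ := LinearPMap.domRestrict_apply rfl
    rw [h4]
    exact LinearPMap.mem_graph _ ⟨(u : L2), u.2.2⟩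
  have h5 := sub_mem h3 (graphH_le_maxGraph hm hξ h2)
  have h6 := maxGraph_single_valued _ _ h5 (by simp [← hwz])
  have h7 : ((u : L2), H m ξ u) = (w, LMin (m ^ 2) ⟨w, hw⟩) + c • bdryPair hm hξ :=
    Prod.ext (by simp [← hwz]) (sub_eq_zero.1 h6)
  rw [h7]
  exact h2

theorem exists_domain_of_mem_graphH (hm : -1 < m.re) (hξ : IsCutoff ξ) {p : L2 × L2}
    (hp : p ∈ graphH hm hξ) : ∃ u : (H m ξ).domain, (u : L2) = p.1 ∧ H m ξ u = p.2 := by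
  have h1 : p ∈ (LMax (m ^ 2)).graph := by
    rw [LMax_graph]
    exact graphH_le_maxGraph hm hξ hp
  obtain ⟨w, hw1, hw2⟩ := (LinearPMap.mem_graph_iff _).1 h1
  have h2 : p.1 ∈ (LMin (m ^ 2)).domain ⊔ boundaryLine m ξ := by
    obtain ⟨q, hq, z, hz, rfl⟩ := Submodule.mem_sup.1 hp
    obtain ⟨c, rfl⟩ := Submodule.mem_span_singleton.1 hz
    rw [← LMin_graph] at hq
    rw [boundaryLine_eq hm hξ]
    exact Submodule.add_mem_sup (LinearPMap.mem_domain_of_mem_graph hq)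
      (Submodule.smul_mem _ _ (Submodule.mem_span_singleton_self _))
  have h3 : p.1 ∈ (LMax (m ^ 2)).domain := hw1 ▸ w.2
  refine ⟨⟨p.1, h2, h3⟩, rfl, ?_⟩
  rw [← hw2]
  exact LinearPMap.domRestrict_apply hw1.symm

theorem kernel_operator_graphH {R : L2 →L[ℂ] L2}
    (hR : HasIntegralKernel R (resolventKernel m k)) (hm : -1 < m.re) (hk : 0 < k.re)
    (hξ : IsCutoff ξ) {p : L2 × L2} (hp : p ∈ graphH hm hξ) : R (k ^ 2 • p.1 + p.2) = p.1 := by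
  let T : L2 × L2 →L[ℂ] L2 :=
    R.comp (k ^ 2 • ContinuousLinearMap.fst ℂ L2 L2 + ContinuousLinearMap.snd ℂ L2 L2) -
      ContinuousLinearMap.fst ℂ L2 L2
  have hT : ∀ q : L2 × L2, q ∈ T.ker ↔ R (k ^ 2 • q.1 + q.2) = q.1 := fun q => by
    rw [LinearMap.mem_ker]
    exact sub_eq_zero
  have h : graphH hm hξ ≤ T.ker := by
    refine sup_le (Submodule.topologicalClosure_minimal _ (fun q hq => (hT q).2
      (kernel_operator_coreGraph hR hm hk hq)) T.isClosed_ker)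
      ((Submodule.span_singleton_le_iff_mem _ _).2 ((hT _).2
        (kernel_operator_bdryPair hR hm hk hξ)))
  exact (hT p).1 (h hp)

end Graph

/-! ### Weak solutions -/

section Weak

variable {m k : ℂ}

theorem integrable_mul_testFunction {w : ℝ → ℂ} (hw : LocallyIntegrableOn w (Ioi 0))
    (φ : 𝓓(halfLine, ℂ)) : IntegrableOn (fun x => w x * φ x) (Ioi 0) := by
  have hK : IsCompact (tsupport φ) := φ.hasCompactSupport'
  have h1 : IntegrableOn w (tsupport φ) := hw.integrableOn_compact_subset φ.tsupport_subset' hK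
  have h2 : IntegrableOn (fun x => w x * φ x) (tsupport φ) :=
    h1.mul_continuousOn (testFunction_contDiff φ).continuous.continuousOn hK
  refine ((integrableOn_iff_integrable_of_support_subset ?_).1 h2).integrableOn
  intro x hx
  by_contra h
  exact hx (by simp [image_eq_zero_of_notMem_tsupport h])

/-- The distribution on `(0, ∞)` given by a locally integrable function. -/
def pairing (w : ℝ → ℂ) (hw : LocallyIntegrableOn w (Ioi 0)) : 𝓓(halfLine, ℂ) →ₗ[ℂ] ℂ where
  toFun φ := ∫ x in Ioi (0 : ℝ), w x * φ x
  map_add' φ ψ := by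
    rw [← integral_add (integrable_mul_testFunction hw φ) (integrable_mul_testFunction hw ψ)]
    refine integral_congr_ae (Eventually.of_forall fun x => ?_)
    exact mul_add _ _ _
  map_smul' c φ := by
    rw [RingHom.id_apply, smul_eq_mul, ← integral_const_mul]
    refine integral_congr_ae (Eventually.of_forall fun x => ?_)
    exact mul_left_comm _ _ _

theorem pairing_apply (w : ℝ → ℂ) (hw : LocallyIntegrableOn w (Ioi 0)) (φ : 𝓓(halfLine, ℂ)) :
    pairing w hw φ = ∫ x in Ioi (0 : ℝ), w x * φ x := rfl

theorem ae_eq_zero_of_pairing_eq_zero {w : ℝ → ℂ} (hw : LocallyIntegrableOn w (Ioi 0))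
    (h : ∀ φ : 𝓓(halfLine, ℂ), ∫ x in Ioi (0 : ℝ), w x * φ x = 0) :
    w =ᵐ[halfMeasure] fun _ => 0 := by
  have key := isOpen_Ioi.ae_eq_zero_of_integral_contDiff_smul_eq_zero hw (fun u hu hc hs => by
    let φ : 𝓓(halfLine, ℂ) :=
      { toFun := fun x => (u x : ℂ)
        contDiff' := Complex.ofRealCLM.contDiff.comp hu
        hasCompactSupport' := hc.comp_left (g := fun t : ℝ => (t : ℂ)) (by simp)
        tsupport_subset' := (tsupport_comp_subset (g := fun t : ℝ => (t : ℂ)) (by simp) u).trans hs }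
    rw [← h φ, setIntegral_eq_integral_of_forall_compl_eq_zero]
    · refine integral_congr_ae (Eventually.of_forall fun x => ?_)
      change u x • w x = w x * (u x : ℂ)
      rw [Complex.real_smul, mul_comm]
    · intro x hx
      rw [testFunction_eq_zero φ hx, mul_zero])
  exact (ae_restrict_iff' measurableSet_Ioi).2 key

theorem contDiff_mul_testFunction {w : ℝ → ℂ} (hw : ContDiffOn ℝ ∞ w (Ioi 0))
    (ψ : 𝓓(halfLine, ℂ)) : ContDiff ℝ ∞ fun x => w x * ψ x := by
  rw [contDiff_iff_contDiffAt]
  intro x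
  by_cases hx : x ∈ tsupport ψ
  · exact (hw.contDiffAt (isOpen_Ioi.mem_nhds (ψ.tsupport_subset' hx))).mul
      (testFunction_contDiff ψ).contDiffAt
  · refine (contDiffAt_const (c := (0 : ℂ))).congr_of_eventuallyEq ?_
    filter_upwards [notMem_tsupport_iff_eventuallyEq.1 hx] with y hy
    rw [hy, Pi.zero_apply, mul_zero]

theorem hasDerivAt_primitive {g : ℝ → ℂ} (hg : Continuous g) (x : ℝ) :
    HasDerivAt (fun x => ∫ y in (0 : ℝ)..x, g y) (g x) x :=
  (hg.integral_hasStrictDerivAt 0 x).hasDerivAt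

theorem contDiff_primitive {g : ℝ → ℂ} (hg : ContDiff ℝ ∞ g) :
    ContDiff ℝ ∞ fun x => ∫ y in (0 : ℝ)..x, g y := by
  have h : deriv (fun x => ∫ y in (0 : ℝ)..x, g y) = g :=
    funext fun x => (hasDerivAt_primitive hg.continuous x).deriv
  exact contDiff_infty_iff_deriv.2
    ⟨fun x => (hasDerivAt_primitive hg.continuous x).differentiableAt, by rwa [h]⟩

theorem testFunction_exists_support (ψ : 𝓓(halfLine, ℂ)) :
    ∃ δ T : ℝ, 0 < δ ∧ (∀ x < δ, ψ x = 0) ∧ ∀ x, T ≤ x → ψ x = 0 := by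
  obtain ⟨δ, hδ, h⟩ := Metric.eventually_nhds_iff.1 (testFunction_eventuallyEq_nhds_zero ψ)
  obtain ⟨T, hT⟩ := eventually_atTop.1 (testFunction_eventuallyEq_atTop ψ)
  refine ⟨δ, T, hδ, fun x hx => ?_, fun x hx => (hT x hx).1⟩
  rcases le_or_gt x 0 with h0 | h0
  · exact testFunction_eq_zero ψ (not_lt.2 h0)
  · exact (h (by rwa [Real.dist_0_eq_abs, abs_of_pos h0])).1

/-- Solvability of `k² φ + L φ = ψ` in test functions. -/
theorem exists_testFunction_of_pairing_eq_zero (hm : -1 < m.re) (hk : 0 < k.re)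
    (ψ : 𝓓(halfLine, ℂ)) (hI : ∫ x in Ioi (0 : ℝ), solI m k x * ψ x = 0)
    (hK : ∫ x in Ioi (0 : ℝ), solK m k x * ψ x = 0) :
    ∃ φ : 𝓓(halfLine, ℂ), ∀ x, 0 < x → k ^ 2 * φ x + diffExpr (m ^ 2) φ x = ψ x := by
  have sI := isSolution_solI m hk
  have sK := isSolution_solK m hk
  have cI := sI.contDiffOn (contDiffOn_besselPotential m k)
  have cK := sK.contDiffOn (contDiffOn_besselPotential m k)
  obtain ⟨δ, T, hδ0, hδ, hT⟩ := testFunction_exists_support ψ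
  have hpre : ∀ w : ℝ → ℂ, ∫ x in Ioi (0 : ℝ), w x * ψ x = 0 → ∀ x, (x < δ ∨ T < x) →
      ∫ y in (0 : ℝ)..x, w y * ψ y = 0 := fun w hw x hx => by
    have hsmall : ∀ x < δ, ∫ y in (0 : ℝ)..x, w y * ψ y = 0 := fun x hx => by
      rw [intervalIntegral.integral_congr (g := fun _ => 0), intervalIntegral.integral_zero]
      intro y hy
      have hy2 : y ≤ max 0 x := hy.2
      simp only
      rw [hδ y (hy2.trans_lt (max_lt hδ0 hx)), mul_zero]
    rcases hx with hx | hx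
    · exact hsmall x hx
    · rcases lt_or_ge x δ with h | h
      · exact hsmall x h
      · rw [intervalIntegral.integral_of_le (hδ0.le.trans h), ← hw]
        refine (setIntegral_eq_of_subset_of_forall_sdiff_eq_zero measurableSet_Ioi
          (fun y hy => hy.1) fun y hy => ?_).symm
        have hy2 : x < y := by
          by_contra hcon
          exact hy.2 ⟨hy.1, not_lt.1 hcon⟩
        rw [hT y (hx.trans hy2).le, mul_zero]
  set A : ℝ → ℂ := fun x => ∫ y in (0 : ℝ)..x, solI m k y * ψ y
  set B : ℝ → ℂ := fun x => ∫ y in (0 : ℝ)..x, solK m k y * ψ y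
  have gI := contDiff_mul_testFunction cI ψ
  have gK := contDiff_mul_testFunction cK ψ
  have cA : ContDiff ℝ ∞ A := contDiff_primitive gI
  have cB : ContDiff ℝ ∞ B := contDiff_primitive gK
  have dA : ∀ x, HasDerivAt A (solI m k x * ψ x) x := hasDerivAt_primitive gI.continuous
  have dB : ∀ x, HasDerivAt B (solK m k x * ψ x) x := hasDerivAt_primitive gK.continuous
  set Φ : ℝ → ℂ := fun x => solK m k x * A x - solI m k x * B x
  have hΦ0 : ∀ x, (x < δ ∨ T < x) → Φ x = 0 := fun x hx => by
    simp only [Φ, A, B]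
    rw [hpre _ hI x hx, hpre _ hK x hx, mul_zero, mul_zero, sub_zero]
  have hsupp : tsupport Φ ⊆ Icc δ T := by
    refine closure_minimal (fun x hx => ?_) isClosed_Icc
    by_contra h
    refine hx (hΦ0 x ?_)
    by_contra hcon
    rw [not_or, not_lt, not_lt] at hcon
    exact h hcon
  let φ : 𝓓(halfLine, ℂ) :=
    { toFun := Φ
      contDiff' := by
        rw [contDiff_iff_contDiffAt]
        intro x
        rcases lt_or_ge x δ with h | h
        · refine (contDiffAt_const (c := (0 : ℂ))).congr_of_eventuallyEq ?_
          filter_upwards [Iio_mem_nhds h] with y hy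
          exact hΦ0 y (Or.inl hy)
        · have hx : Ioi (0 : ℝ) ∈ 𝓝 x := Ioi_mem_nhds (hδ0.trans_le h)
          exact ((cK.contDiffAt hx).mul cA.contDiffAt).sub ((cI.contDiffAt hx).mul cB.contDiffAt)
      hasCompactSupport' := isCompact_Icc.of_isClosed_subset (isClosed_tsupport _) hsupp
      tsupport_subset' := hsupp.trans fun x hx => hδ0.trans_le hx.1 }
  have d1 : ∀ x, 0 < x → HasDerivAt Φ (solK' m k x * A x - solI' m k x * B x) x := fun x hx => by
    refine (((sK x hx).1.mul (dA x)).sub ((sI x hx).1.mul (dB x))).congr_deriv ?_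
    ring
  have d2 : ∀ x, 0 < x → HasDerivAt (fun x => solK' m k x * A x - solI' m k x * B x)
      (besselPotential m k x * Φ x - ψ x) x := fun x hx => by
    refine (((sK x hx).2.mul (dA x)).sub ((sI x hx).2.mul (dB x))).congr_deriv ?_
    simp only [Φ]
    linear_combination (-ψ x) * solI_solK_wronskian hm hk hx
  refine ⟨φ, fun x hx => ?_⟩
  have e1 : deriv Φ =ᶠ[𝓝 x] fun x => solK' m k x * A x - solI' m k x * B x := by
    filter_upwards [Ioi_mem_nhds hx] with y hy
    exact (d1 y hy).deriv
  have e2 : deriv (deriv Φ) x = besselPotential m k x * Φ x - ψ x := by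
    rw [e1.deriv_eq, (d2 x hx).deriv]
  rw [mul_add_diffExpr_eq]
  change besselPotential m k x * Φ x - deriv (deriv Φ) x = ψ x
  rw [e2]
  ring

/-- A weak solution of `k² h + L h = 0` on `(0, ∞)` is a combination of the two solutions. -/
theorem exists_eq_of_weak_solution (hm : -1 < m.re) (hk : 0 < k.re) {h : ℝ → ℂ}
    (hh : LocallyIntegrableOn h (Ioi 0))
    (h0 : ∀ φ : 𝓓(halfLine, ℂ),
      ∫ x in Ioi (0 : ℝ), h x * (k ^ 2 * φ x + diffExpr (m ^ 2) φ x) = 0) :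
    ∃ a b : ℂ, h =ᵐ[halfMeasure] fun x => a * solI m k x + b * solK m k x := by
  have lI : LocallyIntegrableOn (solI m k) (Ioi 0) :=
    (isSolution_solI m hk).continuousOn.locallyIntegrableOn measurableSet_Ioi
  have lK : LocallyIntegrableOn (solK m k) (Ioi 0) :=
    (isSolution_solK m hk).continuousOn.locallyIntegrableOn measurableSet_Ioi
  have hspan : pairing h hh ∈ Submodule.span ℂ
      (range ![pairing (solI m k) lI, pairing (solK m k) lK]) := by
    refine mem_span_of_iInf_ker_le_ker fun ψ hψ => ?_
    rw [Submodule.mem_iInf] at hψ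
    have h1 : pairing (solI m k) lI ψ = 0 := by simpa using hψ 0
    have h2 : pairing (solK m k) lK ψ = 0 := by simpa using hψ 1
    obtain ⟨φ, hφ⟩ := exists_testFunction_of_pairing_eq_zero hm hk ψ h1 h2
    rw [LinearMap.mem_ker, pairing_apply, ← h0 φ]
    refine setIntegral_congr_fun measurableSet_Ioi fun x hx => ?_
    rw [hφ x hx]
  rw [Matrix.range_cons, Matrix.range_cons, Matrix.range_empty, union_empty, singleton_union,
    Submodule.mem_span_pair] at hspan
  obtain ⟨a, b, hab⟩ := hspan
  refine ⟨a, b, ?_⟩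
  have lI' : LocallyIntegrableOn (fun x => a * solI m k x) (Ioi 0) := lI.smul a
  have lK' : LocallyIntegrableOn (fun x => b * solK m k x) (Ioi 0) := lK.smul b
  have key := ae_eq_zero_of_pairing_eq_zero (hh.sub (lI'.add lK')) fun φ => by
    have e := LinearMap.congr_fun hab φ
    rw [LinearMap.add_apply, LinearMap.smul_apply, LinearMap.smul_apply, pairing_apply,
      pairing_apply, pairing_apply, smul_eq_mul, smul_eq_mul] at e
    have i1 := (integrable_mul_testFunction lI φ).const_mul a
    have i2 := (integrable_mul_testFunction lK φ).const_mul b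
    rw [← integral_const_mul, ← integral_const_mul, ← integral_add i1 i2] at e
    have i3 : Integrable (fun x => a * (solI m k x * φ x) + b * (solK m k x * φ x))
        (volume.restrict (Ioi 0)) := i1.add i2
    rw [← sub_eq_zero.2 e.symm, ← integral_sub (integrable_mul_testFunction hh φ) i3]
    refine integral_congr_ae (Eventually.of_forall fun x => ?_)
    simp only [Pi.sub_apply, Pi.add_apply]
    ring
  filter_upwards [key] with x hx
  exact sub_eq_zero.1 hx

/-! ### Square integrability of the solutions -/

theorem not_memLp_solI (hm : -1 < m.re) (hk : 0 < k.re) :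
    ¬ MemLp (solI m k) 2 (volume.restrict (Ioi 1)) := by
  intro hu
  have sI := isSolution_solI m hk
  have sK := isSolution_solK m hk
  obtain ⟨A, hA0, hA⟩ := sI.exists_norm_le_exp hk
  obtain ⟨B, hB0, hB⟩ := exists_norm_solK_le_exp m hk
  obtain ⟨D, hD0, hD⟩ := exists_norm_solK'_le_exp m hk
  have hsub : Ioi (1 : ℝ) ⊆ Ioi 0 := Ioi_subset_Ioi zero_le_one
  have hv : MemLp (solK' m k) 2 (volume.restrict (Ioi 1)) := by
    have hw := (memLp_weight_mul_exp le_rfl (by norm_num) hk 0).mono_measure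
      (Measure.restrict_mono hsub (le_refl volume))
    refine (hw.const_mul D).mono'
      ((sK.continuousOn_deriv.mono hsub).aestronglyMeasurable measurableSet_Ioi) ?_
    filter_upwards [ae_restrict_mem measurableSet_Ioi] with x hx
    have hx1 : (1 : ℝ) < x := hx
    have hwx := one_le_weight 0 (one_pos.trans hx1)
    refine (hD x hx1.le).trans ?_
    rw [zero_sub, abs_neg, abs_of_pos (one_pos.trans hx1)]
    have := (Real.exp_pos (-(k.re * x))).le
    gcongr
    nlinarith
  have huv : IntegrableOn (fun x => solI m k x * solK' m k x) (Ioi 1) := hu.integrable_mul hv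
  set Z := ∫ x in Ioi (1 : ℝ), ‖solI m k x * solK' m k x‖
  have hbd : ∀ x, 1 ≤ x → ‖solI m k x * solK m k x‖ ≤ A * B := fun x hx => by
    rw [norm_mul]
    calc _ ≤ (A * Real.exp (k.re * x)) * (B * Real.exp (-(k.re * x))) :=
          mul_le_mul (hA x hx) (hB x hx) (norm_nonneg _) (by positivity)
      _ = A * B * (Real.exp (k.re * x) * Real.exp (-(k.re * x))) := by ring
      _ = A * B := by rw [← Real.exp_add]; simp
  have key : ∀ N : ℝ, 1 ≤ N → N - 1 ≤ 2 * (A * B) + 2 * Z := fun N hN => by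
    have hd : ∀ x ∈ uIcc 1 N, HasDerivAt (fun x => solI m k x * solK m k x)
        (1 + 2 * (solI m k x * solK' m k x)) x := fun x hx => by
      rw [uIcc_of_le hN] at hx
      have hx0 : 0 < x := one_pos.trans_le hx.1
      refine ((sI x hx0).1.mul (sK x hx0).1).congr_deriv ?_
      linear_combination solI_solK_wronskian hm hk hx0
    have i1 : IntervalIntegrable (fun x => solI m k x * solK' m k x) volume 1 N :=
      (intervalIntegrable_iff_integrableOn_Ioc_of_le hN).2
        (huv.mono_set Ioc_subset_Ioi_self)
    have h1 := intervalIntegral.integral_eq_sub_of_hasDerivAt hd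
      (intervalIntegrable_const.add (i1.const_mul 2))
    rw [intervalIntegral.integral_add intervalIntegrable_const (i1.const_mul 2),
      intervalIntegral.integral_const, intervalIntegral.integral_const_mul] at h1
    have h2 : ‖∫ x in (1 : ℝ)..N, solI m k x * solK' m k x‖ ≤ Z := by
      rw [intervalIntegral.integral_of_le hN]
      exact (norm_integral_le_integral_norm _).trans (setIntegral_mono_set huv.norm
        (Eventually.of_forall fun x => norm_nonneg _) Ioc_subset_Ioi_self.eventuallyLE)
    have h3 : ((N - 1 : ℝ) : ℂ) = solI m k N * solK m k N - solI m k 1 * solK m k 1 -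
        2 * ∫ x in (1 : ℝ)..N, solI m k x * solK' m k x := by
      rw [← h1]
      simp
    have h4 : ‖((N - 1 : ℝ) : ℂ)‖ = N - 1 := by
      rw [Complex.norm_real, Real.norm_of_nonneg (by linarith)]
    rw [← h4, h3]
    refine (norm_sub_le _ _).trans ?_
    rw [norm_mul, Complex.norm_ofNat]
    have h5 := norm_sub_le (solI m k N * solK m k N) (solI m k 1 * solK m k 1)
    have h6 := hbd N hN
    have h7 := hbd 1 le_rfl
    linarith
  have hZ : 0 ≤ Z := integral_nonneg fun x => norm_nonneg _
  have := key (2 * (A * B) + 2 * Z + 2) (by nlinarith [mul_nonneg hA0 hB0])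
  linarith

theorem integral_solK_mul_ne_zero {ξ : ℝ → ℝ} (hm : -1 < m.re) (hk : 0 < k.re) (hξ : IsCutoff ξ)
    (hK : MemLp (solK m k) 2 halfMeasure) :
    ∫ x in Ioi (0 : ℝ), solK m k x * (besselPotential m k x * bdry m ξ x -
      (-bdryImage m ξ x + (-1 / 4 + m ^ 2) / (x : ℂ) ^ 2 * bdry m ξ x)) ≠ 0 := by
  intro h0
  have hg := memLp_besselPotential_mul_bdry_sub k hm hξ
  have hint := hK.integrable_mul hg
  have h1 : Tendsto (fun x => solK m k x * bdry' m ξ x - solK' m k x * bdry m ξ x)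
      (𝓝[>] 0) (𝓝 0) := by
    have hcov : AECover (volume.restrict (Ioi (0 : ℝ))) (𝓝[>] (0 : ℝ)) fun x => Ioi x :=
      aecover_Ioi_of_Ioi (tendsto_id.mono_left nhdsWithin_le_nhds)
    have h2 := hcov.integral_tendsto_of_countably_generated hint
    simp only [Pi.mul_apply] at h2
    rw [h0] at h2
    refine h2.congr' ?_
    filter_upwards [self_mem_nhdsWithin] with x hx
    have hx0 : (0 : ℝ) < x := hx
    rw [Measure.restrict_restrict measurableSet_Ioi,
      inter_eq_self_of_subset_left (Ioi_subset_Ioi hx0.le)]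
    exact integral_Ioi_solK_mul m hk (fun _ hx => hasDerivAt_bdry m hξ hx)
      (fun _ hx => hasDerivAt_bdry' m hξ hx) hg (eventually_bdry_eq_zero m hξ) hx0
  obtain ⟨σ, s, hσ1, hσ2, -⟩ := exists_exponents hm
  obtain ⟨D, hD0, hD⟩ := exists_norm_solK_le_rpow hk hσ1
  have h3 : Tendsto (fun x : ℝ => solK m k x * (x * (x : ℂ) ^ (1 / 2 + m))) (𝓝[>] 0) (𝓝 0) := by
    have hlim := (tendsto_rpow_nhdsGT_zero (p := 2 + m.re - σ) (by linarith)).const_mul D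
    rw [mul_zero] at hlim
    refine squeeze_zero_norm' ?_ hlim
    filter_upwards [self_mem_nhdsWithin] with x hx
    have hx0 : (0 : ℝ) < x := hx
    rw [norm_mul, norm_mul, Complex.norm_cpow_eq_rpow_re_of_pos hx0, Complex.norm_real,
      Real.norm_of_nonneg hx0.le]
    simp only [Complex.add_re, Complex.div_ofNat_re, Complex.one_re]
    calc _ ≤ (D * x ^ (1 / 2 - σ)) * (x * x ^ (1 / 2 + m.re)) := by
          gcongr
          exact hD x hx0
      _ = D * (x ^ (1 / 2 - σ) * (x ^ (1 : ℝ) * x ^ (1 / 2 + m.re))) := by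
          rw [Real.rpow_one]
          ring
      _ = _ := by
          rw [← Real.rpow_add hx0, ← Real.rpow_add hx0]
          ring_nf
  have h4 := ((h3.mul (tendsto_besselF_mul_sq (m + 1) k)).const_mul
    ((k / 2) ^ m * (k ^ 2 / 2))).add
    (((tendsto_besselF_mul_sq m k).const_mul ((k / 2) ^ m)).mul h1)
  simp only [zero_mul, mul_zero, add_zero] at h4
  refine one_ne_zero (α := ℂ) (tendsto_nhds_unique (Tendsto.congr' ?_ tendsto_const_nhds) h4)
  filter_upwards [self_mem_nhdsWithin, eventually_wronskian_bdry m hk hξ] with x hx hW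
  have hx0 : (0 : ℝ) < x := hx
  have hxa : (x : ℂ) ^ (1 / 2 + m) ≠ 0 := by
    rw [Complex.cpow_ne_zero_iff]
    exact Or.inl (by exact_mod_cast hx0.ne')
  have e1 := solI_eq m hk hx0
  have e2 := solI_solK_wronskian hm hk hx0
  obtain ⟨e3, e4⟩ := hW
  refine mul_left_cancel₀ hxa ?_
  have e5 : bdry m ξ x = solK m k x * (solI' m k x * bdry m ξ x - solI m k x * bdry' m ξ x) +
      solI m k x * (solK m k x * bdry' m ξ x - solK' m k x * bdry m ξ x) := by
    linear_combination (-bdry m ξ x) * e2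
  rw [e4, e1] at e5
  linear_combination e5 - e3

end Weak

/-! ### Surjectivity -/

section Surjective

variable {m k : ℂ} {ξ : ℝ → ℝ}

theorem locallyIntegrableOn_of_memLp {h : ℝ → ℂ} (hh : MemLp h 2 halfMeasure) :
    LocallyIntegrableOn h (Ioi (0 : ℝ)) volume := by
  rw [locallyIntegrableOn_iff (isOpen_Ioi.isLocallyClosed)]
  intro K hK hKc
  have h1 : MemLp h 2 (volume.restrict K) := hh.mono_measure (Measure.restrict_mono hK le_rfl)
  have : IsFiniteMeasure (volume.restrict K) := ⟨by simpa using hKc.measure_lt_top⟩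
  exact h1.integrable (by norm_num)

theorem ae_eq_zero_of_orthogonal (hm : -1 < m.re) (hk : 0 < k.re) (hξ : IsCutoff ξ) {h : ℝ → ℂ}
    (hh : MemLp h 2 halfMeasure)
    (h1 : ∀ φ : 𝓓(halfLine, ℂ),
      ∫ x in Ioi (0 : ℝ), h x * (k ^ 2 * φ x + diffExpr (m ^ 2) φ x) = 0)
    (h2 : ∫ x in Ioi (0 : ℝ), h x * (besselPotential m k x * bdry m ξ x -
      (-bdryImage m ξ x + (-1 / 4 + m ^ 2) / (x : ℂ) ^ 2 * bdry m ξ x)) = 0) :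
    h =ᵐ[halfMeasure] fun _ => 0 := by
  obtain ⟨a, b, hab⟩ := exists_eq_of_weak_solution hm hk (locallyIntegrableOn_of_memLp hh) h1
  have hsub : Ioi (1 : ℝ) ⊆ Ioi 0 := Ioi_subset_Ioi zero_le_one
  have hle : volume.restrict (Ioi (1 : ℝ)) ≤ halfMeasure := Measure.restrict_mono hsub le_rfl
  have ha : a = 0 := by
    by_contra ha
    refine not_memLp_solI hm hk ?_
    have hK : MemLp (solK m k) 2 (volume.restrict (Ioi 1)) := by
      have := (memLp_indicator_solK m hk one_pos).mono_measure hle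
      refine this.ae_eq ?_
      filter_upwards [ae_restrict_mem measurableSet_Ioi] with x hx
      rw [indicator_of_mem hx]
    have h3 := ((hh.mono_measure hle).sub (hK.const_mul b)).const_mul a⁻¹
    refine h3.ae_eq ?_
    filter_upwards [ae_mono hle hab] with x hx
    rw [Pi.sub_apply, hx]
    field_simp
    ring
  subst ha
  have hb : b = 0 := by
    by_contra hb
    have hK : MemLp (solK m k) 2 halfMeasure := by
      refine (hh.const_mul b⁻¹).ae_eq ?_
      filter_upwards [hab] with x hx
      rw [hx]
      field_simp
      ring
    refine integral_solK_mul_ne_zero hm hk hξ hK ?_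
    have e : ∫ x in Ioi (0 : ℝ), h x * (besselPotential m k x * bdry m ξ x -
        (-bdryImage m ξ x + (-1 / 4 + m ^ 2) / (x : ℂ) ^ 2 * bdry m ξ x)) =
        b * ∫ x in Ioi (0 : ℝ), solK m k x * (besselPotential m k x * bdry m ξ x -
        (-bdryImage m ξ x + (-1 / 4 + m ^ 2) / (x : ℂ) ^ 2 * bdry m ξ x)) := by
      rw [← integral_const_mul]
      refine integral_congr_ae ?_
      filter_upwards [hab] with x hx
      rw [hx]
      ring
    rw [e] at h2
    exact (mul_eq_zero.1 h2).resolve_left hb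
  subst hb
  filter_upwards [hab] with x hx
  rw [hx]
  simp

theorem prod_mem_graphH {R : L2 →L[ℂ] L2} (hR : HasIntegralKernel R (resolventKernel m k))
    (hm : -1 < m.re) (hk : 0 < k.re) (hξ : IsCutoff ξ) (f : L2) :
    (R f, f - k ^ 2 • R f) ∈ graphH hm hξ := by
  let J : L2 →L[ℂ] L2 × L2 := R.prod (ContinuousLinearMap.id ℂ L2 - k ^ 2 • R)
  let S : Submodule ℂ L2 := (graphH hm hξ).comap J.toLinearMap
  have hSc : IsClosed (S : Set L2) := (isClosed_graphH hm hξ).preimage J.continuous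
  have hS : ∀ p ∈ graphH hm hξ, k ^ 2 • p.1 + p.2 ∈ S := fun p hp => by
    have e : J (k ^ 2 • p.1 + p.2) = p := by
      change (R (k ^ 2 • p.1 + p.2), k ^ 2 • p.1 + p.2 - k ^ 2 • R (k ^ 2 • p.1 + p.2)) = p
      rw [kernel_operator_graphH hR hm hk hξ hp, add_sub_cancel_left]
    change J (k ^ 2 • p.1 + p.2) ∈ graphH hm hξ
    rwa [e]
  suffices h : S = ⊤ by
    have : f ∈ S := h ▸ Submodule.mem_top
    exact this
  have : CompleteSpace S := hSc.completeSpace_coe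
  rw [← Submodule.orthogonal_eq_bot_iff, Submodule.eq_bot_iff]
  intro g hg
  have hh : MemLp (fun x => star (g x)) 2 halfMeasure := (Lp.memLp g).star
  have horth : ∀ p ∈ graphH hm hξ, ∀ w : ℝ → ℂ,
      (k ^ 2 • p.1 + p.2 : L2) =ᵐ[halfMeasure] w →
        ∫ x in Ioi (0 : ℝ), star (g x) * w x = 0 := fun p hp w hw => by
    have h1 := Submodule.inner_left_of_mem_orthogonal (hS p hp) hg
    rw [L2.inner_def] at h1
    rw [← h1]
    refine integral_congr_ae ?_
    filter_upwards [hw] with x hx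
    rw [← hx]
    simp [mul_comm]
  have key := ae_eq_zero_of_orthogonal hm hk hξ hh (fun φ => ?_)
    (horth _ (Submodule.mem_sup_right (Submodule.mem_span_singleton_self _)) _
      (smul_bdryPair_add_coeFn k hm hξ))
  · refine Lp.ext ?_
    filter_upwards [key, Lp.coeFn_zero ℂ 2 halfMeasure] with x hx h0
    rw [h0, Pi.zero_apply]
    exact star_eq_zero.1 hx
  · have hp : ((memLp_testFunction φ).toLp _, (memLp_diffExpr φ (m ^ 2)).toLp _) ∈
        coreGraph (m ^ 2) :=
      ⟨φ, (memLp_testFunction φ).coeFn_toLp, (memLp_diffExpr φ (m ^ 2)).coeFn_toLp⟩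
    refine horth _ (Submodule.mem_sup_left (Submodule.le_topologicalClosure _ hp)) _ ?_
    filter_upwards [Lp.coeFn_add (k ^ 2 • (memLp_testFunction φ).toLp _)
      ((memLp_diffExpr φ (m ^ 2)).toLp _), Lp.coeFn_smul (k ^ 2) ((memLp_testFunction φ).toLp _),
      (memLp_testFunction φ).coeFn_toLp, (memLp_diffExpr φ (m ^ 2)).coeFn_toLp]
      with x e1 e2 e3 e4
    rw [e1, Pi.add_apply, e2, Pi.smul_apply, e3, e4, smul_eq_mul]

end Surjective

end BesselOp

end

theorem mainTheorem5 (m : ℂ) (hm : -1 < m.re) (ξ : ℝ → ℝ) (hξ : BesselOp.IsCutoff ξ)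
    (k : ℂ) (hk : 0 < k.re) :
    ∃ R : BesselOp.L2 →L[ℂ] BesselOp.L2,
      BesselOp.IsBoundedInverse (BesselOp.H m ξ) (k ^ 2) R ∧
      BesselOp.HasIntegralKernel R (BesselOp.resolventKernel m k) := by
  obtain ⟨R, hR⟩ := BesselOp.exists_hasIntegralKernel_resolventKernel hm hk
  refine ⟨R, ⟨fun u => BesselOp.kernel_operator_graphH hR hm hk hξ
    (BesselOp.mem_graphH_of_mem_domain hm hξ u), fun f => ?_⟩, hR⟩
  obtain ⟨u, hu1, hu2⟩ :=
    BesselOp.exists_domain_of_mem_graphH hm hξ (BesselOp.prod_mem_graphH hR hm hk hξ f)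
  refine ⟨u, hu1, ?_⟩
  rw [hu2, hu1]
  exact add_sub_cancel _ _
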